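/- Let $\hbar\in\mathbb C$ with $e^{\hbar}\ne\pm1$; put $q=e^{\hbar}$ and $q^z=e^{\hbar z}$ for $z\in\mathbb C$. Write $\mathbb Z_2=\mathbb Z/2\mathbb Z$ and $|v|\in\mathbb Z_2$ for the parity of $v$. **The category.** Let $U=U_q^E(\mathfrak{gl}(1|1))$ be the complex Hopf superalgebra with even generators $E,G,K^{\pm1}$ and odd generators $X,Y$; $K^{\pm1}$ and $E$ are central, $[G,X]=X$, $[G,Y]=-Y$, $XY+YX=\frac{K-K^{-1}}{q-q^{-1}}$, $X^2=Y^2=0$; $\Delta E=E\otimes1+1\otimes E$, $\Delta G=G\otimes 1+1\otimes G$, $\Delta K=K\otimes K$, $\Delta X=X\otimes K^{-1}+1\otimes X$, $\Delta Y=Y\otimes 1+K\otimes Y$; $S(E)=-E$, $S(G)=-G$, $S(K)=K^{-1}$, $S(X)=-XK$, $S(Y)=-YK^{-1}$. Let $\mathcal D^{q,\mathrm{int}}$ be the category of finite dimensional $U$-supermodules that are direct sums of simultaneous eigenspaces of $E$ and $G$ (weights $(\lambda_E,\lambda_G)$), with all $\lambda_G\in\mathbb Z$ and $K=q^{\lambda_E}$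 on the space of weight $\lambda$; morphisms are the even $U$-linear maps. It is a $\mathbb C$-linear ribbon category: $(xf)(v)=(-1)^{|x||f|}f(S(x)v)$ on $V^*$; the left and right evaluations are $f\otimes v\mapsto f(v)$ and $\overrightarrow{\mathrm{ev}}_V(v\otimes f)=(-1)^{|f||v|}f(Kv)$, and $\overleftarrow{\mathrm{coev}}_V(1)=\sum_i v_i\otimes v_i^*$; $c_{V,W}=\tau\circ\tilde R\circ\Upsilon$ with $\Upsilon(v\otimes w)=q^{-\lambda_E\mu_G-\lambda_G\mu_E}v\otimes w$ for $v,w$ of weights $\lambda,\mu$, $\tilde R$ the multiplication by $1+(q-q^{-1})(X\otimes Y)(K\otimes K^{-1})$ and $\tau$ the super flip; the twist $\theta_V$ is the right partial trace of $c_{V,V}$. For $\lambda\in\frac{\pi i}{\hbar}\mathbb Z$, $n\in\mathbb Z$, $p\in\mathbb Z_2$ let $\varepsilon(\lambda,n)_p$ be the one dimensional module of weight $(\lambda,n)$ and parity $p$ (with $X=Y=0$). For $\alpha\in\mathbb C$, $a\in\mathbb Z$ let $V(\alpha,a)_p$ have basis $v$, $v'=Yv$, with $v$ of parity $p$ and weight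 $(\alpha,a)$, $Xv=0$ and $Xv'=\frac{q^\alpha-q^{-\alpha}}{q-q^{-1}}v$. **Relative modular categories.** Let $\mathcal C$ be a $\Bbbk$-linear ribbon category ($\otimes$ bilinear, $\mathbb I$ simple, $\Bbbk\cong\operatorname{End}\mathbb I$). An object $P$ is projective if every epimorphism $V\to P$ splits; $V$ is regular if $V^*\otimes V\to\mathbb I$ is epi. A family $(V_j)_{j\in J}$ dominates a full subcategory if for each object $V$ of it $\mathrm{Id}_V$ is a finite sum of maps $V\to V_j\to V$; it is completely reduced if $\dim\operatorname{Hom}(V_i,V_j)=\delta_{ij}$. An object $V$ is indecomposable if whenever $V=\bigoplus_{i\in I}V_i$ with $I$ finite there is a unique $i$ with $V\simeq V_i$ and $V_j=0$ for all $j\neq i$. Let $\mathsf G,\mathsf Z$ be abelian groups and $\mathsf X\subset\mathsf G$ symmetric ($\mathsf X=-\mathsf X$) and small (no finite union of translates of $\mathsf X$ is $\mathsf G$). $\mathcal C$ is *modular over $\mathsf G$ relative to $(\mathsf Z,\mathsf X)$ with parameter $\zeta\in\Bbbk^\times$* if it is given with 1. a $\mathsf G$-grading $\mathcal C\simeq\bigoplus_{g}\mathcal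 C_g$ by full subcategories, with $\mathbb I\in\mathcal C_0$, $\mathcal C_g^*\subset\mathcal C_{-g}$, $\mathcal C_g\otimes\mathcal C_h\subset\mathcal C_{g+h}$; 2. a monoidal functor $\sigma$ from the discrete monoidal category $\mathsf Z$ to $\mathcal C_0$ with $\sigma(0)=\mathbb I$, $\operatorname{qdim}\sigma(k)=\pm1$, $\theta_{\sigma(k)}=\mathrm{Id}$ and, for $V$ simple, $V\otimes\sigma(k)\simeq V$ iff $k=0$; 3. a non-zero modified trace $\mathsf t$ on the ideal of projectives (linear maps $\mathsf t_V:\operatorname{End}(V)\to\Bbbk$ with $\mathsf t_V(fg)=\mathsf t_W(gf)$ and $\mathsf t_{V\otimes W}(f)=\mathsf t_V(\operatorname{ptr}_W f)$), with modified dimension $\mathsf d(V)=\mathsf t_V(\mathrm{Id}_V)$; such that there is a bilinear $\psi:\mathsf G\times\mathsf Z\to\Bbbk^\times$ with $c_{\sigma(k),V}c_{V,\sigma(k)}=\psi(g,k)\mathrm{Id}_{V\otimes\sigma(k)}$ for $V\in\mathcal C_g$, and, for every $g\in\mathsf G\setminus\mathsf X$, a finite set $\{V_i\}_{i\in I_g}$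 of regular simple (automatically projective) objects of $\mathcal C_g$ such that $(V_i\otimes\sigma(k))_{i\in I_g,\,k\in\mathsf Z}$ is a completely reduced dominating family for $\mathcal C_g$, and such that, for all $g,h\in\mathsf G\setminus\mathsf X$ and $i,j\in I_g$, $$\mathsf d(V_i)\sum_{k\in I_h}\mathsf d(V_k)\,\Phi_{V_k,\,V_i\otimes V_j^*}=\zeta\,\delta_{ij}\;\overleftarrow{\mathrm{coev}}_{V_i}\circ\overrightarrow{\mathrm{ev}}_{V_i},\qquad \Phi_{V,V'}=\operatorname{ptr}_V(c_{V,V'}c_{V',V})\in\operatorname{End}(V').$$ It is *TQFT finite* if (F1) for every $g$ there are finitely many projective indecomposables $P_j\in\mathcal C_g$ such that each projective indecomposable of $\mathcal C_g$ is isomorphic to some $P_j\otimes\sigma(k)$; (F2) for every projective $P$, $\operatorname{Hom}(\sigma(k),P)$ is finite dimensional for all $k$ and non-zero for only finitely many $k$; (F3) the projectives are dominated by the projective indecomposables. **Theorem.** Normalize the modified trace by $\mathsf d(V(1,0)_0)=(q-q^{-1})^{-1}$ and let $\mathsf Z=\mathbb Z\times\mathbb Z\times\mathbb Z_2$. (a)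 With $\mathsf G=\mathbb C/\frac{2\pi i}{\hbar}\mathbb Z$, the grading by the classes of $E$-weights, and $\sigma(n,n',p)=\varepsilon(\frac{2\pi i n}{\hbar},n')_p$, the category $\mathcal D^{q,\mathrm{int}}$ is modular over $\mathsf G$ relative to $(\mathsf Z,\ \frac{\pi i}{\hbar}\mathbb Z/\frac{2\pi i}{\hbar}\mathbb Z)$ with parameter $\zeta=-1$, and it is TQFT finite. (b) Let $r\ge3$ be odd and $\hbar=\frac{2\pi i}{r}$, so that $q=e^{2\pi i/r}$. With $\mathsf G=\mathbb C/\mathbb Z$, the grading by the classes of $E$-weights, and $\sigma(n,n',p)=\varepsilon(nr,n'r)_p$, the category $\mathcal D^{q,\mathrm{int}}$ is modular over $\mathsf G$ relative to $(\mathsf Z,\ \tfrac12\mathbb Z/\mathbb Z)$ with parameter $\zeta=-r^2$, and it is TQFT finite. -/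

import Mathlib

open CategoryTheory MonoidalCategory TensorProduct

set_option linter.unusedSectionVars false
set_option linter.unusedSimpArgs false
set_option linter.unusedVariables false

noncomputable section

namespace IntWeight

/-- The standing assumption `q = e ^ ħ ∉ {0, 1, -1}`. -/
class Admissible (ħ : ℂ) : Prop where
  exp_ne_one : Complex.exp ħ ≠ 1
  exp_ne_neg_one : Complex.exp ħ ≠ -1

/-- `q ^ z = e ^ (ħ z)`. -/
def qpow (ħ z : ℂ) : ℂ := Complex.exp (ħ * z)

lemma qpow_add (ħ a b : ℂ) : qpow ħ (a + b) = qpow ħ a * qpow ħ b := by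
  simp [qpow, mul_add, Complex.exp_add]

lemma qpow_zero (ħ : ℂ) : qpow ħ 0 = 1 := by simp [qpow]

@[simp] lemma qpow_ne_zero (ħ a : ℂ) : qpow ħ a ≠ 0 := Complex.exp_ne_zero _

lemma qpow_neg (ħ a : ℂ) : qpow ħ (-a) = (qpow ħ a)⁻¹ := by
  simp [qpow, Complex.exp_neg]

lemma qpow_sub (ħ a b : ℂ) : qpow ħ (a - b) = qpow ħ a * (qpow ħ b)⁻¹ := by
  rw [sub_eq_add_neg, qpow_add, qpow_neg]

/-- The scalar `q - q⁻¹`. -/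
def qdiff (ħ : ℂ) : ℂ := qpow ħ 1 - qpow ħ (-1)

@[simp] lemma qdiff_ne_zero (ħ : ℂ) [h : Admissible ħ] : qdiff ħ ≠ 0 := by
  intro h0
  have h1 : qpow ħ 1 = Complex.exp ħ := by simp [qpow]
  rw [qdiff, qpow_neg, sub_eq_zero, h1] at h0
  have h2 : Complex.exp ħ * Complex.exp ħ = 1 := by
    nth_rewrite 1 [h0]
    exact inv_mul_cancel₀ (Complex.exp_ne_zero ħ)
  rcases mul_self_eq_one_iff.mp h2 with h3 | h3
  · exact h.exp_ne_one h3
  · exact h.exp_ne_neg_one h3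

/-- `q ^ T` for a diagonalizable operator `T` on a finite dimensional space: the polynomial in `T`
which interpolates `z ↦ q ^ z` at the eigenvalues of `T`. -/
def qpowEnd (ħ : ℂ) {V : Type*} [AddCommGroup V] [Module ℂ V] (T : Module.End ℂ V) :
    Module.End ℂ V :=
  Polynomial.aeval T (Lagrange.interpolate (minpoly ℂ T).roots.toFinset id (qpow ħ))

lemma qpowEnd_apply (ħ : ℂ) {V : Type*} [AddCommGroup V] [Module ℂ V] [Module.Finite ℂ V]
    {T : Module.End ℂ V} {z : ℂ} {v : V} (h : T v = z • v) :
    qpowEnd ħ T v = qpow ħ z • v := by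
  by_cases hv : v = 0
  · simp [hv]
  have hev : T.HasEigenvector z v := ⟨Module.End.mem_eigenspace_iff.mpr h, hv⟩
  have hz : z ∈ (minpoly ℂ T).roots.toFinset := by
    rw [Multiset.mem_toFinset, Polynomial.mem_roots (minpoly.ne_zero (Algebra.IsIntegral.isIntegral T))]
    exact Module.End.isRoot_of_hasEigenvalue (Module.End.hasEigenvalue_of_hasEigenvector hev)
  rw [qpowEnd, Module.End.aeval_apply_of_hasEigenvector hev]
  congr 1
  exact Lagrange.eval_interpolate_at_node (v := id) (qpow ħ) (fun a _ b _ h => h) hz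

/-- The structure of a weight module with integral `G`-weights on `V`, over the unrolled quantum group
of `gl(1|1)`: the `ℤ₂`-grading of `V` is given by its parity involution `P` (`P v = (-1) ^ |v| v`),
`E`, `G` are even and `X`, `Y` are odd operators which satisfy the defining relations, where `K` and
`K⁻¹` act by `q ^ E` and `q ^ (-E)`, and `V` is the sum of its weight spaces, that is, of the
simultaneous eigenspaces of `E` and `G`, with eigenvalues in `ℤ` for `G`. -/
structure IntAction (ħ : ℂ) (V : Type*) [AddCommGroup V] [Module ℂ V] where
  P : Module.End ℂ V
  E : Module.End ℂ V
  G : Module.End ℂ V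
  X : Module.End ℂ V
  Y : Module.End ℂ V
  P_P : P * P = 1
  P_E : P * E = E * P
  P_G : P * G = G * P
  P_X : P * X = -(X * P)
  P_Y : P * Y = -(Y * P)
  E_X : E * X - X * E = 0
  E_Y : E * Y - Y * E = 0
  E_G : E * G - G * E = 0
  G_X : G * X - X * G = X
  G_Y : G * Y - Y * G = -Y
  X_Y : X * Y + Y * X =
    (qdiff ħ)⁻¹ • (qpowEnd ħ E - qpowEnd ħ (-E))
  X_X : X * X = 0
  Y_Y : Y * Y = 0
  weight : ⨆ (l : ℂ) (n : ℤ), E.eigenspace l ⊓ G.eigenspace (n : ℂ) = ⊤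

namespace IntAction

variable {ħ : ℂ} {V W U Z : Type*} [AddCommGroup V] [Module ℂ V]
  [AddCommGroup W] [Module ℂ W] [AddCommGroup U] [Module ℂ U]

/-- The action of `K`. -/
def K (M : IntAction ħ V) : Module.End ℂ V := qpowEnd ħ M.E
/-- The action of `K⁻¹`. -/
def Kinv (M : IntAction ħ V) : Module.End ℂ V := qpowEnd ħ (-M.E)

/-- `v` is homogeneous, with sign `s = (-1) ^ |v|`, and of weight `(l, n)`. -/
structure IsWt (M : IntAction ħ V) (s l : ℂ) (n : ℤ) (v : V) : Prop where
  sign : s = 1 ∨ s = -1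
  eP : M.P v = s • v
  eE : M.E v = l • v
  eG : M.G v = (n : ℂ) • v

variable [Module.Finite ℂ V] [Module.Finite ℂ W] [Module.Finite ℂ U]

variable {M : IntAction ħ V} {N : IntAction ħ W} {L : IntAction ħ U} {s l t m u k : ℂ} {n n' n'' : ℤ} {v : V} {w : W}
  {x : U}

lemma IsWt.eK (h : IsWt M s l n v) : M.K v = qpow ħ l • v := qpowEnd_apply ħ h.eE
lemma IsWt.eK' (h : IsWt M s l n v) : M.Kinv v = (qpow ħ l)⁻¹ • v := by
  rw [← qpow_neg]
  exact qpowEnd_apply ħ (by simp [h.eE])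

lemma IsWt.X (h : IsWt M s l n v) : IsWt M (-s) l (n + 1) (M.X v) where
  sign := by rcases h.sign with h | h <;> simp [h]
  eP := by
    have := LinearMap.congr_fun M.P_X v
    simpa [h.eP] using this
  eE := by
    have := LinearMap.congr_fun M.E_X v
    simpa [h.eE, sub_eq_zero] using this
  eG := by
    have := LinearMap.congr_fun M.G_X v
    simp only [LinearMap.sub_apply, Module.End.mul_apply, h.eG, map_smul, sub_eq_iff_eq_add] at this
    rw [this]; push_cast; module

lemma IsWt.Y (h : IsWt M s l n v) : IsWt M (-s) l (n - 1) (M.Y v) where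
  sign := by rcases h.sign with h | h <;> simp [h]
  eP := by
    have := LinearMap.congr_fun M.P_Y v
    simpa [h.eP] using this
  eE := by
    have := LinearMap.congr_fun M.E_Y v
    simpa [h.eE, sub_eq_zero] using this
  eG := by
    have := LinearMap.congr_fun M.G_Y v
    simp only [LinearMap.sub_apply, Module.End.mul_apply, h.eG, map_smul, sub_eq_iff_eq_add] at this
    rw [this]; push_cast; simp only [LinearMap.neg_apply]; module

lemma X_X_apply (v : V) : M.X (M.X v) = 0 := LinearMap.congr_fun M.X_X v
lemma Y_Y_apply (v : V) : M.Y (M.Y v) = 0 := LinearMap.congr_fun M.Y_Y v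

lemma IsWt.eXY (h : IsWt M s l n v) : M.X (M.Y v) =
    ((qdiff ħ)⁻¹ * (qpow ħ l - (qpow ħ l)⁻¹)) • v - M.Y (M.X v) := by
  have := LinearMap.congr_fun M.X_Y v
  rw [eq_sub_iff_add_eq]
  have h1 := h.eK
  have h2 := h.eK'
  simp only [K, Kinv] at h1 h2
  simp only [LinearMap.add_apply, Module.End.mul_apply, LinearMap.smul_apply, LinearMap.sub_apply,
    h1, h2, qpow_neg] at this
  rw [this]; module

lemma IsWt.sq (h : IsWt M s l n v) : s * s = 1 := by
  rcases h.sign with h | h <;> simp [h]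

theorem span_wt (M : IntAction ħ V) :
    Submodule.span ℂ {v : V | ∃ s l n, IsWt M s l n v} = ⊤ := by
  rw [eq_top_iff, ← M.weight]
  refine iSup_le fun l => iSup_le fun n => ?_
  intro v hv
  obtain ⟨h1, h2⟩ := hv
  rw [SetLike.mem_coe, Module.End.mem_eigenspace_iff] at h1 h2
  have hP : M.P (M.P v) = v := LinearMap.congr_fun M.P_P v
  have hE : M.E (M.P v) = l • M.P v := by
    rw [← map_smul, ← h1]; exact (LinearMap.congr_fun M.P_E v).symm
  have hG : M.G (M.P v) = (n : ℂ) • M.P v := by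
    rw [← map_smul, ← h2]; exact (LinearMap.congr_fun M.P_G v).symm
  have a : IsWt M 1 l n (v + M.P v) :=
    ⟨Or.inl rfl, by simp [hP, add_comm], by simp [h1, hE], by simp [h2, hG]⟩
  have b : IsWt M (-1) l n (v - M.P v) :=
    ⟨Or.inr rfl, by simp [hP], by simp [h1, hE, smul_sub], by simp [h2, hG, smul_sub]⟩
  have : v = (2⁻¹ : ℂ) • (v + M.P v) + (2⁻¹ : ℂ) • (v - M.P v) := by module
  rw [this]
  exact add_mem (Submodule.smul_mem _ _ (Submodule.subset_span ⟨_, _, _, a⟩))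
    (Submodule.smul_mem _ _ (Submodule.subset_span ⟨_, _, _, b⟩))

variable (M) in
theorem ext_wt {A : Type*} [AddCommGroup A] [Module ℂ A] {f g : V →ₗ[ℂ] A}
    (h : ∀ s l n v, IsWt M s l n v → f v = g v) : f = g := by
  refine LinearMap.ext_on_range (v := fun v : {v : V | ∃ s l n, IsWt M s l n v} => v.1)
    (by simpa using span_wt M) ?_
  rintro ⟨v, s, l, n, hv⟩
  exact h _ _ _ _ hv

variable (M N) in
theorem ext_wt₂ {A : Type*} [AddCommGroup A] [Module ℂ A]
    {f g : V ⊗[ℂ] W →ₗ[ℂ] A}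
    (h : ∀ s l n v, IsWt M s l n v → ∀ t m n' w, IsWt N t m n' w →
      f (v ⊗ₜ w) = g (v ⊗ₜ w)) : f = g := by
  apply TensorProduct.ext
  refine ext_wt M fun s l n v hv => ext_wt N fun t m n' w hw => ?_
  simpa using h s l n v hv t m n' w hw

variable (M N L) in
theorem ext_wt₃ {A : Type*} [AddCommGroup A] [Module ℂ A]
    {f g : (V ⊗[ℂ] W) ⊗[ℂ] U →ₗ[ℂ] A}
    (h : ∀ s l n v, IsWt M s l n v → ∀ t m n' w, IsWt N t m n' w →
      ∀ u k n'' x, IsWt L u k n'' x → f ((v ⊗ₜ w) ⊗ₜ x) = g ((v ⊗ₜ w) ⊗ₜ x)) : f = g := by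
  apply TensorProduct.ext
  refine ext_wt₂ M N fun s l n v hv t m n' w hw => ext_wt L fun u k n'' x hx => ?_
  simpa using h s l n v hv t m n' w hw u k n'' x hx

/-! Tensor product -/

section tensor

variable (M N)

/-- The parity of a tensor product. -/
def tP : Module.End ℂ (V ⊗[ℂ] W) := TensorProduct.map M.P N.P
/-- The action of `Δ E = E ⊗ 1 + 1 ⊗ E`. -/
def tE : Module.End ℂ (V ⊗[ℂ] W) :=
  TensorProduct.map M.E 1 + TensorProduct.map 1 N.E
/-- The action of `Δ G = G ⊗ 1 + 1 ⊗ G`. -/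
def tG : Module.End ℂ (V ⊗[ℂ] W) :=
  TensorProduct.map M.G 1 + TensorProduct.map 1 N.G
/-- The action of `Δ X = X ⊗ K⁻¹ + 1 ⊗ X`, where `(1 ⊗ X) (v ⊗ w) = (-1) ^ |v| v ⊗ X w`. -/
def tX : Module.End ℂ (V ⊗[ℂ] W) :=
  TensorProduct.map M.X N.Kinv + TensorProduct.map M.P N.X
/-- The action of `Δ Y = Y ⊗ 1 + K ⊗ Y`, where `(K ⊗ Y) (v ⊗ w) = (-1) ^ |v| K v ⊗ Y w`. -/
def tY : Module.End ℂ (V ⊗[ℂ] W) :=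
  TensorProduct.map M.Y 1 + TensorProduct.map (M.K * M.P) N.Y

variable {M N}

lemma tP_tmul (hv : IsWt M s l n v) (hw : IsWt N t m n' w) :
    tP M N (v ⊗ₜ w) = (s * t) • v ⊗ₜ w := by
  simp [tP, hv.eP, hw.eP, TensorProduct.smul_tmul', TensorProduct.tmul_smul, smul_smul, mul_comm]
lemma tE_tmul (hv : IsWt M s l n v) (hw : IsWt N t m n' w) :
    tE M N (v ⊗ₜ w) = (l + m) • v ⊗ₜ w := by
  simp [tE, hv.eE, hw.eE, TensorProduct.smul_tmul', TensorProduct.tmul_smul, add_smul]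
lemma tG_tmul (hv : IsWt M s l n v) (hw : IsWt N t m n' w) :
    tG M N (v ⊗ₜ w) = ((n + n' : ℤ) : ℂ) • v ⊗ₜ w := by
  simp [tG, hv.eG, hw.eG, TensorProduct.smul_tmul', TensorProduct.tmul_smul, add_smul]
lemma tX_tmul (hv : IsWt M s l n v) (hw : IsWt N t m n' w) :
    tX M N (v ⊗ₜ w) = (qpow ħ m)⁻¹ • M.X v ⊗ₜ w + s • v ⊗ₜ N.X w := by
  simp [tX, hv.eP, hw.eK', TensorProduct.smul_tmul', TensorProduct.tmul_smul]
lemma tY_tmul (hv : IsWt M s l n v) (_hw : IsWt N t m n' w) :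
    tY M N (v ⊗ₜ w) = M.Y v ⊗ₜ w + (s * qpow ħ l) • v ⊗ₜ N.Y w := by
  simp [tY, hv.eP, hv.eK, TensorProduct.smul_tmul', smul_smul]

/-- The tensor product of modules. -/
@[simps P E G X Y]
def tensor (M : IntAction ħ V) (N : IntAction ħ W) :
    IntAction ħ (V ⊗[ℂ] W) where
  P := tP M N
  E := tE M N
  G := tG M N
  X := tX M N
  Y := tY M N
  P_P := ext_wt₂ M N fun s l n v hv t m n' w hw => by
    simp only [Module.End.mul_apply, tP_tmul hv hw, map_smul, smul_smul, Module.End.one_apply]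
    rw [show s * t * (s * t) = (s * s) * (t * t) by ring, hv.sq, hw.sq]; simp
  P_E := ext_wt₂ M N fun s l n v hv t m n' w hw => by
    simp only [Module.End.mul_apply, tP_tmul hv hw, tE_tmul hv hw, map_smul]; module
  P_G := ext_wt₂ M N fun s l n v hv t m n' w hw => by
    simp only [Module.End.mul_apply, tP_tmul hv hw, tG_tmul hv hw, map_smul]; module
  P_X := ext_wt₂ M N fun s l n v hv t m n' w hw => by
    simp only [Module.End.mul_apply, LinearMap.neg_apply, tP_tmul hv hw, tX_tmul hv hw, map_smul,
      map_add, tP_tmul hv.X hw, tP_tmul hv hw.X]; module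
  P_Y := ext_wt₂ M N fun s l n v hv t m n' w hw => by
    simp only [Module.End.mul_apply, LinearMap.neg_apply, tP_tmul hv hw, tY_tmul hv hw, map_smul,
      map_add, tP_tmul hv.Y hw, tP_tmul hv hw.Y]; module
  E_X := ext_wt₂ M N fun s l n v hv t m n' w hw => by
    simp only [Module.End.mul_apply, LinearMap.sub_apply, tE_tmul hv hw, tX_tmul hv hw, map_smul,
      map_add, tE_tmul hv.X hw, tE_tmul hv hw.X, LinearMap.zero_apply]; module
  E_Y := ext_wt₂ M N fun s l n v hv t m n' w hw => by
    simp only [Module.End.mul_apply, LinearMap.sub_apply, tE_tmul hv hw, tY_tmul hv hw, map_smul,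
      map_add, tE_tmul hv.Y hw, tE_tmul hv hw.Y, LinearMap.zero_apply]; module
  E_G := ext_wt₂ M N fun s l n v hv t m n' w hw => by
    simp only [Module.End.mul_apply, LinearMap.sub_apply, tE_tmul hv hw, tG_tmul hv hw, map_smul,
      LinearMap.zero_apply]; module
  G_X := ext_wt₂ M N fun s l n v hv t m n' w hw => by
    simp only [Module.End.mul_apply, LinearMap.sub_apply, tG_tmul hv hw, tX_tmul hv hw, map_smul,
      map_add, tG_tmul hv.X hw, tG_tmul hv hw.X]; push_cast; module
  G_Y := ext_wt₂ M N fun s l n v hv t m n' w hw => by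
    simp only [Module.End.mul_apply, LinearMap.sub_apply, tG_tmul hv hw, tY_tmul hv hw, map_smul,
      map_add, tG_tmul hv.Y hw, tG_tmul hv hw.Y, LinearMap.neg_apply]; push_cast; module
  X_Y := ext_wt₂ M N fun s l n v hv t m n' w hw => by
    have h1 : qpowEnd ħ (tE M N) (v ⊗ₜ w) = qpow ħ (l + m) • v ⊗ₜ w :=
      qpowEnd_apply ħ (tE_tmul hv hw)
    have h2 : qpowEnd ħ (-tE M N) (v ⊗ₜ w) = qpow ħ (-(l + m)) • v ⊗ₜ w :=
      qpowEnd_apply ħ (by rw [LinearMap.neg_apply, tE_tmul hv hw, neg_smul])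
    simp only [Module.End.mul_apply, LinearMap.add_apply, LinearMap.smul_apply,
      LinearMap.sub_apply, h1, h2, tX_tmul hv hw, tY_tmul hv hw, map_smul, map_add,
      tX_tmul hv.Y hw, tX_tmul hv hw.Y, tY_tmul hv.X hw, tY_tmul hv hw.X, hv.eXY, hw.eXY,
      qpow_add, qpow_neg, TensorProduct.sub_tmul, TensorProduct.tmul_sub,
      ← TensorProduct.smul_tmul', TensorProduct.tmul_smul]
    have a := qpow_ne_zero ħ l
    have b := qpow_ne_zero ħ m
    rcases hv.sign with rfl | rfl <;> match_scalars <;> field_simp <;> ring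
  X_X := ext_wt₂ M N fun s l n v hv t m n' w hw => by
    simp only [Module.End.mul_apply, tX_tmul hv hw, map_smul, map_add, tX_tmul hv.X hw,
      tX_tmul hv hw.X, X_X_apply, LinearMap.zero_apply, TensorProduct.zero_tmul,
      TensorProduct.tmul_zero]; module
  Y_Y := ext_wt₂ M N fun s l n v hv t m n' w hw => by
    simp only [Module.End.mul_apply, tY_tmul hv hw, map_smul, map_add, tY_tmul hv.Y hw,
      tY_tmul hv hw.Y, Y_Y_apply, LinearMap.zero_apply, TensorProduct.zero_tmul,
      TensorProduct.tmul_zero]; module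
  weight := by
    set S := ⨆ (l : ℂ) (n : ℤ), (tE M N).eigenspace l ⊓ (tG M N).eigenspace (n : ℂ)
    have : S.mkQ = 0 := ext_wt₂ M N fun s l n v hv t m n' w hw => by
      rw [LinearMap.zero_apply, Submodule.mkQ_apply, Submodule.Quotient.mk_eq_zero]
      refine Submodule.mem_iSup_of_mem (l + m) (Submodule.mem_iSup_of_mem (n + n') ⟨?_, ?_⟩)
      · exact Module.End.mem_eigenspace_iff.mpr (tE_tmul hv hw)
      · exact Module.End.mem_eigenspace_iff.mpr (tG_tmul hv hw)
    rw [← S.ker_mkQ, this, LinearMap.ker_zero]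

end tensor

end IntAction
end IntWeight

namespace IntWeight
namespace IntAction

variable {ħ : ℂ} {V W U V' W' : Type*} [AddCommGroup V] [Module ℂ V]
  [AddCommGroup W] [Module ℂ W] [AddCommGroup U] [Module ℂ U]
  [AddCommGroup V'] [Module ℂ V'] [AddCommGroup W'] [Module ℂ W']
variable [Module.Finite ℂ V] [Module.Finite ℂ W] [Module.Finite ℂ U]
  [Module.Finite ℂ V'] [Module.Finite ℂ W']
variable {M : IntAction ħ V} {N : IntAction ħ W} {L : IntAction ħ U} {M' : IntAction ħ V'}
  {N' : IntAction ħ W'}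
  {s l t m u k : ℂ} {n n' n'' : ℤ} {v : V} {w : W} {x : U}

lemma IsWt.tmul (hv : IsWt M s l n v) (hw : IsWt N t m n' w) :
    IsWt (tensor M N) (s * t) (l + m) (n + n') (v ⊗ₜ[ℂ] w) where
  sign := by rcases hv.sign with rfl | rfl <;> rcases hw.sign with rfl | rfl <;> simp
  eP := tP_tmul hv hw
  eE := tE_tmul hv hw
  eG := tG_tmul hv hw

/-- The space of degree `0̄` linear maps which commute with the actions of `E`, `G`, `X`, `Y` (and
hence of `K`). -/
def homs (M : IntAction ħ V) (N : IntAction ħ W) : Submodule ℂ (V →ₗ[ℂ] W) where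
  carrier := {f | f ∘ₗ M.P = N.P ∘ₗ f ∧ f ∘ₗ M.E = N.E ∘ₗ f ∧ f ∘ₗ M.G = N.G ∘ₗ f ∧
    f ∘ₗ M.X = N.X ∘ₗ f ∧ f ∘ₗ M.Y = N.Y ∘ₗ f}
  add_mem' := by
    rintro f g ⟨h1, h2, h3, h4, h5⟩ ⟨k1, k2, k3, k4, k5⟩
    simp [LinearMap.add_comp, LinearMap.comp_add, *]
  zero_mem' := by simp
  smul_mem' := by
    rintro c f ⟨h1, h2, h3, h4, h5⟩
    simp [LinearMap.smul_comp, LinearMap.comp_smul, *]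

lemma id_mem : LinearMap.id ∈ homs M M := by simp [homs]

lemma comp_mem {f : V →ₗ[ℂ] W} {g : W →ₗ[ℂ] U} (hf : f ∈ homs M N) (hg : g ∈ homs N L) :
    g ∘ₗ f ∈ homs M L := by
  obtain ⟨h1, h2, h3, h4, h5⟩ := hf
  obtain ⟨k1, k2, k3, k4, k5⟩ := hg
  refine ⟨?_, ?_, ?_, ?_, ?_⟩ <;>
  simp only [LinearMap.comp_assoc, *] <;> simp only [← LinearMap.comp_assoc, *]

lemma symm_mem {e : V ≃ₗ[ℂ] W} (h : e.toLinearMap ∈ homs M N) : e.symm.toLinearMap ∈ homs N M := by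
  have key : ∀ (A : Module.End ℂ V) (B : Module.End ℂ W),
      e.toLinearMap ∘ₗ A = B ∘ₗ e.toLinearMap →
      e.symm.toLinearMap ∘ₗ B = A ∘ₗ e.symm.toLinearMap := by
    intro A B hAB
    ext v
    apply e.injective
    have := LinearMap.congr_fun hAB (e.symm v)
    simpa using this.symm
  obtain ⟨h1, h2, h3, h4, h5⟩ := h
  exact ⟨key _ _ h1, key _ _ h2, key _ _ h3, key _ _ h4, key _ _ h5⟩

lemma hom_X {f : V →ₗ[ℂ] W} (hf : f ∈ homs M N) (v : V) : f (M.X v) = N.X (f v) :=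
  LinearMap.congr_fun hf.2.2.2.1 v
lemma hom_Y {f : V →ₗ[ℂ] W} (hf : f ∈ homs M N) (v : V) : f (M.Y v) = N.Y (f v) :=
  LinearMap.congr_fun hf.2.2.2.2 v

lemma IsWt.map (h : IsWt M s l n v) {f : V →ₗ[ℂ] W} (hf : f ∈ homs M N) :
    IsWt N s l n (f v) where
  sign := h.sign
  eP := by rw [← map_smul, ← h.eP]; exact (LinearMap.congr_fun hf.1 v).symm
  eE := by rw [← map_smul, ← h.eE]; exact (LinearMap.congr_fun hf.2.1 v).symm
  eG := by rw [← map_smul, ← h.eG]; exact (LinearMap.congr_fun hf.2.2.1 v).symm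

lemma IsWt.add (h : IsWt M s l n v) {v' : V} (h' : IsWt M s l n v') : IsWt M s l n (v + v') where
  sign := h.sign
  eP := by simp [h.eP, h'.eP]
  eE := by simp [h.eE, h'.eE]
  eG := by simp [h.eG, h'.eG]

lemma IsWt.smul (h : IsWt M s l n v) (c : ℂ) : IsWt M s l n (c • v) where
  sign := h.sign
  eP := by simp [h.eP, smul_comm c]
  eE := by simp [h.eE, smul_comm c]
  eG := by simp [h.eG, smul_comm c]

lemma IsWt.cast (h : IsWt M s l n v) {s' l' : ℂ} {m : ℤ} (hs : s = s') (hl : l = l') (hn : n = m) :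
    IsWt M s' l' m v := by subst hs hl hn; exact h

lemma mem_homs {f : V →ₗ[ℂ] W}
    (h : ∀ s l n v, IsWt M s l n v → IsWt N s l n (f v) ∧
      f (M.X v) = N.X (f v) ∧ f (M.Y v) = N.Y (f v)) : f ∈ homs M N :=
  ⟨ext_wt M fun s l n v hv => by simp [hv.eP, (h s l n v hv).1.eP],
   ext_wt M fun s l n v hv => by simp [hv.eE, (h s l n v hv).1.eE],
   ext_wt M fun s l n v hv => by simp [hv.eG, (h s l n v hv).1.eG],
   ext_wt M fun s l n v hv => (h s l n v hv).2.1,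
   ext_wt M fun s l n v hv => (h s l n v hv).2.2⟩

lemma mem_homs₂ {f : V ⊗[ℂ] W →ₗ[ℂ] U}
    (h : ∀ s l n v, IsWt M s l n v → ∀ t m n' w, IsWt N t m n' w →
      IsWt L (s * t) (l + m) (n + n') (f (v ⊗ₜ w)) ∧
      f (tX M N (v ⊗ₜ w)) = L.X (f (v ⊗ₜ w)) ∧ f (tY M N (v ⊗ₜ w)) = L.Y (f (v ⊗ₜ w))) :
    f ∈ homs (tensor M N) L :=
  ⟨ext_wt₂ M N fun s l n v hv t m n' w hw => by
      simp [tP_tmul hv hw, (h s l n v hv t m n' w hw).1.eP],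
   ext_wt₂ M N fun s l n v hv t m n' w hw => by
      simp [tE_tmul hv hw, (h s l n v hv t m n' w hw).1.eE],
   ext_wt₂ M N fun s l n v hv t m n' w hw => by
      have := (h s l n v hv t m n' w hw).1.eG
      simp only [LinearMap.comp_apply, tensor_G, tG_tmul hv hw, map_smul, this],
   ext_wt₂ M N fun s l n v hv t m n' w hw => (h s l n v hv t m n' w hw).2.1,
   ext_wt₂ M N fun s l n v hv t m n' w hw => (h s l n v hv t m n' w hw).2.2⟩

lemma assoc_mem (M : IntAction ħ V) (N : IntAction ħ W) (L : IntAction ħ U) :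
    (TensorProduct.assoc ℂ V W U).toLinearMap ∈
      homs (tensor (tensor M N) L) (tensor M (tensor N L)) := by
  refine ⟨?_, ?_, ?_, ?_, ?_⟩ <;>
    refine ext_wt₃ M N L fun s l n v hv t m n' w hw u k n'' x hx => ?_
  · have h1 := ((hv.tmul hw).tmul hx).eP
    have h2 := (hv.tmul (hw.tmul hx)).eP
    rw [LinearMap.comp_apply, h1, LinearMap.comp_apply, map_smul, mul_assoc]
    exact h2.symm
  · have h1 := ((hv.tmul hw).tmul hx).eE
    have h2 := (hv.tmul (hw.tmul hx)).eE
    rw [LinearMap.comp_apply, h1, LinearMap.comp_apply, map_smul, add_assoc]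
    exact h2.symm
  · have h1 := ((hv.tmul hw).tmul hx).eG
    have h2 := (hv.tmul (hw.tmul hx)).eG
    rw [LinearMap.comp_apply, h1, LinearMap.comp_apply, map_smul, add_assoc]
    exact h2.symm
  · simp only [LinearMap.comp_apply, tensor_X, tX_tmul (hv.tmul hw) hx, LinearEquiv.coe_coe,
      TensorProduct.assoc_tmul, tX_tmul hv (hw.tmul hx), tX_tmul hv hw, tX_tmul hw hx,
      TensorProduct.add_tmul, TensorProduct.tmul_add, ← TensorProduct.smul_tmul',
      TensorProduct.tmul_smul, map_add, map_smul, qpow_add, mul_inv]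
    module
  · simp only [LinearMap.comp_apply, tensor_Y, tY_tmul (hv.tmul hw) hx, LinearEquiv.coe_coe,
      TensorProduct.assoc_tmul, tY_tmul hv (hw.tmul hx), tY_tmul hv hw, tY_tmul hw hx,
      TensorProduct.add_tmul, TensorProduct.tmul_add, ← TensorProduct.smul_tmul',
      TensorProduct.tmul_smul, map_add, map_smul, qpow_add, mul_inv]
    module

/-- The trivial module `ℂ`, on which the action is given by the counit. -/
@[simps P E G X Y]
def unit (ħ : ℂ) : IntAction ħ ℂ where
  P := 1
  E := 0
  G := 0
  X := 0
  Y := 0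
  P_P := by simp
  P_E := by simp
  P_G := by simp
  P_X := by simp
  P_Y := by simp
  E_X := by simp
  E_Y := by simp
  E_G := by simp
  G_X := by simp
  G_Y := by simp
  X_Y := by simp
  X_X := by simp
  Y_Y := by simp
  weight := by
    rw [eq_top_iff]
    intro v _
    refine Submodule.mem_iSup_of_mem 0 (Submodule.mem_iSup_of_mem 0 ⟨?_, ?_⟩) <;>
    simp

lemma isWt_unit (c : ℂ) : IsWt (unit ħ) 1 0 0 c := ⟨Or.inl rfl, by simp, by simp, by simp⟩

lemma lid_mem (M : IntAction ħ V) :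
    (TensorProduct.lid ℂ V).toLinearMap ∈ homs (tensor (unit ħ) M) M := by
  refine ⟨?_, ?_, ?_, ?_, ?_⟩ <;>
    refine TensorProduct.ext' fun c v => ?_
  · simp [tP]
  · simp [tE]
  · simp [tG]
  · simp [tX]
  · have := (isWt_unit (ħ := ħ) c).eK
    simp [qpow_zero] at this
    simp [tY, this]

lemma rid_mem (M : IntAction ħ V) :
    (TensorProduct.rid ℂ V).toLinearMap ∈ homs (tensor M (unit ħ)) M := by
  refine ⟨?_, ?_, ?_, ?_, ?_⟩ <;>
    refine TensorProduct.ext' fun v c => ?_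
  · simp [tP]
  · simp [tE]
  · simp [tG]
  · have := (isWt_unit (ħ := ħ) c).eK'
    simp [qpow_zero] at this
    simp [tX, this]
  · simp [tY]

lemma map_mem {f : V →ₗ[ℂ] V'} {g : W →ₗ[ℂ] W'} (hf : f ∈ homs M M') (hg : g ∈ homs N N') :
    TensorProduct.map f g ∈ homs (tensor M N) (tensor M' N') := by
  refine mem_homs₂ fun s l n v hv t m n' w hw => ⟨?_, ?_, ?_⟩
  · exact (hv.map hf).tmul (hw.map hg)
  · simp only [tX_tmul hv hw, TensorProduct.map_tmul, map_add, map_smul, tensor_X,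
      tX_tmul (hv.map hf) (hw.map hg), hom_X hf, hom_X hg]
  · simp only [tY_tmul hv hw, TensorProduct.map_tmul, map_add, map_smul, tensor_Y,
      tY_tmul (hv.map hf) (hw.map hg), hom_Y hf, hom_Y hg]

end IntAction
end IntWeight

namespace IntWeight
namespace IntAction

variable {ħ : ℂ} {V W U V' W' : Type*} [AddCommGroup V] [Module ℂ V]
  [AddCommGroup W] [Module ℂ W] [AddCommGroup U] [Module ℂ U]
  [AddCommGroup V'] [Module ℂ V'] [AddCommGroup W'] [Module ℂ W']
variable [Module.Finite ℂ V] [Module.Finite ℂ W] [Module.Finite ℂ U]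
  [Module.Finite ℂ V'] [Module.Finite ℂ W']
variable {M : IntAction ħ V} {N : IntAction ħ W} {L : IntAction ħ U} {M' : IntAction ħ V'}
  {N' : IntAction ħ W'}
  {s l t m u k : ℂ} {n n' n'' : ℤ} {v : V} {w : W} {x : U}

/-! Braiding -/

/-- The super flip `v ⊗ w ↦ (-1) ^ (|v| |w|) w ⊗ v`. -/
def superSwap (M : IntAction ħ V) (N : IntAction ħ W) : V ⊗[ℂ] W →ₗ[ℂ] W ⊗[ℂ] V :=
  (TensorProduct.comm ℂ V W).toLinearMap ∘ₗ ((1 / 2 : ℂ) • (TensorProduct.map 1 1 +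
    TensorProduct.map M.P 1 + TensorProduct.map 1 N.P - TensorProduct.map M.P N.P))

/-- The value of the sign `(-1) ^ (|v| |w|)` in terms of `s = (-1) ^ |v|` and `t = (-1) ^ |w|`. -/
def sgn (s t : ℂ) : ℂ := (1 / 2 : ℂ) * (1 + s + t - s * t)

lemma superSwap_tmul (hv : IsWt M s l n v) (hw : IsWt N t m n' w) :
    superSwap M N (v ⊗ₜ w) = sgn s t • w ⊗ₜ v := by
  simp only [superSwap, LinearMap.comp_apply, LinearMap.smul_apply, LinearMap.add_apply,
    LinearMap.sub_apply, TensorProduct.map_tmul, Module.End.one_apply, hv.eP, hw.eP, map_smul,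
    map_add, map_sub, LinearEquiv.coe_coe, TensorProduct.comm_tmul, ← TensorProduct.smul_tmul',
    TensorProduct.tmul_smul, sgn]
  module

/-- The operator `Υ`: `v ⊗ w ↦ q ^ (-λ_E μ_G - λ_G μ_E) v ⊗ w` for `v`, `w` of weights `λ`, `μ`. -/
def upsilon (M : IntAction ħ V) (N : IntAction ħ W) : Module.End ℂ (V ⊗[ℂ] W) :=
  qpowEnd ħ (-(TensorProduct.map M.E N.G + TensorProduct.map M.G N.E))

lemma upsilon_tmul (hv : IsWt M s l n v) (hw : IsWt N t m n' w) :
    upsilon M N (v ⊗ₜ w) = qpow ħ (-(l * n' + n * m)) • v ⊗ₜ w := by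
  refine qpowEnd_apply ħ ?_
  simp only [LinearMap.neg_apply, LinearMap.add_apply, TensorProduct.map_tmul, hv.eE, hv.eG,
    hw.eE, hw.eG, ← TensorProduct.smul_tmul', TensorProduct.tmul_smul]
  module

/-- The operator `R̃`: multiplication by `1 + (q - q⁻¹) (X ⊗ Y) (K ⊗ K⁻¹)`, where
`(X ⊗ Y) (v ⊗ w) = (-1) ^ |v| X v ⊗ Y w`. -/
def rTilde (M : IntAction ħ V) (N : IntAction ħ W) : Module.End ℂ (V ⊗[ℂ] W) :=
  1 + qdiff ħ • TensorProduct.map (M.X * M.P * M.K) (N.Y * N.Kinv)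

lemma rTilde_tmul (hv : IsWt M s l n v) (hw : IsWt N t m n' w) :
    rTilde M N (v ⊗ₜ w) = v ⊗ₜ w +
      (qdiff ħ * (s * qpow ħ l * (qpow ħ m)⁻¹)) • M.X v ⊗ₜ N.Y w := by
  simp only [rTilde, LinearMap.add_apply, Module.End.one_apply, LinearMap.smul_apply,
    TensorProduct.map_tmul, Module.End.mul_apply, hv.eK, hv.eP, hw.eK', map_smul,
    ← TensorProduct.smul_tmul', TensorProduct.tmul_smul]
  module

/-- The map `c_{V,W} = τ ∘ R̃ ∘ Υ`. -/
def braid (M : IntAction ħ V) (N : IntAction ħ W) : V ⊗[ℂ] W →ₗ[ℂ] W ⊗[ℂ] V :=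
  superSwap M N ∘ₗ rTilde M N ∘ₗ upsilon M N

lemma braid_tmul (hv : IsWt M s l n v) (hw : IsWt N t m n' w) :
    braid M N (v ⊗ₜ w) = qpow ħ (-(l * n' + n * m)) • (sgn s t • w ⊗ₜ v +
      (qdiff ħ * (s * qpow ħ l * (qpow ħ m)⁻¹) * sgn (-s) (-t)) • N.Y w ⊗ₜ M.X v) := by
  simp only [braid, LinearMap.comp_apply, upsilon_tmul hv hw, rTilde_tmul hv hw, map_smul, map_add,
    superSwap_tmul hv hw, superSwap_tmul hv.X hw.Y]
  module

/-- The inverse of `braid`. -/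
def braidInv (M : IntAction ħ V) (N : IntAction ħ W) : W ⊗[ℂ] V →ₗ[ℂ] V ⊗[ℂ] W :=
  qpowEnd ħ (TensorProduct.map M.E N.G + TensorProduct.map M.G N.E) ∘ₗ
    (1 - qdiff ħ • TensorProduct.map (M.X * M.P * M.K) (N.Y * N.Kinv)) ∘ₗ superSwap N M

lemma braidInv_tmul (hv : IsWt M s l n v) (hw : IsWt N t m n' w) :
    braidInv M N (w ⊗ₜ v) = sgn s t • (qpow ħ (l * n' + n * m) • (v ⊗ₜ w -
      (qdiff ħ * (s * qpow ħ l * (qpow ħ m)⁻¹) * (qpow ħ m * (qpow ħ l)⁻¹)) •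
        M.X v ⊗ₜ N.Y w)) := by
  have h1 : ∀ {s l : ℂ} {n : ℤ} {v : V}, IsWt M s l n v → ∀ {t m : ℂ} {n' : ℤ} {w : W},
      IsWt N t m n' w → qpowEnd ħ (TensorProduct.map M.E N.G + TensorProduct.map M.G N.E)
        (v ⊗ₜ w) = qpow ħ (l * n' + n * m) • v ⊗ₜ w := by
    intro s l n v hv t m n' w hw
    refine qpowEnd_apply ħ ?_
    simp only [LinearMap.add_apply, TensorProduct.map_tmul, hv.eE, hv.eG,
      hw.eE, hw.eG, ← TensorProduct.smul_tmul', TensorProduct.tmul_smul]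
    module
  have h2 : qpow ħ (l * ((n' - 1 : ℤ) : ℂ) + ((n + 1 : ℤ) : ℂ) * m) =
      qpow ħ (l * n' + n * m) * (qpow ħ m * (qpow ħ l)⁻¹) := by
    rw [← qpow_neg, ← qpow_add, ← qpow_add]; congr 1; push_cast; ring
  have h3 : sgn t s = sgn s t := by simp only [sgn]; ring
  simp only [braidInv, LinearMap.comp_apply, superSwap_tmul hw hv, map_smul, LinearMap.sub_apply,
    Module.End.one_apply, LinearMap.smul_apply, TensorProduct.map_tmul, Module.End.mul_apply, hv.eK,
    hv.eP, hw.eK', ← TensorProduct.smul_tmul', TensorProduct.tmul_smul, map_sub, h1 hv hw,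
    h1 hv.X hw.Y, h2, h3]
  module

lemma qpow_shift₁ (ħ l m : ℂ) (n n' : ℤ) : qpow ħ (-(l * ((n' - 1 : ℤ) : ℂ) + ((n + 1 : ℤ) : ℂ) * m))
    = qpow ħ (-(l * n' + n * m)) * (qpow ħ l * (qpow ħ m)⁻¹) := by
  rw [← qpow_neg, ← qpow_add, ← qpow_add]; congr 1; push_cast; ring

lemma qpow_shift₂ (ħ l m : ℂ) (n n' : ℤ) : qpow ħ (-(l * n' + ((n + 1 : ℤ) : ℂ) * m))
    = qpow ħ (-(l * n' + n * m)) * (qpow ħ m)⁻¹ := by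
  rw [← qpow_neg, ← qpow_add]; congr 1; push_cast; ring

lemma qpow_shift₃ (ħ l m : ℂ) (n n' : ℤ) : qpow ħ (-(l * n' + ((n - 1 : ℤ) : ℂ) * m))
    = qpow ħ (-(l * n' + n * m)) * (qpow ħ m) := by
  rw [← qpow_add]; congr 1; push_cast; ring

lemma qpow_shift₄ (ħ l m : ℂ) (n n' : ℤ) : qpow ħ (-(l * ((n' + 1 : ℤ) : ℂ) + n * m))
    = qpow ħ (-(l * n' + n * m)) * (qpow ħ l)⁻¹ := by
  rw [← qpow_neg, ← qpow_add]; congr 1; push_cast; ring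

lemma qpow_shift₅ (ħ l m : ℂ) (n n' : ℤ) : qpow ħ (-(l * ((n' - 1 : ℤ) : ℂ) + n * m))
    = qpow ħ (-(l * n' + n * m)) * (qpow ħ l) := by
  rw [← qpow_add]; congr 1; push_cast; ring

lemma qpow_shift₆ (ħ l m : ℂ) (n n' : ℤ) : qpow ħ (l * n' + n * m)
    = (qpow ħ (-(l * n' + n * m)))⁻¹ := by
  rw [← qpow_neg, neg_neg]

/-- The braiding as a linear equivalence. -/
def braidEquiv (M : IntAction ħ V) (N : IntAction ħ W) : V ⊗[ℂ] W ≃ₗ[ℂ] W ⊗[ℂ] V :=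
  LinearEquiv.ofLinearMap (braid M N) (braidInv M N)
    (ext_wt₂ N M fun t m n' w hw s l n v hv => by
      simp only [LinearMap.comp_apply, braidInv_tmul hv hw, map_smul, map_sub, braid_tmul hv hw,
        braid_tmul hv.X hw.Y, X_X_apply, Y_Y_apply, LinearMap.id_apply,
        TensorProduct.zero_tmul, TensorProduct.tmul_zero, qpow_shift₁, qpow_shift₆]
      rcases hv.sign with rfl | rfl <;> rcases hw.sign with rfl | rfl <;>
        simp only [sgn] <;> match_scalars <;> field_simp <;> ring)
    (ext_wt₂ M N fun s l n v hv t m n' w hw => by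
      simp only [LinearMap.comp_apply, braid_tmul hv hw, map_smul, map_add, braidInv_tmul hv hw,
        braidInv_tmul hv.X hw.Y, X_X_apply, Y_Y_apply, LinearMap.id_apply,
        TensorProduct.zero_tmul, TensorProduct.tmul_zero, qpow_shift₁, qpow_shift₆]
      rcases hv.sign with rfl | rfl <;> rcases hw.sign with rfl | rfl <;>
        simp only [sgn] <;> match_scalars <;> field_simp <;> ring)

lemma braid_mem [Admissible ħ] (M : IntAction ħ V) (N : IntAction ħ W) :
    (braidEquiv M N).toLinearMap ∈ homs (tensor M N) (tensor N M) := by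
  change braid M N ∈ _
  refine mem_homs₂ fun s l n v hv t m n' w hw => ⟨?_, ?_, ?_⟩
  · rw [braid_tmul hv hw]
    refine IsWt.smul (IsWt.add (IsWt.smul ?_ _) (IsWt.smul ?_ _)) _
    · exact (hw.tmul hv).cast (mul_comm _ _) (add_comm _ _) (add_comm _ _)
    · exact (hw.Y.tmul hv.X).cast (by ring) (add_comm _ _) (by ring)
  · simp only [tensor_X, tX_tmul hv hw, braid_tmul hv hw, braid_tmul hv.X hw, braid_tmul hv hw.X,
      map_add, map_smul, tX_tmul hw hv, tX_tmul hw.Y hv.X, X_X_apply, hw.eXY, TensorProduct.sub_tmul,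
      ← TensorProduct.smul_tmul', TensorProduct.tmul_zero, TensorProduct.zero_tmul, qpow_shift₂,
      qpow_shift₄]
    rcases hv.sign with rfl | rfl <;> rcases hw.sign with rfl | rfl <;>
        simp only [sgn] <;> match_scalars <;> field_simp <;> ring
  · simp only [tensor_Y, tY_tmul hv hw, braid_tmul hv hw, braid_tmul hv.Y hw, braid_tmul hv hw.Y,
      map_add, map_smul, tY_tmul hw hv, tY_tmul hw.Y hv.X, Y_Y_apply, hv.eXY, TensorProduct.tmul_sub,
      TensorProduct.tmul_smul, TensorProduct.tmul_zero, TensorProduct.zero_tmul, qpow_shift₃,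
      qpow_shift₅]
    rcases hv.sign with rfl | rfl <;> rcases hw.sign with rfl | rfl <;>
        simp only [sgn] <;> match_scalars <;> field_simp <;> ring

end IntAction
end IntWeight

namespace IntWeight
namespace IntAction

variable {ħ : ℂ} {V W U V' W' : Type*} [AddCommGroup V] [Module ℂ V]
  [AddCommGroup W] [Module ℂ W] [AddCommGroup U] [Module ℂ U]
  [AddCommGroup V'] [Module ℂ V'] [AddCommGroup W'] [Module ℂ W']
variable [Module.Finite ℂ V] [Module.Finite ℂ W] [Module.Finite ℂ U]
  [Module.Finite ℂ V'] [Module.Finite ℂ W']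
variable {M : IntAction ħ V} {N : IntAction ħ W} {L : IntAction ħ U} {M' : IntAction ħ V'}
  {N' : IntAction ħ W'}
  {s l t m u k : ℂ} {n n' n'' : ℤ} {v : V} {w : W} {x : U}

lemma braid_natural {f : V →ₗ[ℂ] V'} {g : W →ₗ[ℂ] W'} (hf : f ∈ homs M M') (hg : g ∈ homs N N') :
    braid M' N' ∘ₗ TensorProduct.map f g = TensorProduct.map g f ∘ₗ braid M N :=
  ext_wt₂ M N fun s l n v hv t m n' w hw => by
    simp only [LinearMap.comp_apply, TensorProduct.map_tmul, braid_tmul hv hw,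
      braid_tmul (hv.map hf) (hw.map hg), map_add, map_smul, hom_X hf, hom_Y hg]

lemma qpow_split₁ (ħ l m k : ℂ) (n n' n'' : ℤ) :
    qpow ħ (-(l * ((n' + n'' : ℤ) : ℂ) + n * (m + k))) =
      qpow ħ (-(l * n' + n * m)) * qpow ħ (-(l * n'' + n * k)) := by
  rw [← qpow_add]; congr 1; push_cast; ring

lemma qpow_split₂ (ħ l m k : ℂ) (n n' n'' : ℤ) :
    qpow ħ (-((l + m) * n'' + ((n + n' : ℤ) : ℂ) * k)) =
      qpow ħ (-(m * n'' + n' * k)) * qpow ħ (-(l * n'' + n * k)) := by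
  rw [← qpow_add]; congr 1; push_cast; ring

lemma hexagon_forward (M : IntAction ħ V) (N : IntAction ħ W) (L : IntAction ħ U) :
    (TensorProduct.assoc ℂ W U V).toLinearMap ∘ₗ braid M (tensor N L) ∘ₗ
      (TensorProduct.assoc ℂ V W U).toLinearMap =
    TensorProduct.map LinearMap.id (braid M L) ∘ₗ (TensorProduct.assoc ℂ W V U).toLinearMap ∘ₗ
      TensorProduct.map (braid M N) LinearMap.id :=
  ext_wt₃ M N L fun s l n v hv t m n' w hw u k n'' x hx => by
    simp only [LinearMap.comp_apply, LinearEquiv.coe_coe, TensorProduct.assoc_tmul,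
      braid_tmul hv (hw.tmul hx), TensorProduct.map_tmul, LinearMap.id_apply, braid_tmul hv hw,
      tensor_Y, tY_tmul hw hx, TensorProduct.add_tmul, TensorProduct.tmul_add,
      ← TensorProduct.smul_tmul', TensorProduct.tmul_smul, map_add, map_smul, braid_tmul hv hx,
      braid_tmul hv.X hx, X_X_apply, TensorProduct.tmul_zero, qpow_split₁, qpow_shift₂, qpow_add]
    have a := qpow_ne_zero ħ l
    have b := qpow_ne_zero ħ m
    have c := qpow_ne_zero ħ k
    rcases hv.sign with rfl | rfl <;> rcases hw.sign with rfl | rfl <;>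
      rcases hx.sign with rfl | rfl <;>
        simp only [sgn] <;> match_scalars <;> field_simp <;> ring

variable (M N L) in
theorem ext_wt₃' {A : Type*} [AddCommGroup A] [Module ℂ A]
    {f g : V ⊗[ℂ] (W ⊗[ℂ] U) →ₗ[ℂ] A}
    (h : ∀ s l n v, IsWt M s l n v → ∀ t m n' w, IsWt N t m n' w →
      ∀ u k n'' x, IsWt L u k n'' x → f (v ⊗ₜ (w ⊗ₜ x)) = g (v ⊗ₜ (w ⊗ₜ x))) : f = g := by
  apply TensorProduct.ext
  refine ext_wt M fun s l n v hv => ext_wt₂ N L fun t m n' w hw u k n'' x hx => ?_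
  simpa using h s l n v hv t m n' w hw u k n'' x hx

lemma hexagon_reverse (M : IntAction ħ V) (N : IntAction ħ W) (L : IntAction ħ U) :
    (TensorProduct.assoc ℂ U V W).symm.toLinearMap ∘ₗ braid (tensor M N) L ∘ₗ
      (TensorProduct.assoc ℂ V W U).symm.toLinearMap =
    TensorProduct.map (braid M L) LinearMap.id ∘ₗ
      (TensorProduct.assoc ℂ V U W).symm.toLinearMap ∘ₗ
      TensorProduct.map LinearMap.id (braid N L) :=
  ext_wt₃' M N L fun s l n v hv t m n' w hw u k n'' x hx => by
    simp only [LinearMap.comp_apply, LinearEquiv.coe_coe, TensorProduct.assoc_symm_tmul,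
      braid_tmul (hv.tmul hw) hx, TensorProduct.map_tmul, LinearMap.id_apply, braid_tmul hw hx,
      tensor_X, tX_tmul hv hw, TensorProduct.add_tmul, TensorProduct.tmul_add,
      ← TensorProduct.smul_tmul', TensorProduct.tmul_smul, map_add, map_smul, braid_tmul hv hx,
      braid_tmul hv hx.Y, Y_Y_apply, TensorProduct.zero_tmul, qpow_split₂, qpow_shift₅, qpow_add]
    have a := qpow_ne_zero ħ l
    have b := qpow_ne_zero ħ m
    have c := qpow_ne_zero ħ k
    rcases hv.sign with rfl | rfl <;> rcases hw.sign with rfl | rfl <;>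
      rcases hx.sign with rfl | rfl <;>
        simp only [sgn] <;> match_scalars <;> field_simp <;> ring

end IntAction
end IntWeight

namespace IntWeight
namespace IntAction

variable {ħ : ℂ} {V W U V' W' : Type*} [AddCommGroup V] [Module ℂ V]
  [AddCommGroup W] [Module ℂ W] [AddCommGroup U] [Module ℂ U]
  [AddCommGroup V'] [Module ℂ V'] [AddCommGroup W'] [Module ℂ W']
variable [Module.Finite ℂ V] [Module.Finite ℂ W] [Module.Finite ℂ U]
  [Module.Finite ℂ V'] [Module.Finite ℂ W']
variable {M : IntAction ħ V} {N : IntAction ħ W} {L : IntAction ħ U} {M' : IntAction ħ V'}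
  {N' : IntAction ħ W'}
  {s l t m u k : ℂ} {n n' n'' : ℤ} {v : V} {w : W} {x : U}

/-! Duals -/

/-- Functionals which are homogeneous and vanish on all weight spaces but one. -/
structure IsCoWt (M : IntAction ħ V) (s l : ℂ) (n : ℤ) (φ : Module.Dual ℂ V) : Prop where
  sign : s = 1 ∨ s = -1
  eP : ∀ v, φ (M.P v) = s * φ v
  eE : ∀ v, φ (M.E v) = l * φ v
  eG : ∀ v, φ (M.G v) = n * φ v

theorem span_cowt (M : IntAction ħ V) :
    Submodule.span ℂ {φ : Module.Dual ℂ V | ∃ s l n, IsCoWt M s l n φ} = ⊤ := by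
  classical
  let b := Module.Basis.ofSpan (span_wt M).ge
  have hb : ∀ i, ∃ s l n, IsWt M s l n (b i) :=
    fun i => Module.Basis.ofSpan_subset (span_wt M).ge ⟨i, rfl⟩
  have hfin : Fintype _ := Module.Basis.fintypeIndexOfRankLtAleph0 b (Module.rank_lt_aleph0 ℂ V)
  choose s l n h using hb
  have key : ∀ (A : Module.End ℂ V) (c : _ → ℂ), (∀ i, A (b i) = c i • b i) →
      ∀ i v, b.coord i (A v) = c i * b.coord i v := by
    intro A c hA i v
    have : b.coord i ∘ₗ A = c i • b.coord i := b.ext fun j => by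
      by_cases hij : j = i
      · subst hij; simp [hA]
      · simp [hA, hij]
    exact LinearMap.congr_fun this v
  rw [eq_top_iff]
  intro φ _
  rw [← b.sum_dual_apply_smul_coord φ]
  refine Submodule.sum_mem _ fun i _ => Submodule.smul_mem _ _ (Submodule.subset_span
    ⟨s i, l i, n i, (h i).sign, key _ _ (fun j => (h j).eP) i, key _ _ (fun j => (h j).eE) i,
      key _ _ (fun j => (h j).eG) i⟩)

variable (M) in
theorem ext_cowt {A : Type*} [AddCommGroup A] [Module ℂ A] {f g : Module.Dual ℂ V →ₗ[ℂ] A}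
    (h : ∀ s l n φ, IsCoWt M s l n φ → f φ = g φ) : f = g := by
  refine LinearMap.ext_on_range
    (v := fun v : {φ : Module.Dual ℂ V | ∃ s l n, IsCoWt M s l n φ} => v.1)
    (by simpa using span_cowt M) ?_
  rintro ⟨v, s, l, n, hv⟩
  exact h _ _ _ _ hv

lemma qpowEnd_dualMap (M : IntAction ħ V) : qpowEnd ħ M.E.dualMap = M.K.dualMap := by
  refine ext_cowt M fun s l n φ hφ => ?_
  have h : M.E.dualMap φ = l • φ := LinearMap.ext fun v => by simp [hφ.eE]
  rw [qpowEnd_apply ħ h]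
  refine ext_wt M fun t m k v hv => ?_
  rw [LinearMap.dualMap_apply, hv.eK, LinearMap.smul_apply, map_smul]
  by_cases h0 : φ v = 0
  · simp [h0]
  · have := hφ.eE v
    rw [hv.eE, map_smul, smul_eq_mul] at this
    rw [mul_right_cancel₀ h0 this]

lemma qpowEnd_neg_dualMap (M : IntAction ħ V) : qpowEnd ħ (-M.E.dualMap) = M.Kinv.dualMap := by
  refine ext_cowt M fun s l n φ hφ => ?_
  have h : (-M.E.dualMap) φ = (-l) • φ := LinearMap.ext fun v => by simp [hφ.eE]
  rw [qpowEnd_apply ħ h]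
  refine ext_wt M fun t m k v hv => ?_
  rw [LinearMap.dualMap_apply, hv.eK', LinearMap.smul_apply, map_smul, qpow_neg]
  by_cases h0 : φ v = 0
  · simp [h0]
  · have := hφ.eE v
    rw [hv.eE, map_smul, smul_eq_mul] at this
    rw [mul_right_cancel₀ h0 this]

/-- The dual module: `(x f) v = (-1) ^ (|x| |f|) f (S x v)`, where `S` is the antipode, so that
`S E = -E`, `S G = -G`, `S X = -X K`, `S Y = -Y K⁻¹`. -/
@[simps P E G X Y]
def dual (M : IntAction ħ V) : IntAction ħ (Module.Dual ℂ V) where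
  P := M.P.dualMap
  E := -M.E.dualMap
  G := -M.G.dualMap
  X := -(M.X * M.K).dualMap * M.P.dualMap
  Y := -(M.Y * M.Kinv).dualMap * M.P.dualMap
  P_P := LinearMap.ext fun φ => ext_wt M fun s l n v hv => by
    simp [hv.eP, ← mul_assoc, hv.sq]
  P_E := LinearMap.ext fun φ => ext_wt M fun s l n v hv => by
    simp [hv.eP, hv.eE]; ring
  P_G := LinearMap.ext fun φ => ext_wt M fun s l n v hv => by
    simp [hv.eP, hv.eG]; ring
  P_X := LinearMap.ext fun φ => ext_wt M fun s l n v hv => by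
    simp [hv.eP, hv.eK, hv.X.eP]; ring
  P_Y := LinearMap.ext fun φ => ext_wt M fun s l n v hv => by
    simp [hv.eP, hv.eK', hv.Y.eP]; ring
  E_X := LinearMap.ext fun φ => ext_wt M fun s l n v hv => by
    simp [hv.eE, hv.eK, hv.X.eP, hv.X.eE]; ring
  E_Y := LinearMap.ext fun φ => ext_wt M fun s l n v hv => by
    simp [hv.eE, hv.eK', hv.Y.eP, hv.Y.eE]; ring
  E_G := LinearMap.ext fun φ => ext_wt M fun s l n v hv => by
    simp [hv.eE, hv.eG]; ring
  G_X := LinearMap.ext fun φ => ext_wt M fun s l n v hv => by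
    simp [hv.eG, hv.eK, hv.X.eP, hv.X.eG]; ring
  G_Y := LinearMap.ext fun φ => ext_wt M fun s l n v hv => by
    simp [hv.eG, hv.eK', hv.Y.eP, hv.Y.eG]; ring
  X_Y := by
    rw [neg_neg, qpowEnd_dualMap, qpowEnd_neg_dualMap]
    refine LinearMap.ext fun φ => ext_wt M fun s l n v hv => ?_
    simp [hv.eK', hv.eK, hv.X.eP, hv.Y.eP, hv.X.eK', hv.Y.eK, hv.X.Y.eP, hv.Y.X.eP, hv.eXY, hv.eP]
    have a := qpow_ne_zero ħ l
    rcases hv.sign with rfl | rfl <;> field_simp <;> ring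
  X_X := LinearMap.ext fun φ => ext_wt M fun s l n v hv => by
    simp [hv.eK, hv.X.eP, hv.X.eK, X_X_apply]
  Y_Y := LinearMap.ext fun φ => ext_wt M fun s l n v hv => by
    simp [hv.eK', hv.Y.eP, hv.Y.eK', Y_Y_apply]
  weight := by
    rw [eq_top_iff, ← span_cowt M, Submodule.span_le]
    rintro φ ⟨s, l, n, h⟩
    refine Submodule.mem_iSup_of_mem (-l) (Submodule.mem_iSup_of_mem (-n) ⟨?_, ?_⟩) <;>
    rw [SetLike.mem_coe, Module.End.mem_eigenspace_iff] <;>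
    refine LinearMap.ext fun v => ?_ <;> simp [h.eE, h.eG]

lemma IsWt.cowt {φ : Module.Dual ℂ V} (h : IsWt (dual M) s l n φ) : IsCoWt M s (-l) (-n) φ where
  sign := h.sign
  eP v := LinearMap.congr_fun h.eP v
  eE v := by
    have := LinearMap.congr_fun h.eE v
    simp at this; simp [← this]
  eG v := by
    have := LinearMap.congr_fun h.eG v
    simp at this; simp [← this]

lemma IsCoWt.pair {φ : Module.Dual ℂ V} (h : IsCoWt M s l n φ) (hv : IsWt M t m n' v)
    (h0 : φ v ≠ 0) : s = t ∧ l = m ∧ n = n' := by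
  refine ⟨?_, ?_, ?_⟩
  · have := h.eP v
    rw [hv.eP, map_smul, smul_eq_mul] at this
    exact (mul_right_cancel₀ h0 this).symm
  · have := h.eE v
    rw [hv.eE, map_smul, smul_eq_mul] at this
    exact (mul_right_cancel₀ h0 this).symm
  · have := h.eG v
    rw [hv.eG, map_smul, smul_eq_mul] at this
    exact_mod_cast (mul_right_cancel₀ h0 this).symm

lemma contractLeft_mem (M : IntAction ħ V) :
    contractLeft ℂ V ∈ homs (tensor (dual M) M) (unit ħ) := by
  refine mem_homs₂ fun s l n φ hφ t m n' v hv => ⟨⟨?_, ?_, ?_, ?_⟩, ?_, ?_⟩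
  · rcases hv.sign with rfl | rfl <;> rcases hφ.sign with rfl | rfl <;> simp
  · rw [contractLeft_apply]
    by_cases h0 : φ v = 0
    · simp [h0]
    · obtain ⟨rfl, -, -⟩ := hφ.cowt.pair hv h0
      simp [hφ.sq]
  · rw [contractLeft_apply]
    by_cases h0 : φ v = 0
    · simp [h0]
    · obtain ⟨-, rfl, -⟩ := hφ.cowt.pair hv h0
      simp
  · rw [contractLeft_apply]
    by_cases h0 : φ v = 0
    · simp [h0]
    · obtain ⟨-, -, rfl⟩ := hφ.cowt.pair hv h0
      simp
  · rw [tX_tmul hφ hv, map_add, map_smul, map_smul, contractLeft_apply, contractLeft_apply]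
    simp only [dual_X, unit_X, LinearMap.zero_apply]
    simp [hv.eK, hφ.cowt.eP]
  · rw [tY_tmul hφ hv, map_add, map_smul, contractLeft_apply, contractLeft_apply]
    simp only [dual_Y, unit_Y, LinearMap.zero_apply]
    simp [hv.eK', hφ.cowt.eP]
    by_cases h0 : φ (M.Y v) = 0
    · simp [h0]
    · obtain ⟨-, rfl, -⟩ := hφ.cowt.pair hv.Y h0
      simp [qpow_neg]; ring

lemma map_coevaluation (A : Module.End ℂ V) :
    TensorProduct.map A 1 (coevaluation ℂ V 1) = TensorProduct.map 1 A.dualMap (coevaluation ℂ V 1) := by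
  have key : ∀ (b : Module.Basis (Module.Basis.ofVectorSpaceIndex ℂ V) ℂ V),
      TensorProduct.map A 1 (∑ i, b i ⊗ₜ[ℂ] b.coord i) =
      TensorProduct.map 1 A.dualMap (∑ i, b i ⊗ₜ[ℂ] b.coord i) := by
    intro b
    simp only [map_sum, TensorProduct.map_tmul, Module.End.one_apply]
    have h1 : ∀ i, A (b i) = ∑ j, b.coord j (A (b i)) • b j := fun i => (b.sum_repr _).symm
    have h2 : ∀ i, A.dualMap (b.coord i) = ∑ j, b.coord i (A (b j)) • b.coord j :=
      fun i => (b.sum_dual_apply_smul_coord (A.dualMap (b.coord i))).symm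
    have h3 : ∀ i, A (b i) ⊗ₜ[ℂ] b.coord i = ∑ j, b.coord j (A (b i)) • (b j ⊗ₜ[ℂ] b.coord i) := by
      intro i
      conv_lhs => rw [h1 i]
      rw [TensorProduct.sum_tmul]; rfl
    have h4 : ∀ i, b i ⊗ₜ[ℂ] A.dualMap (b.coord i) =
        ∑ j, b.coord i (A (b j)) • (b i ⊗ₜ[ℂ] b.coord j) := by
      intro i
      rw [h2 i, TensorProduct.tmul_sum]
      simp only [TensorProduct.tmul_smul]
    simp only [h3, h4]
    exact Finset.sum_comm
  have := key (Module.Basis.ofVectorSpace ℂ V)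
  simpa only [coevaluation_apply_one] using this

lemma map_coevaluation' (A B : Module.End ℂ V) :
    TensorProduct.map A B.dualMap (coevaluation ℂ V 1) =
      TensorProduct.map (A * B) 1 (coevaluation ℂ V 1) := by
  have h1 : TensorProduct.map A B.dualMap =
      TensorProduct.map A 1 * TensorProduct.map (1 : Module.End ℂ V) B.dualMap := by
    rw [← TensorProduct.map_mul]; simp
  rw [h1, Module.End.mul_apply, ← map_coevaluation, ← Module.End.mul_apply, ← TensorProduct.map_mul]
  simp

lemma dual_K (M : IntAction ħ V) : (dual M).K = M.Kinv.dualMap := qpowEnd_neg_dualMap M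
lemma dual_Kinv (M : IntAction ħ V) : (dual M).Kinv = M.K.dualMap := by
  rw [Kinv, dual_E, neg_neg, qpowEnd_dualMap]

lemma coevaluation_mem (M : IntAction ħ V) :
    coevaluation ℂ V ∈ homs (unit ħ) (tensor M (dual M)) := by
  have key : ∀ A B : Module.End ℂ V, TensorProduct.map A (-B.dualMap) (coevaluation ℂ V 1) =
      -TensorProduct.map (A * B) 1 (coevaluation ℂ V 1) := by
    intro A B
    rw [← map_coevaluation', ← neg_one_smul ℂ B.dualMap,
      TensorProduct.map_smul_right]
    simp
  refine ⟨?_, ?_, ?_, ?_, ?_⟩ <;> refine LinearMap.ext_ring ?_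
  · simp only [LinearMap.comp_apply, tensor_P, unit_P, tP, dual_P, map_coevaluation', M.P_P]
    simp
  · simp only [LinearMap.comp_apply, tensor_E, unit_E, tE, dual_E, key, LinearMap.add_apply]
    simp
  · simp only [LinearMap.comp_apply, tensor_G, unit_G, tG, dual_G, key, LinearMap.add_apply]
    simp
  · have h1 : -(M.X * M.K).dualMap * M.P.dualMap = -(M.P * (M.X * M.K)).dualMap := rfl
    simp only [LinearMap.comp_apply, tensor_X, unit_X, tX, dual_X, dual_Kinv, h1, key,
      LinearMap.add_apply, map_coevaluation']
    rw [← mul_assoc M.P, M.P_P]; simp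
  · have h1 : -(M.Y * M.Kinv).dualMap * M.P.dualMap = -(M.P * (M.Y * M.Kinv)).dualMap := rfl
    have h2 : M.K * M.P * (M.P * (M.Y * M.Kinv)) = M.Y := ext_wt M fun s l n v hv => by
      simp only [Module.End.mul_apply, hv.eK', map_smul, hv.Y.eP, smul_smul, hv.Y.eK]
      have a := qpow_ne_zero ħ l
      rcases hv.sign with rfl | rfl <;> match_scalars <;> field_simp
    simp only [LinearMap.comp_apply, tensor_Y, unit_Y, tY, dual_Y, h1, key, h2,
      LinearMap.add_apply]
    simp

end IntAction
end IntWeight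

namespace IntWeight
namespace IntAction

variable {ħ : ℂ} {V W U V' W' : Type*} [AddCommGroup V] [Module ℂ V]
  [AddCommGroup W] [Module ℂ W] [AddCommGroup U] [Module ℂ U]
  [AddCommGroup V'] [Module ℂ V'] [AddCommGroup W'] [Module ℂ W']
variable [Module.Finite ℂ V] [Module.Finite ℂ W] [Module.Finite ℂ U]
  [Module.Finite ℂ V'] [Module.Finite ℂ W']
variable {M : IntAction ħ V} {N : IntAction ħ W} {L : IntAction ħ U} {M' : IntAction ħ V'}
  {N' : IntAction ħ W'}
  {s l t m u k : ℂ} {n n' n'' : ℤ} {v : V} {w : W} {x : U}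

/-! Twist -/

/-- The twist `v ↦ q ^ (-2 E G) (K - (q - q⁻¹) Y X) v`. By `twist_eq_ptr` it is the
right partial trace of the braiding `c_{V,V}`. -/
def twist (M : IntAction ħ V) : Module.End ℂ V :=
  qpowEnd ħ ((-2 : ℂ) • (M.E * M.G)) * (M.K - qdiff ħ • (M.Y * M.X))

/-- The inverse of `twist`. -/
def twistInv (M : IntAction ħ V) : Module.End ℂ V :=
  qpowEnd ħ ((2 : ℂ) • (M.E * M.G)) * (M.Kinv + qdiff ħ • (M.Y * M.X))

lemma IsWt.YX (hv : IsWt M s l n v) : IsWt M s l n (M.Y (M.X v)) :=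
  hv.X.Y.cast (by simp) rfl (by simp)

lemma IsWt.twist (hv : IsWt M s l n v) : M.twist v =
    qpow ħ (-2 * (l * n)) • (qpow ħ l • v - qdiff ħ • M.Y (M.X v)) := by
  have h : ∀ v, IsWt M s l n v → qpowEnd ħ ((-2 : ℂ) • (M.E * M.G)) v =
      qpow ħ (-2 * (l * n)) • v := fun v hv => qpowEnd_apply ħ (by
    simp only [LinearMap.smul_apply, Module.End.mul_apply, hv.eG, hv.eE, map_smul, smul_smul]
    congr 1; ring)
  simp only [IntAction.twist, Module.End.mul_apply, LinearMap.sub_apply, LinearMap.smul_apply,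
    map_sub, map_smul, hv.eK, h v hv, h _ hv.YX]
  module

lemma IsWt.twistInv (hv : IsWt M s l n v) : M.twistInv v =
    (qpow ħ (-2 * (l * n)))⁻¹ • ((qpow ħ l)⁻¹ • v + qdiff ħ • M.Y (M.X v)) := by
  have h : ∀ v, IsWt M s l n v → qpowEnd ħ ((2 : ℂ) • (M.E * M.G)) v =
      (qpow ħ (-2 * (l * n)))⁻¹ • v := fun v hv => by
    rw [← qpow_neg]
    exact qpowEnd_apply ħ (by
      simp only [LinearMap.smul_apply, Module.End.mul_apply, hv.eG, hv.eE, map_smul, smul_smul]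
      congr 1; ring)
  simp only [IntAction.twistInv, Module.End.mul_apply, LinearMap.add_apply, LinearMap.smul_apply,
    map_add, map_smul, hv.eK', h v hv, h _ hv.YX]
  module

/-- The twist as a linear equivalence. -/
def twistEquiv [Admissible ħ] (M : IntAction ħ V) : V ≃ₗ[ℂ] V :=
  LinearEquiv.ofLinearMap M.twist M.twistInv
    (ext_wt M fun s l n v hv => by
      simp only [LinearMap.comp_apply, hv.twistInv, map_smul, map_add, hv.twist, hv.YX.twist,
        LinearMap.id_apply, hv.X.eXY, map_sub, X_X_apply, map_zero]
      (match_scalars <;> field_simp)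
      ring)
    (ext_wt M fun s l n v hv => by
      simp only [LinearMap.comp_apply, hv.twist, map_smul, map_sub, hv.twistInv, hv.YX.twistInv,
        LinearMap.id_apply, hv.X.eXY, map_sub, X_X_apply, map_zero]
      (match_scalars <;> field_simp)
      ring)

lemma qpow_shift₇ (ħ l : ℂ) (n : ℤ) : qpow ħ (-2 * (l * ((n + 1 : ℤ) : ℂ))) =
    qpow ħ (-2 * (l * n)) * ((qpow ħ l)⁻¹ * (qpow ħ l)⁻¹) := by
  rw [← qpow_neg, ← qpow_add, ← qpow_add]; congr 1; push_cast; ring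

lemma qpow_shift₈ (ħ l : ℂ) (n : ℤ) : qpow ħ (-2 * (l * ((n - 1 : ℤ) : ℂ))) =
    qpow ħ (-2 * (l * n)) * (qpow ħ l * qpow ħ l) := by
  rw [← qpow_add, ← qpow_add]; congr 1; push_cast; ring

lemma twist_mem [Admissible ħ] (M : IntAction ħ V) : (twistEquiv M).toLinearMap ∈ homs M M := by
  change M.twist ∈ _
  refine mem_homs fun s l n v hv => ⟨?_, ?_, ?_⟩
  · rw [hv.twist, sub_eq_add_neg, ← neg_smul]
    exact ((hv.smul _).add (hv.YX.smul _)).smul _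
  · rw [hv.twist, hv.X.twist]
    simp only [map_smul, map_sub, X_X_apply, hv.X.eXY, qpow_shift₇, map_zero]
    match_scalars; field_simp; ring
  · rw [hv.twist, hv.Y.twist]
    simp only [map_smul, map_sub, Y_Y_apply, hv.eXY, qpow_shift₈, map_zero]
    match_scalars; field_simp; ring

lemma twist_natural {f : V →ₗ[ℂ] W} (hf : f ∈ homs M N) : f ∘ₗ M.twist = N.twist ∘ₗ f :=
  ext_wt M fun s l n v hv => by
    simp only [LinearMap.comp_apply, hv.twist, (hv.map hf).twist, map_smul, map_sub, hom_X hf,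
      hom_Y hf]

lemma qpow_split₃ (ħ l m : ℂ) (n n' : ℤ) : qpow ħ (-2 * ((l + m) * ((n + n' : ℤ) : ℂ))) =
    qpow ħ (-2 * (l * n)) * qpow ħ (-2 * (m * n')) *
      (qpow ħ (-(l * n' + n * m)) * qpow ħ (-(l * n' + n * m))) := by
  rw [← qpow_add, ← qpow_add, ← qpow_add]; congr 1; push_cast; ring

lemma qpow_flip (ħ l m : ℂ) (n n' : ℤ) : qpow ħ (-(m * n + n' * l)) =
    qpow ħ (-(l * n' + n * m)) := by congr 1; ring

lemma twist_tensor [Admissible ħ] (M : IntAction ħ V) (N : IntAction ħ W) :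
    (tensor M N).twist = braid N M ∘ₗ braid M N ∘ₗ TensorProduct.map M.twist N.twist :=
  ext_wt₂ M N fun s l n v hv t m n' w hw => by
    simp only [LinearMap.comp_apply, TensorProduct.map_tmul, (hv.tmul hw).twist, hv.twist, hw.twist,
      tensor_X, tX_tmul hv hw, map_add, map_smul, tensor_Y, tY_tmul hv.X hw, tY_tmul hv hw.X,
      TensorProduct.tmul_sub, TensorProduct.sub_tmul, ← TensorProduct.smul_tmul',
      TensorProduct.tmul_smul, map_sub, braid_tmul hv hw, braid_tmul hv hw.YX, braid_tmul hv.YX hw,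
      braid_tmul hv.YX hw.YX, hw.X.eXY, hv.X.eXY, X_X_apply, Y_Y_apply, map_zero, smul_zero,
      TensorProduct.zero_tmul, TensorProduct.tmul_zero, sub_zero, smul_sub, hv.eXY, hw.eXY,
      braid_tmul hw hv, braid_tmul hw.Y hv.X, braid_tmul hw.YX hv, braid_tmul hw hv.YX,
      braid_tmul hw.YX hv.YX, qpow_split₃, qpow_add, qpow_shift₁, qpow_flip ħ l m]
    rcases hv.sign with rfl | rfl <;> rcases hw.sign with rfl | rfl <;>
        simp only [sgn] <;> match_scalars <;> field_simp <;> ring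

lemma twist_dual [Admissible ħ] (M : IntAction ħ V) : (dual M).twist = M.twist.dualMap :=
  ext_wt (dual M) fun t m n' φ hφ => ext_wt M fun s l n v hv => by
    rw [hφ.twist, LinearMap.dualMap_apply, hv.twist]
    simp only [LinearMap.smul_apply, LinearMap.sub_apply, dual_X, dual_Y, map_smul, map_sub]
    by_cases h : -m = l ∧ -n' = n
    · obtain ⟨rfl, rfl⟩ := h
      simp [hv.eK', hv.eK, hv.X.eP, hv.Y.eP, hv.X.eK', hv.Y.eK, hv.X.Y.eP, hv.Y.X.eP, hv.eXY, hv.eP,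
        qpow_neg]
      have a := qpow_ne_zero ħ m
      rcases hv.sign with rfl | rfl <;> field_simp <;> ring
    · have h1 : ∀ v, IsWt M s l n v → φ v = 0 := fun v hv => by
        by_contra h0
        exact h (hφ.cowt.pair hv h0).2
      have h2 : IsWt M s l n (M.X (M.Y v)) := hv.Y.X.cast (by simp) rfl (by simp)
      simp [h1 v hv, h1 _ hv.YX, hv.eK', hv.Y.eP, hv.Y.eK, hv.Y.X.eP, h1 _ h2]

/-- The evaluation built from the twist and the braiding is `v ⊗ f ↦ (-1) ^ (|f| |v|) f (K v)`. -/
lemma contractLeft_braid [Admissible ħ] (M : IntAction ħ V) (v : V) (φ : Module.Dual ℂ V) :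
    contractLeft ℂ V (braid M (dual M) (M.twist v ⊗ₜ φ)) = φ (M.P (M.K v)) := by
  have : contractLeft ℂ V ∘ₗ braid M (dual M) ∘ₗ TensorProduct.map M.twist LinearMap.id =
      contractLeft ℂ V ∘ₗ (TensorProduct.comm ℂ _ _).toLinearMap ∘ₗ
        TensorProduct.map (M.P * M.K) LinearMap.id :=
    ext_wt₂ M (dual M) fun s l n v hv t m n' φ hφ => by
      simp only [LinearMap.comp_apply, TensorProduct.map_tmul, hv.twist, TensorProduct.sub_tmul,
        ← TensorProduct.smul_tmul', map_smul, map_sub, braid_tmul hv hφ, braid_tmul hv.YX hφ,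
        map_add, contractLeft_apply, LinearMap.id_apply, Module.End.mul_apply, hv.eK, hv.eP,
        LinearEquiv.coe_coe, TensorProduct.comm_tmul, hv.X.eXY, X_X_apply, map_zero, sub_zero]
      by_cases h : t = s ∧ -m = l ∧ -n' = n
      · obtain ⟨rfl, rfl, rfl⟩ := h
        simp only [dual_Y]
        have e : qpow ħ (-(-m * n' + ((-n' : ℤ) : ℂ) * m)) = (qpow ħ (-2 * (-m * ((-n' : ℤ) : ℂ))))⁻¹ := by
          rw [← qpow_neg]; congr 1; push_cast; ring
        simp [hv.X.eK', hv.X.Y.eP, e, qpow_neg]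
        have a := qpow_ne_zero ħ m
        rcases hv.sign with rfl | rfl <;> simp only [sgn] <;> field_simp <;> ring_nf
      · have h1 : ∀ v, IsWt M s l n v → φ v = 0 := fun v hv => by
          by_contra h0
          exact h (hφ.cowt.pair hv h0)
        simp [dual_Y, h1 v hv, h1 _ hv.YX, hv.X.eK', hv.X.Y.eP]
  simpa using LinearMap.congr_fun this (v ⊗ₜ φ)

end IntAction
end IntWeight

namespace RelMod

universe v u

/-- A ribbon category: a rigid braided monoidal category with a compatible twist. The dual `V*` of
`V` is `Vᘁ`, with `ev : V* ⊗ V ⟶ 𝟙` and `coev : 𝟙 ⟶ V ⊗ V*` the maps `ε_ V Vᘁ` and `η_ V Vᘁ`. -/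
class RibbonCategory (C : Type u) [Category.{v} C] [MonoidalCategory C] [BraidedCategory C]
    extends RightRigidCategory C where
  twist (V : C) : V ≅ V
  twist_naturality {V W : C} (f : V ⟶ W) : f ≫ (twist W).hom = (twist V).hom ≫ f
  twist_tensor (V W : C) : (twist (V ⊗ W)).hom =
    ((twist V).hom ⊗ₘ (twist W).hom) ≫ (β_ V W).hom ≫ (β_ W V).hom
  twist_dual (V : C) : (twist Vᘁ).hom = ((twist V).hom)ᘁ

section Ribbon

variable {C : Type u} [Category.{v} C] [MonoidalCategory C] [BraidedCategory C] [RibbonCategory C]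

/-- The twist of `V`. -/
def θ (V : C) : V ⟶ V := (RibbonCategory.twist V).hom

/-- The evaluation `V ⊗ V* ⟶ 𝟙` of the pivotal structure given by the twist. -/
def evR (V : C) : V ⊗ Vᘁ ⟶ 𝟙_ C := (θ V ▷ Vᘁ) ≫ (β_ V Vᘁ).hom ≫ ε_ V Vᘁ

/-- The quantum dimension, as an endomorphism of the unit. -/
def qdim (V : C) : 𝟙_ C ⟶ 𝟙_ C := η_ V Vᘁ ≫ evR V

/-- The right partial trace `End (V ⊗ W) → End V`. -/
def ptr (V W : C) (f : V ⊗ W ⟶ V ⊗ W) : V ⟶ V :=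
  (ρ_ V).inv ≫ (V ◁ η_ W Wᘁ) ≫ (α_ V W Wᘁ).inv ≫ (f ▷ Wᘁ) ≫ (α_ V W Wᘁ).hom ≫
    (V ◁ evR W) ≫ (ρ_ V).hom

/-- `Φ_{V,V'}`: the endomorphism of `V'` given by a strand colored by `V'` which is encircled by an
unknot colored by `V`. -/
def Phi (V V' : C) : V' ⟶ V' := ptr V' V ((β_ V' V).hom ≫ (β_ V V').hom)

variable (C) in
/-- The full subcategory of projective objects: those onto which every epimorphism splits. -/
def IsProjective : ObjectProperty C := fun P =>
  ∀ ⦃V : C⦄ (f : V ⟶ P), Epi f → ∃ s : P ⟶ V, s ≫ f = 𝟙 P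

/-- An object is regular if its evaluation `V* ⊗ V ⟶ 𝟙` is an epimorphism. -/
def IsRegular (V : C) : Prop := Epi (ε_ V Vᘁ)

/-- Ideals of a ribbon category. -/
structure IsIdeal (I : ObjectProperty C) : Prop where
  retract {V W : C} (hW : I W) (f : V ⟶ W) (g : W ⟶ V) (h : f ≫ g = 𝟙 V) : I V
  tensor {U : C} (hU : I U) (V : C) : I (U ⊗ V)

variable (C) in
/-- A free realisation of an abelian group `Z`: a monoidal functor from `Z`, viewed as a discrete
monoidal category. -/
structure FreeRealisation [Preadditive C] (Z : Type*) [AddCommGroup Z] where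
  functor : Discrete Z ⥤ C
  monoidal : functor.Monoidal
  obj_zero : functor.obj ⟨0⟩ = 𝟙_ C
  qdim_eq (k : Z) : qdim (functor.obj ⟨k⟩) = 𝟙 _ ∨ qdim (functor.obj ⟨k⟩) = -𝟙 _
  twist_eq (k : Z) : θ (functor.obj ⟨k⟩) = 𝟙 _
  free (V : C) [Simple V] (k : Z) : Nonempty (V ⊗ functor.obj ⟨k⟩ ≅ V) ↔ k = 0

/-- The object `σ(k)`. -/
def FreeRealisation.obj [Preadditive C] {Z : Type*} [AddCommGroup Z] (σ : FreeRealisation C Z)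
    (k : Z) : C := σ.functor.obj ⟨k⟩

end Ribbon

section Linear

variable {C : Type u} [Category.{v} C] [Preadditive C]

/-- `V` is a direct sum of the objects `W i`. -/
def IsDirectSum {n : ℕ} (V : C) (W : Fin n → C) : Prop :=
  ∃ (ι : ∀ i, W i ⟶ V) (s : ∀ i, V ⟶ W i), 𝟙 V = ∑ i, s i ≫ ι i ∧
    (∀ i, ι i ≫ s i = 𝟙 (W i)) ∧ ∀ i j, i ≠ j → ι i ≫ s j = 0

/-- `V` is indecomposable. -/
def IsIndecomposable (V : C) : Prop :=
  ∀ (n : ℕ) (W : Fin n → C), IsDirectSum V W →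
    ∃! i, Nonempty (V ≅ W i) ∧ ∀ j, j ≠ i → Limits.IsZero (W j)

/-- The family `(W j)` dominates the full subcategory `D`. -/
def IsDominating {J : Type*} (W : J → C) (D : ObjectProperty C) : Prop :=
  ∀ V, D V → ∃ (n : ℕ) (i : Fin n → J) (ι : ∀ k, W (i k) ⟶ V) (s : ∀ k, V ⟶ W (i k)),
    𝟙 V = ∑ k, s k ≫ ι k

/-- The family `(W j)` is completely reduced: `dim Hom (W i, W j) = δ_{i,j}`. -/
def IsCompletelyReduced (𝕜 : Type*) [Field 𝕜] [Linear 𝕜 C] {J : Type*} (W : J → C) : Prop :=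
  (∀ i, Module.rank 𝕜 (W i ⟶ W i) = 1) ∧ ∀ i j, i ≠ j → Module.rank 𝕜 (W i ⟶ W j) = 0

end Linear

/-- A subset `X` of an abelian group is small if no finite union of its translates is everything. -/
def IsSmall {G : Type*} [AddCommGroup G] (X : Set G) : Prop :=
  ∀ s : Finset G, ⋃ g ∈ s, (fun x => g + x) '' X ≠ Set.univ

/-- A subset `X` of an abelian group is symmetric if `X = -X`. -/
def IsSymmetric {G : Type*} [AddCommGroup G] (X : Set G) : Prop := X = {x | -x ∈ X}

section Modular

variable (𝕜 : Type*) [Field 𝕜] (C : Type u) [Category.{v} C] [Preadditive C] [Linear 𝕜 C]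
  [MonoidalCategory C] [BraidedCategory C] [RibbonCategory C]

/-- The standing assumptions on a `𝕜`-linear ribbon category: `⊗` is bilinear, the unit is simple
and `𝕜 → End 𝟙` is an isomorphism. -/
structure IsLinearRibbon : Prop where
  monoidalPreadditive : MonoidalPreadditive C
  monoidalLinear : MonoidalLinear 𝕜 C
  simple_unit : Simple (𝟙_ C)
  scalars : Function.Bijective fun c : 𝕜 => c • 𝟙 (𝟙_ C)

variable {C} in
/-- A modified trace on the ideal `I`. -/
structure MTrace (I : ObjectProperty C) where
  isIdeal : IsIdeal I
  trace (V : C) (hV : I V) : (V ⟶ V) →ₗ[𝕜] 𝕜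
  cyclic {V W : C} (hV : I V) (hW : I W) (f : W ⟶ V) (g : V ⟶ W) :
    trace V hV (g ≫ f) = trace W hW (f ≫ g)
  partial_trace {V : C} (hV : I V) (W : C) (f : V ⊗ W ⟶ V ⊗ W) :
    trace (V ⊗ W) (isIdeal.tensor hV W) f = trace V hV (ptr V W f)

variable {𝕜 C} in
/-- The modified dimension. -/
def MTrace.dim {I : ObjectProperty C} (t : MTrace 𝕜 I) (V : C) (hV : I V) : 𝕜 :=
  t.trace V hV (𝟙 V)

variable {C} in
/-- The full subcategories `deg g`, `g : G`, form a `G`-grading: `C` is equivalent to their direct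
sum, that is, objects of different degrees are orthogonal, each object is a finite direct sum of
homogeneous objects of different degrees and each such sum exists in `C`. -/
structure IsGrading {G : Type*} [AddCommGroup G] (deg : G → ObjectProperty C) : Prop where
  iso_closed (g : G) {V W : C} (e : V ≅ W) (hV : deg g V) : deg g W
  orthogonal {g h : G} (hgh : g ≠ h) {V W : C} (hV : deg g V) (hW : deg h W) (f : V ⟶ W) : f = 0
  decompose (V : C) : ∃ (n : ℕ) (g : Fin n → G) (W : Fin n → C), Function.Injective g ∧
    (∀ i, deg (g i) (W i)) ∧ IsDirectSum V W
  sum {n : ℕ} (g : Fin n → G) (W : Fin n → C) (hg : Function.Injective g)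
    (hW : ∀ i, deg (g i) (W i)) : ∃ V : C, IsDirectSum V W
  unit : deg 0 (𝟙_ C)
  dual {g : G} {V : C} (hV : deg g V) : deg (-g) Vᘁ
  tensor {g h : G} {V W : C} (hV : deg g V) (hW : deg h W) : deg (g + h) (V ⊗ W)

/-- The data of a relative (pre-)modular category: the family of full subcategories of a grading,
a free realisation and an m-trace on the ideal of projective objects. -/
structure RelativeData (G Z : Type*) [AddCommGroup G] [AddCommGroup Z] where
  deg : G → ObjectProperty C
  σ : FreeRealisation C Z
  t : MTrace 𝕜 (IsProjective C)

namespace RelativeData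

variable {𝕜 C} {G Z : Type*} [AddCommGroup G] [AddCommGroup Z] (D : RelativeData 𝕜 C G Z)
  (X : Set G)

/-- The finite sets `Θ(g) = {V_i | i ∈ I_g}`, for `g ∉ X`, of generic semisimplicity. -/
structure GenericSimples where
  card : G → ℕ
  obj (g : G) : Fin (card g) → C
  deg_obj {g : G} (hg : g ∉ X) (i : Fin (card g)) : D.deg g (obj g i)
  simple {g : G} (hg : g ∉ X) (i : Fin (card g)) : Simple (obj g i)
  regular {g : G} (hg : g ∉ X) (i : Fin (card g)) : IsRegular (obj g i)
  projective {g : G} (hg : g ∉ X) (i : Fin (card g)) : IsProjective C (obj g i)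
  dominating {g : G} (hg : g ∉ X) :
    IsDominating (fun ik : Fin (card g) × Z => obj g ik.1 ⊗ D.σ.obj ik.2) (D.deg g)
  completelyReduced {g : G} (hg : g ∉ X) :
    IsCompletelyReduced 𝕜 (fun ik : Fin (card g) × Z => obj g ik.1 ⊗ D.σ.obj ik.2)

/-- `C` with the data `D` is a pre-modular `G`-category relative to `(Z, X)`. -/
structure IsPreModular : Prop where
  isLinearRibbon : IsLinearRibbon 𝕜 C
  small : IsSmall X
  symmetric : IsSymmetric X
  grading : IsGrading D.deg
  deg_σ (k : Z) : D.deg 0 (D.σ.obj k)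
  trace_ne_zero : ∃ (V : C) (hV : IsProjective C V) (f : V ⟶ V), D.t.trace V hV f ≠ 0
  generic_semisimplicity : Nonempty (D.GenericSimples X)
  compatibility : ∃ ψ : G →+ Z →+ Additive 𝕜ˣ, ∀ (g : G) (V : C), D.deg g V → ∀ k : Z,
    (β_ V (D.σ.obj k)).hom ≫ (β_ (D.σ.obj k) V).hom =
      (((ψ g k).toMul : 𝕜ˣ) : 𝕜) • 𝟙 (V ⊗ D.σ.obj k)

variable {D X} in
/-- `Φ_{Ω_h, V'}`, where `Ω_h = ∑ d(V_k) V_k` is the Kirby color of index `h`. -/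
def GenericSimples.kirbyPhi (Θ : D.GenericSimples X) {h : G} (hh : h ∉ X) (V' : C) : V' ⟶ V' :=
  ∑ k, D.t.dim (Θ.obj h k) (Θ.projective hh k) • Phi (Θ.obj h k) V'

/-- `C` with the data `D` is a modular `G`-category relative to `(Z, X)` with relative modularity
parameter `ζ`. -/
structure IsModular (ζ : 𝕜) : Prop extends D.IsPreModular X where
  ζ_ne_zero : ζ ≠ 0
  relative_modularity : ∃ Θ : D.GenericSimples X, ∀ (g h : G) (hg : g ∉ X) (hh : h ∉ X)
    (i j : Fin (Θ.card g)),
      (i ≠ j → D.t.dim (Θ.obj g i) (Θ.projective hg i) •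
        Θ.kirbyPhi hh (Θ.obj g i ⊗ (Θ.obj g j)ᘁ) = 0) ∧
      (D.t.dim (Θ.obj g i) (Θ.projective hg i) • Θ.kirbyPhi hh (Θ.obj g i ⊗ (Θ.obj g i)ᘁ) =
        ζ • (evR (Θ.obj g i) ≫ η_ (Θ.obj g i) (Θ.obj g i)ᘁ))

/-- TQFT finiteness. -/
structure IsTQFTFinite : Prop where
  finite_indecomposables (g : G) : ∃ (n : ℕ) (P : Fin n → C),
    (∀ j, IsProjective C (P j) ∧ IsIndecomposable (P j) ∧ D.deg g (P j)) ∧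
    ∀ Q, IsProjective C Q → IsIndecomposable Q → D.deg g Q →
      ∃ (j : Fin n) (k : Z), Nonempty (Q ≅ P j ⊗ D.σ.obj k)
  finite_hom (P : C) (hP : IsProjective C P) :
    (∀ k : Z, Module.Finite 𝕜 (D.σ.obj k ⟶ P)) ∧
      {k : Z | ∃ f : D.σ.obj k ⟶ P, f ≠ 0}.Finite
  dominated : IsDominating (fun P : {P : C // IsProjective C P ∧ IsIndecomposable P} => P.1)
    (IsProjective C)

end RelativeData

end Modular

end RelMod

/-- Objects of `D^{q,int}`: finite dimensional weight modules with integral `G`-weights. -/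
structure IntWeightModule (ħ : ℂ) where
  carrier : Type
  [addCommGroup : AddCommGroup carrier]
  [module : Module ℂ carrier]
  [finite : Module.Finite ℂ carrier]
  action : IntWeight.IntAction ħ carrier

attribute [instance] IntWeightModule.addCommGroup IntWeightModule.module IntWeightModule.finite

namespace IntWeightModule

open IntWeight IntAction

variable {ħ : ℂ}

/-- Morphisms of `D^{q,int}`: linear maps of degree `0̄` which commute with the action. -/
@[ext]
structure Hom (V W : IntWeightModule ħ) where
  val : homs V.action W.action

/-- The underlying linear map. -/
def Hom.lin {V W : IntWeightModule ħ} (f : Hom V W) : V.carrier →ₗ[ℂ] W.carrier := f.val.1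

/-- A morphism is a linear map in `homs`. -/
def Hom.equiv (V W : IntWeightModule ħ) : Hom V W ≃ homs V.action W.action where
  toFun := Hom.val
  invFun := Hom.mk

instance (V W : IntWeightModule ħ) : AddCommGroup (Hom V W) := (Hom.equiv V W).addCommGroup
instance (V W : IntWeightModule ħ) : Module ℂ (Hom V W) := (Hom.equiv V W).module ℂ

instance : Category (IntWeightModule ħ) where
  Hom V W := Hom V W
  id V := ⟨⟨LinearMap.id, id_mem⟩⟩
  comp f g := ⟨⟨g.lin ∘ₗ f.lin, comp_mem f.val.2 g.val.2⟩⟩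

variable {V W U T : IntWeightModule ħ}

/-- The morphism given by a linear map. -/
def ofLin (f : V.carrier →ₗ[ℂ] W.carrier) (hf : f ∈ homs V.action W.action) : V ⟶ W := ⟨⟨f, hf⟩⟩

/-- The underlying linear map. -/
def lin (f : V ⟶ W) : V.carrier →ₗ[ℂ] W.carrier := Hom.lin f

lemma lin_mem (f : V ⟶ W) : lin f ∈ homs V.action W.action := f.val.2

lemma lin_injective {f g : V ⟶ W} (h : lin f = lin g) : f = g := Hom.ext (Subtype.ext h)

@[simp] lemma lin_ofLin (f : V.carrier →ₗ[ℂ] W.carrier) (hf : f ∈ homs V.action W.action) :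
    lin (ofLin f hf) = f := rfl
@[simp] lemma lin_id : lin (𝟙 V) = LinearMap.id := rfl
@[simp] lemma lin_comp (f : V ⟶ W) (g : W ⟶ U) : lin (f ≫ g) = lin g ∘ₗ lin f := rfl

instance : Preadditive (IntWeightModule ħ) where
  homGroup V W := inferInstanceAs (AddCommGroup (Hom V W))
  add_comp P Q R f f' g := lin_injective (LinearMap.comp_add (lin f) (lin f') (lin g))
  comp_add P Q R f g g' := lin_injective (LinearMap.add_comp (lin f) (lin g') (lin g))

instance : Linear ℂ (IntWeightModule ħ) where
  homModule V W := inferInstanceAs (Module ℂ (Hom V W))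
  smul_comp P Q R c f g := lin_injective (LinearMap.comp_smul (lin g) c (lin f))
  comp_smul P Q R f c g := lin_injective (LinearMap.smul_comp c (lin g) (lin f))

@[simp] lemma lin_add (f g : V ⟶ W) : lin (f + g) = lin f + lin g := rfl
@[simp] lemma lin_zero : lin (0 : V ⟶ W) = 0 := rfl
@[simp] lemma lin_smul (c : ℂ) (f : V ⟶ W) : lin (c • f) = c • lin f := rfl

/-- The isomorphism given by a linear equivalence. -/
def isoOfLin (e : V.carrier ≃ₗ[ℂ] W.carrier) (he : e.toLinearMap ∈ homs V.action W.action) :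
    V ≅ W where
  hom := ofLin e.toLinearMap he
  inv := ofLin e.symm.toLinearMap (symm_mem he)
  hom_inv_id := lin_injective (LinearMap.ext fun x => e.symm_apply_apply x)
  inv_hom_id := lin_injective (LinearMap.ext fun x => e.apply_symm_apply x)

/-- The tensor product of modules. -/
@[simps] def tensorObj (V W : IntWeightModule ħ) : IntWeightModule ħ where
  carrier := V.carrier ⊗[ℂ] W.carrier
  action := tensor V.action W.action

/-- The trivial module `ℂ`. -/
@[simps] def unitObj (ħ : ℂ) : IntWeightModule ħ where
  carrier := ℂ
  action := unit ħ

/-- The dual module. -/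
@[simps] def dualObj (V : IntWeightModule ħ) : IntWeightModule ħ where
  carrier := Module.Dual ℂ V.carrier
  action := dual V.action

instance : MonoidalCategoryStruct (IntWeightModule ħ) where
  tensorObj := tensorObj
  tensorUnit := unitObj ħ
  tensorHom f g := ofLin (V := tensorObj _ _) (W := tensorObj _ _)
    (TensorProduct.map (lin f) (lin g)) (map_mem (lin_mem f) (lin_mem g))
  whiskerLeft V _ _ g := ofLin (V := tensorObj _ _) (W := tensorObj _ _)
    (TensorProduct.map LinearMap.id (lin g)) (map_mem id_mem (lin_mem g))
  whiskerRight f W := ofLin (V := tensorObj _ _) (W := tensorObj _ _)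
    (TensorProduct.map (lin f) LinearMap.id) (map_mem (lin_mem f) id_mem)
  associator V W U := isoOfLin (V := tensorObj (tensorObj _ _) _) (W := tensorObj _ (tensorObj _ _))
    (TensorProduct.assoc ℂ _ _ _) (assoc_mem V.action W.action U.action)
  leftUnitor V := isoOfLin (V := tensorObj (unitObj ħ) _) (TensorProduct.lid ℂ _)
    (lid_mem V.action)
  rightUnitor V := isoOfLin (V := tensorObj _ (unitObj ħ)) (TensorProduct.rid ℂ _)
    (rid_mem V.action)

instance : MonoidalCategory (IntWeightModule ħ) where
  tensorHom_def f g := lin_injective (TensorProduct.ext' fun _ _ => rfl)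
  id_tensorHom_id V W := lin_injective (TensorProduct.ext' fun _ _ => rfl)
  tensorHom_comp_tensorHom f₁ f₂ g₁ g₂ := lin_injective (TensorProduct.ext' fun _ _ => rfl)
  whiskerLeft_id V W := lin_injective (TensorProduct.ext' fun _ _ => rfl)
  id_whiskerRight V W := lin_injective (TensorProduct.ext' fun _ _ => rfl)
  associator_naturality f g h := lin_injective (TensorProduct.ext_threefold fun _ _ _ => rfl)
  leftUnitor_naturality f := lin_injective (TensorProduct.ext' fun c v => by
    exact ((lin f).map_smul (show ℂ from c) v).symm)
  rightUnitor_naturality f := lin_injective (TensorProduct.ext' fun v c => by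
    exact ((lin f).map_smul (show ℂ from c) v).symm)
  pentagon V W U T := lin_injective (TensorProduct.ext_fourfold fun _ _ _ _ => rfl)
  triangle V W := lin_injective (TensorProduct.ext_threefold fun v c w => by
    exact (TensorProduct.smul_tmul (show ℂ from c) v w).symm)

variable [Admissible ħ]

instance : BraidedCategory (IntWeightModule ħ) where
  braiding V W := isoOfLin (V := tensorObj V W) (W := tensorObj W V)
    (braidEquiv V.action W.action) (braid_mem V.action W.action)
  braiding_naturality_right V W U f := lin_injective (braid_natural id_mem (lin_mem f))
  braiding_naturality_left f Z := lin_injective (braid_natural (lin_mem f) id_mem)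
  hexagon_forward V W U := lin_injective (hexagon_forward V.action W.action U.action)
  hexagon_reverse V W U := lin_injective (hexagon_reverse V.action W.action U.action)

instance exactPairing (V : IntWeightModule ħ) : ExactPairing V (dualObj V) where
  coevaluation' := ofLin (V := unitObj ħ) (W := tensorObj V (dualObj V)) (coevaluation ℂ V.carrier)
    (coevaluation_mem V.action)
  evaluation' := ofLin (V := tensorObj (dualObj V) V) (W := unitObj ħ) (contractLeft ℂ V.carrier)
    (contractLeft_mem V.action)
  coevaluation_evaluation' := lin_injective (contractLeft_assoc_coevaluation ℂ V.carrier)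
  evaluation_coevaluation' := lin_injective (contractLeft_assoc_coevaluation' ℂ V.carrier)

instance : RightRigidCategory (IntWeightModule ħ) where
  rightDual V := ⟨dualObj V⟩

lemma lin_rightAdjointMate (f : V ⟶ W) : lin (fᘁ) = (lin f).dualMap := by
  have h := rightAdjointMate_comp_evaluation f
  have h' := congrArg lin h
  refine LinearMap.ext fun φ => LinearMap.ext fun v => ?_
  exact LinearMap.congr_fun h' (φ ⊗ₜ v)

instance : RelMod.RibbonCategory (IntWeightModule ħ) where
  twist V := isoOfLin (twistEquiv V.action) (twist_mem V.action)
  twist_naturality {V W} f := lin_injective (twist_natural (lin_mem f)).symm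
  twist_tensor V W := lin_injective (twist_tensor V.action W.action)
  twist_dual V := lin_injective ((twist_dual V.action).trans (lin_rightAdjointMate
    (isoOfLin (twistEquiv V.action) (twist_mem V.action)).hom).symm)

end IntWeightModule

namespace IntWeightModule

open IntWeight IntAction

variable {ħ : ℂ}

/-- The right evaluation of the ribbon structure is `v ⊗ f ↦ (-1) ^ (|f| |v|) f (K v)`. -/
lemma lin_evR [Admissible ħ] (V : IntWeightModule ħ) (v : V.carrier)
    (φ : Module.Dual ℂ V.carrier) :
    lin (RelMod.evR V) (v ⊗ₜ[ℂ] φ) = φ (V.action.P (V.action.K v)) :=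
  contractLeft_braid V.action v φ

lemma partialTrace_aux {V : Type*} [AddCommGroup V] [Module ℂ V] [Module.Finite ℂ V]
    {g : V ⊗[ℂ] V →ₗ[ℂ] V ⊗[ℂ] V} {ev : V ⊗[ℂ] Module.Dual ℂ V →ₗ[ℂ] ℂ} {A C D : Module.End ℂ V}
    {v v₁ v₂ : V} (hg : ∀ w, g (v ⊗ₜ w) = C w ⊗ₜ v₁ + D w ⊗ₜ v₂)
    (hev : ∀ v φ, ev (v ⊗ₜ φ) = φ (A v)) :
    (TensorProduct.rid ℂ V) ((TensorProduct.map LinearMap.id ev)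
      ((TensorProduct.assoc ℂ _ _ _) ((TensorProduct.map g LinearMap.id)
        ((TensorProduct.assoc ℂ _ _ _).symm (v ⊗ₜ coevaluation ℂ V 1))))) =
      C (A v₁) + D (A v₂) := by
  rw [coevaluation_apply_one]
  set b := Module.Basis.ofVectorSpace ℂ V
  simp only [TensorProduct.tmul_sum, map_sum, TensorProduct.assoc_symm_tmul,
    TensorProduct.map_tmul, hg, TensorProduct.add_tmul, map_add, TensorProduct.assoc_tmul, hev,
    LinearMap.id_apply, TensorProduct.rid_tmul, Finset.sum_add_distrib]
  congr 1
  · conv_rhs => rw [← b.sum_repr (A v₁), map_sum]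
    simp only [map_smul, Module.Basis.coord_apply]
  · conv_rhs => rw [← b.sum_repr (A v₂), map_sum]
    simp only [map_smul, Module.Basis.coord_apply]

/-- The twist is the right partial trace of the braiding. -/
lemma twist_eq_ptr [Admissible ħ] (V : IntWeightModule ħ) :
    RelMod.θ V = RelMod.ptr V V (β_ V V).hom := by
  refine lin_injective (ext_wt V.action fun s l n v hv => ?_)
  obtain ⟨C, D, hC, hD⟩ : ∃ C D : Module.End ℂ V.carrier,
      (∀ t m k w, IsWt V.action t m k w →
        C w = (qpow ħ (-(l * k + n * m)) * sgn s t) • w) ∧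
      (∀ t m k w, IsWt V.action t m k w → D w = (qpow ħ (-(l * k + n * m)) *
        (qdiff ħ * (s * qpow ħ l * (qpow ħ m)⁻¹) * sgn (-s) (-t))) • V.action.Y w) := by
    have key : ∀ t m k w, IsWt V.action t m k w →
        qpowEnd ħ (-(l • V.action.G + (n : ℂ) • V.action.E)) w =
          qpow ħ (-(l * k + n * m)) • w := fun t m k w hw => qpowEnd_apply ħ (by
      simp only [LinearMap.neg_apply, LinearMap.add_apply, LinearMap.smul_apply, hw.eG, hw.eE]
      module)
    refine ⟨qpowEnd ħ (-(l • V.action.G + (n : ℂ) • V.action.E)) *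
        ((1 / 2 : ℂ) • ((1 + s) • 1 + (1 - s) • V.action.P)),
      V.action.Y * qpowEnd ħ (-(l • V.action.G + (n : ℂ) • V.action.E)) *
        ((qdiff ħ * s * qpow ħ l) • V.action.Kinv) *
        ((1 / 2 : ℂ) • ((1 - s) • 1 - (1 + s) • V.action.P)), fun t m k w hw => ?_,
      fun t m k w hw => ?_⟩
    · simp only [Module.End.mul_apply, LinearMap.smul_apply, LinearMap.add_apply, hw.eP, map_smul,
        map_add, Module.End.one_apply, key t m k w hw, sgn]
      module
    · simp only [Module.End.mul_apply, LinearMap.smul_apply, LinearMap.sub_apply, hw.eP, map_smul,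
        map_sub, Module.End.one_apply, hw.eK', key t m k w hw, sgn]
      module
  have hb : ∀ w, braid V.action V.action (v ⊗ₜ w) = C w ⊗ₜ v + D w ⊗ₜ V.action.X v := by
    have : (braid V.action V.action) ∘ₗ TensorProduct.mk ℂ _ _ v =
        (TensorProduct.mk ℂ _ _).flip v ∘ₗ C +
          (TensorProduct.mk ℂ _ _).flip (V.action.X v) ∘ₗ D :=
      ext_wt V.action fun t m k w hw => by
        simp only [LinearMap.comp_apply, LinearMap.add_apply, TensorProduct.mk_apply,
          LinearMap.flip_apply, braid_tmul hv hw, hC t m k w hw, hD t m k w hw,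
          ← TensorProduct.smul_tmul']
        module
    exact fun w => LinearMap.congr_fun this w
  have h1 : lin (RelMod.ptr V V (β_ V V).hom) v =
      C (V.action.P (V.action.K v)) + D (V.action.P (V.action.K (V.action.X v))) := by
    exact partialTrace_aux (g := braid V.action V.action) (ev := lin (RelMod.evR V))
      (A := V.action.P * V.action.K) hb (lin_evR V)
  rw [h1]
  change V.action.twist v = _
  rw [hv.twist, hv.eK, hv.X.eK]
  simp only [map_smul, hv.eP, hv.X.eP, hC _ _ _ _ hv, hD _ _ _ _ hv.X]
  have e1 : qpow ħ (-(l * n + n * l)) = qpow ħ (-2 * (l * n)) := by congr 1; ring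
  have e2 : qpow ħ (-(l * ((n + 1 : ℤ) : ℂ) + n * l)) = qpow ħ (-2 * (l * n)) * (qpow ħ l)⁻¹ := by
    rw [← qpow_neg, ← qpow_add]; congr 1; push_cast; ring
  rw [e1, e2]
  have a := qpow_ne_zero ħ l
  rcases hv.sign with rfl | rfl <;> simp only [sgn] <;> match_scalars <;> field_simp <;> ring

/-- The sign `(-1) ^ p`. -/
def paritySign (p : ZMod 2) : ℂ := if p = 0 then 1 else -1

lemma paritySign_mul_self (p : ZMod 2) : paritySign p * paritySign p = 1 := by
  rw [paritySign]; split_ifs <;> simp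

/-- The action on the one dimensional module `ε(l, n)_p`. -/
def epsAction (ħ l : ℂ) (n : ℤ) (p : ZMod 2) (h : qpow ħ l = qpow ħ (-l)) : IntAction ħ ℂ where
  P := paritySign p • 1
  E := l • 1
  G := (n : ℂ) • 1
  X := 0
  Y := 0
  P_P := by simp [smul_smul, paritySign_mul_self]
  P_E := by simp [smul_smul, mul_comm]
  P_G := by simp [smul_smul, mul_comm]
  P_X := by simp
  P_Y := by simp
  E_X := by simp
  E_Y := by simp
  E_G := by simp [smul_smul, mul_comm]
  G_X := by simp
  G_Y := by simp
  X_Y := by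
    have h1 : qpowEnd ħ (l • (1 : Module.End ℂ ℂ)) = qpowEnd ħ (-(l • (1 : Module.End ℂ ℂ))) :=
      LinearMap.ext fun v => by
        rw [qpowEnd_apply ħ (z := l) (by simp), qpowEnd_apply ħ (z := -l) (by simp), h]
    rw [h1]; simp
  X_X := by simp
  Y_Y := by simp
  weight := by
    rw [eq_top_iff]
    intro v _
    refine Submodule.mem_iSup_of_mem l (Submodule.mem_iSup_of_mem n ⟨?_, ?_⟩) <;>
    simp

/-- The one dimensional module `ε(l, n)_p` of parity `p` and weight `(l, n)`, for `q ^ l = q ^ (-l)`,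
that is, `l ∈ (π i / ħ) ℤ`. -/
def eps (ħ l : ℂ) (n : ℤ) (p : ZMod 2) (h : qpow ħ l = qpow ħ (-l)) : IntWeightModule ħ where
  carrier := ℂ
  action := epsAction ħ l n p h

lemma eps_zero [Admissible ħ] (h : qpow ħ 0 = qpow ħ (-0)) :
    eps ħ 0 0 0 h = 𝟙_ (IntWeightModule ħ) := by
  have : epsAction ħ 0 0 0 h = unit ħ := by
    simp [epsAction, unit, paritySign]
  rw [eps, this]; rfl

/-- The action on `V(α, a)_p`. -/
def kacAction (ħ α : ℂ) (a : ℤ) (p : ZMod 2) : IntAction ħ (ℂ × ℂ) where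
  P := (paritySign p • LinearMap.fst ℂ ℂ ℂ).prod (-(paritySign p) • LinearMap.snd ℂ ℂ ℂ)
  E := α • 1
  G := ((a : ℂ) • LinearMap.fst ℂ ℂ ℂ).prod ((a - 1 : ℂ) • LinearMap.snd ℂ ℂ ℂ)
  X := (((qpow ħ α - qpow ħ (-α)) / qdiff ħ) • LinearMap.snd ℂ ℂ ℂ).prod 0
  Y := LinearMap.prod 0 (LinearMap.fst ℂ ℂ ℂ)
  P_P := by ext <;> simp [paritySign_mul_self]
  P_E := by ext <;> simp [mul_comm]
  P_G := by ext <;> simp [mul_comm]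
  P_X := by ext <;> simp [mul_comm]
  P_Y := by ext <;> simp [mul_comm]
  E_X := by ext <;> simp [mul_comm]
  E_Y := by ext <;> simp [mul_comm]
  E_G := by ext <;> simp [mul_comm]
  G_X := by ext <;> simp; ring
  G_Y := by ext <;> simp
  X_Y := by
    have h1 : ∀ v : ℂ × ℂ, qpowEnd ħ (α • (1 : Module.End ℂ (ℂ × ℂ))) v = qpow ħ α • v :=
      fun v => qpowEnd_apply ħ (by simp)
    have h2 : ∀ v : ℂ × ℂ, qpowEnd ħ (-(α • (1 : Module.End ℂ (ℂ × ℂ)))) v = qpow ħ (-α) • v :=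
      fun v => qpowEnd_apply ħ (by simp)
    refine LinearMap.ext fun v => ?_
    simp only [LinearMap.add_apply, LinearMap.smul_apply, LinearMap.sub_apply, h1, h2]
    ext <;> simp <;> ring
  X_X := by ext <;> simp
  Y_Y := by ext <;> simp
  weight := by
    rw [eq_top_iff]
    intro v _
    rw [show v = (v.1, 0) + (0, v.2) by simp]
    refine add_mem (Submodule.mem_iSup_of_mem α (Submodule.mem_iSup_of_mem a ⟨?_, ?_⟩))
      (Submodule.mem_iSup_of_mem α (Submodule.mem_iSup_of_mem (a - 1) ⟨?_, ?_⟩)) <;>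
    simp

/-- The module `V(α, a)_p` with basis `v = (1, 0)`, of parity `p` and weight `(α, a)`, and
`v' = Y v = (0, 1)`, and with `X v' = [α]_q v`. -/
def kac (ħ α : ℂ) (a : ℤ) (p : ZMod 2) : IntWeightModule ħ where
  carrier := ℂ × ℂ
  action := kacAction ħ α a p

/-- The full subcategory of modules all of whose `E`-weights are congruent to `g` modulo `Γ`. -/
def eDegree (ħ : ℂ) (Γ : AddSubgroup ℂ) (g : ℂ ⧸ Γ) : ObjectProperty (IntWeightModule ħ) :=
  fun V => ∀ l : ℂ, V.action.E.HasEigenvalue l → (l : ℂ ⧸ Γ) = g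

end IntWeightModule

end

/-! Both cases are instances of one statement. Let ħRγ = 2πi with R odd (`IsPeriod`), grade by ℂ/γℤ
and put σ(n,n',p) = ε(nRγ, n'R)_p; then ζ = −R². Case (a) is R = 1, γ = 2πi/ħ, and case (b) is R =
r, γ = 1.

Projectivity is governed by a criterion of Higman type. For an even linear map f commuting with E
and G, `relTrace` f = YXf − YfX + XfY − fXY is a module map. A module V is projective iff its
identity is `relTrace` h for some such h, a contraction (`isProjective_iff`): epimorphisms always
have weight-preserving sections, which `relTrace` corrects to module maps; conversely V is a
quotient of P ⊗ V with P induced, and P ⊗ V has the contraction h ⊗ K. The same h gives the modified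
trace t(f) = −(q − q⁻¹)⁻¹ str(fh). Since `relTrace` is self-adjoint for the supertrace pairing
(`trace_relTrace`), t is independent of h and cyclic; since h ⊗ K is a contraction of V ⊗ W, it is
compatible with partial traces.

Write [l] = (q^l − q^{−l})/(q − q⁻¹), the scalar by which XY + YX acts at E-weight l. Where [l] ≠ 0,
the identity (XY)² + (YX)² = [l]² splits every module into modules V(l,n)_p (`exists_kac_sum`),
which are simple and projective; outside the non-generic degrees this is generic semisimplicity. In
general, the equation `relTrace` h = 1 written in a weight basis exhibits a projective V as a
retract of a sum of four dimensional induced modules (`exists_ind_sum`). These are indecomposable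
when [l] = 0, whence the classification `exists_iso_indec`. Tensoring with σ(k) shifts E-weights by
Rγℤ, G-weights by Rℤ and changes parity freely, so each degree has R² cells of weights, and TQFT
finiteness follows.

For relative modularity, encircling a vector v of weight (l,n) by V(β,b)_0 gives q^{−2(lb+nβ)} (q^β
(1 − q^{2l}) v + (q − q⁻¹) q^l (q^β − q^{−β}) YXv) (`lin_Phi_kac`). This is weighted by d(V(β,b)_0)
= (q^β − q^{−β})⁻¹ and summed over the R² cells of degree h. On V_i ⊗ V_j*, l is the difference of
two E-cells. If l ≠ 0, the sum over b is a vanishing sum of roots of unity. If l = 0, the first term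
drops out; the sum over β kills the second when R does not divide n, while YX kills every weight
vector whose n is not the difference of the two G-cells. So nothing survives for i ≠ j. For i = j
there remains R² (q − q⁻¹) YX, where YX = −[α] coev ∘ ev (`YX_kac_tensor_dual`); multiplication by
d(V_i) = (q^α − q^{−α})⁻¹ yields −R². -/

noncomputable section

/-! ### Relative traces, contractions and bases of weight vectors -/

namespace IntWeight
namespace IntAction

variable {ħ : ℂ} {V W U : Type*} [AddCommGroup V] [Module ℂ V]
  [AddCommGroup W] [Module ℂ W] [AddCommGroup U] [Module ℂ U]
variable [Module.Finite ℂ V] [Module.Finite ℂ W] [Module.Finite ℂ U]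
variable {M : IntAction ħ V} {N : IntAction ħ W} {L : IntAction ħ U}
  {s l t m u k : ℂ} {n n' n'' : ℤ} {v : V} {w : W} {x : U}

/-- The scalar by which `X Y + Y X` acts on vectors of `E`-weight `l`. -/
def qnum (ħ l : ℂ) : ℂ := (qdiff ħ)⁻¹ * (qpow ħ l - (qpow ħ l)⁻¹)

lemma IsWt.X_Y_apply (h : IsWt M s l n v) : M.X (M.Y v) = qnum ħ l • v - M.Y (M.X v) := h.eXY

/-- The linear maps of degree `0̄` which commute with `E` and `G`. -/
def wtHoms (M : IntAction ħ V) (N : IntAction ħ W) : Submodule ℂ (V →ₗ[ℂ] W) where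
  carrier := {f | f ∘ₗ M.P = N.P ∘ₗ f ∧ f ∘ₗ M.E = N.E ∘ₗ f ∧ f ∘ₗ M.G = N.G ∘ₗ f}
  add_mem' := by
    rintro f g ⟨h1, h2, h3⟩ ⟨k1, k2, k3⟩
    simp [LinearMap.add_comp, LinearMap.comp_add, *]
  zero_mem' := by simp
  smul_mem' := by
    rintro c f ⟨h1, h2, h3⟩
    simp [LinearMap.smul_comp, LinearMap.comp_smul, *]

lemma homs_le_wtHoms : homs M N ≤ wtHoms M N := fun _ h => ⟨h.1, h.2.1, h.2.2.1⟩

lemma IsWt.map_wt (h : IsWt M s l n v) {f : V →ₗ[ℂ] W} (hf : f ∈ wtHoms M N) :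
    IsWt N s l n (f v) where
  sign := h.sign
  eP := by rw [← map_smul, ← h.eP]; exact (LinearMap.congr_fun hf.1 v).symm
  eE := by rw [← map_smul, ← h.eE]; exact (LinearMap.congr_fun hf.2.1 v).symm
  eG := by rw [← map_smul, ← h.eG]; exact (LinearMap.congr_fun hf.2.2 v).symm

lemma mem_wtHoms {f : V →ₗ[ℂ] W}
    (h : ∀ s l n v, IsWt M s l n v → IsWt N s l n (f v)) : f ∈ wtHoms M N :=
  ⟨ext_wt M fun s l n v hv => by simp [hv.eP, (h s l n v hv).eP],
   ext_wt M fun s l n v hv => by simp [hv.eE, (h s l n v hv).eE],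
   ext_wt M fun s l n v hv => by simp [hv.eG, (h s l n v hv).eG]⟩

lemma wtHoms_comp {f : V →ₗ[ℂ] W} {g : W →ₗ[ℂ] U} (hf : f ∈ wtHoms M N) (hg : g ∈ wtHoms N L) :
    g ∘ₗ f ∈ wtHoms M L :=
  mem_wtHoms fun _ _ _ _ hv => (hv.map_wt hf).map_wt hg

/-- The relative trace `ad Y (ad X f)`, which turns `E`- and `G`-linear maps into module maps. -/
def relTrace (M : IntAction ħ V) (N : IntAction ħ W) (f : V →ₗ[ℂ] W) : V →ₗ[ℂ] W :=
  N.Y ∘ₗ N.X ∘ₗ f - N.Y ∘ₗ f ∘ₗ M.X + N.X ∘ₗ f ∘ₗ M.Y - f ∘ₗ M.X ∘ₗ M.Y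

lemma relTrace_apply (f : V →ₗ[ℂ] W) (v : V) : relTrace M N f v =
    N.Y (N.X (f v)) - N.Y (f (M.X v)) + N.X (f (M.Y v)) - f (M.X (M.Y v)) := rfl

/-- The super commutators ad X and ad Y square to zero, and their anticommutator is the commutator
with XY + YX. The latter kills f, because XY + YX acts by a scalar that depends only on the
E-weight. So both ad X and ad Y annihilate ad Y (ad X f). -/
lemma relTrace_mem {f : V →ₗ[ℂ] W} (hf : f ∈ wtHoms M N) : relTrace M N f ∈ homs M N := by
  refine mem_homs fun s l n v hv => ⟨?_, ?_, ?_⟩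
  · have a := (hv.map_wt hf).X.Y
    have b := (hv.X.map_wt hf).Y
    have c := (hv.Y.map_wt hf).X
    have d := hv.Y.X.map_wt hf
    rw [relTrace_apply, sub_eq_add_neg, sub_eq_add_neg, ← neg_one_smul ℂ, ← neg_one_smul ℂ (f _)]
    exact ((((a.cast (by simp) rfl (by simp)).add ((b.cast (by simp) rfl (by simp)).smul _)).add
      (c.cast (by simp) rfl (by simp))).add ((d.cast (by simp) rfl (by simp)).smul _))
  · simp only [relTrace_apply, map_sub, map_add, X_X_apply, map_zero, hv.X.X_Y_apply, hv.X_Y_apply, map_smul,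
      (hv.map_wt hf).X.X_Y_apply, (hv.X.map_wt hf).X_Y_apply]
    module
  · simp only [relTrace_apply, map_sub, map_add, Y_Y_apply, map_zero, hv.X_Y_apply, map_smul,
      (hv.Y.map_wt hf).X_Y_apply, (hv.map_wt hf).X_Y_apply]
    module

/-- Module maps can be pulled out of `relTrace` on either side; this turns weight-preserving
sections into module sections. -/
lemma relTrace_comp_left {g : W →ₗ[ℂ] U} (hg : g ∈ homs N L) (f : V →ₗ[ℂ] W) :
    relTrace M L (g ∘ₗ f) = g ∘ₗ relTrace M N f :=
  LinearMap.ext fun v => by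
    simp only [relTrace_apply, LinearMap.comp_apply, map_sub, map_add, hom_X hg, hom_Y hg]

lemma relTrace_comp_right {g : V →ₗ[ℂ] W} (hg : g ∈ homs M N) (f : W →ₗ[ℂ] U) :
    relTrace M L (f ∘ₗ g) = relTrace N L f ∘ₗ g :=
  LinearMap.ext fun v => by
    simp only [relTrace_apply, LinearMap.comp_apply, hom_X hg, hom_Y hg]

/-- `relTrace` is self-adjoint for the pairing str(fg), because ad X and ad Y are so up to sign.
Independence and cyclicity of the modified trace both rest on this. -/
lemma trace_relTrace {f g : Module.End ℂ V} (hf : f ∈ wtHoms M M) (hg : g ∈ wtHoms M M) :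
    LinearMap.trace ℂ V (M.P * relTrace M M f * g) =
      LinearMap.trace ℂ V (M.P * f * relTrace M M g) := by
  have c := fun a b : Module.End ℂ V => LinearMap.trace_mul_comm ℂ a b
  have pf : f * M.P = M.P * f := hf.1
  have pg : g * M.P = M.P * g := hg.1
  -- XY + YX commutes with g. The terms with X and Y adjacent match only after being added up to
  -- this central element; cyclicity alone does not relate them.
  have hz : ∀ a : Module.End ℂ V, a * (M.X * M.Y + M.Y * M.X) * g =
      a * g * (M.X * M.Y + M.Y * M.X) := fun a => ext_wt M fun s l n v hv => by
    simp only [Module.End.mul_apply, LinearMap.add_apply, hv.X_Y_apply,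
      (hv.map_wt hg).X_Y_apply, map_sub, map_smul, map_add]
    module
  have hz' := hz (M.P * f)
  have e1 : M.P * relTrace M M f * g = M.P * M.Y * M.X * f * g - M.P * M.Y * f * M.X * g +
      M.P * M.X * f * M.Y * g - M.P * f * M.X * M.Y * g := by
    change M.P * (M.Y * (M.X * f) - M.Y * (f * M.X) + M.X * (f * M.Y) - f * (M.X * M.Y)) * g = _
    noncomm_ring
  have e2 : M.P * f * relTrace M M g = M.P * f * M.Y * M.X * g - M.P * f * M.Y * g * M.X +
      M.P * f * M.X * g * M.Y - M.P * f * g * M.X * M.Y := by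
    change M.P * f * (M.Y * (M.X * g) - M.Y * (g * M.X) + M.X * (g * M.Y) - g * (M.X * M.Y)) = _
    noncomm_ring
  -- Each odd operator carried around the trace crosses P and changes the sign: twice here, once in
  -- the next two identities.
  have t1 : LinearMap.trace ℂ V (M.P * M.Y * M.X * f * g) =
      LinearMap.trace ℂ V (M.P * f * g * M.Y * M.X) := by
    rw [show M.P * M.Y * M.X * f * g = (M.P * M.Y * M.X) * (f * g) by noncomm_ring, c,
      M.P_Y, neg_mul, mul_assoc M.Y, M.P_X, mul_neg, mul_neg, mul_neg, neg_neg,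
      show f * g * (M.Y * (M.X * M.P)) = (f * g * (M.Y * M.X)) * M.P by noncomm_ring, c]
    noncomm_ring
  have t2 : LinearMap.trace ℂ V (M.P * M.Y * f * M.X * g) =
      -LinearMap.trace ℂ V (M.P * f * M.X * g * M.Y) := by
    rw [M.P_Y, show -(M.Y * M.P) * f * M.X * g = M.Y * (-(M.P * f * M.X * g)) by noncomm_ring, c,
      neg_mul, map_neg]
  have t3 : LinearMap.trace ℂ V (M.P * M.X * f * M.Y * g) =
      -LinearMap.trace ℂ V (M.P * f * M.Y * g * M.X) := by
    rw [M.P_X, show -(M.X * M.P) * f * M.Y * g = M.X * (-(M.P * f * M.Y * g)) by noncomm_ring, c,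
      neg_mul, map_neg]
  have t4 := congrArg (LinearMap.trace ℂ V) hz'
  simp only [mul_add, add_mul, map_add, ← mul_assoc] at t4
  rw [e1, e2]
  simp only [map_add, map_sub, t1, t2, t3]
  linear_combination -t4

/-- A contraction of a module: a witness of its projectivity. -/
structure IsContraction (M : IntAction ħ V) (h : Module.End ℂ V) : Prop where
  mem : h ∈ wtHoms M M
  relTrace_eq : relTrace M M h = LinearMap.id

/-- The factor K cancels the K⁻¹ in ΔX = X ⊗ K⁻¹ + 1 ⊗ X. The parts 1 ⊗ X and K ⊗ Y contribute
nothing to the successive super commutators, since K commutes with X and Y and h is even of weight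
zero. What remains is `relTrace` h ⊗ 1. -/
lemma IsContraction.tensor {h : Module.End ℂ V} (hh : IsContraction M h) (N : IntAction ħ W) :
    IsContraction (tensor M N) (TensorProduct.map h N.K) := by
  have key : ∀ s l n v, IsWt M s l n v → ∀ t m n' w, IsWt N t m n' w →
      TensorProduct.map h N.K (v ⊗ₜ w) = qpow ħ m • h v ⊗ₜ w := fun s l n v hv t m n' w hw => by
    rw [TensorProduct.map_tmul, hw.eK, TensorProduct.tmul_smul]
  refine ⟨⟨?_, ?_, ?_⟩, ?_⟩ <;> refine ext_wt₂ M N fun s l n v hv t m n' w hw => ?_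
  · have a := (hv.tmul hw).eP
    have b := ((hv.map_wt hh.mem).tmul hw).eP
    simp only [LinearMap.comp_apply, a, b, map_smul, key _ _ _ _ hv _ _ _ _ hw]
    module
  · have a := (hv.tmul hw).eE
    have b := ((hv.map_wt hh.mem).tmul hw).eE
    simp only [LinearMap.comp_apply, a, b, map_smul, key _ _ _ _ hv _ _ _ _ hw]
    module
  · have a := (hv.tmul hw).eG
    have b := ((hv.map_wt hh.mem).tmul hw).eG
    simp only [LinearMap.comp_apply, a, b, map_smul, key _ _ _ _ hv _ _ _ _ hw]
    module
  · have e := LinearMap.congr_fun hh.relTrace_eq v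
    rw [relTrace_apply, LinearMap.id_apply] at e
    have hv' := hv.map_wt hh.mem
    have hx := hv.X.map_wt hh.mem
    have hy := hv.Y.map_wt hh.mem
    have q := qpow_ne_zero ħ m
    have : v ⊗ₜ[ℂ] w = (M.Y (M.X (h v)) - M.Y (h (M.X v)) + M.X (h (M.Y v)) - h (M.X (M.Y v)))
      ⊗ₜ[ℂ] w := by rw [e]
    rw [relTrace_apply, LinearMap.id_apply]
    conv_rhs => rw [this]
    simp only [tensor_X, tensor_Y, tX_tmul hv hw, tY_tmul hv hw, key _ _ _ _ hv _ _ _ _ hw,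
      key _ _ _ _ hv.X _ _ _ _ hw, key _ _ _ _ hv _ _ _ _ hw.X, key _ _ _ _ hv.Y _ _ _ _ hw,
      key _ _ _ _ hv _ _ _ _ hw.Y, tX_tmul hv' hw, tY_tmul hv'.X hw, tY_tmul hv' hw.X,
      tY_tmul hx hw, tX_tmul hy hw, tX_tmul hv' hw.Y, tX_tmul hv.Y hw, tX_tmul hv hw.Y,
      key _ _ _ _ hv.Y.X _ _ _ _ hw, key _ _ _ _ hv.Y _ _ _ _ hw.X, key _ _ _ _ hv.X _ _ _ _ hw.Y,
      key _ _ _ _ hv _ _ _ _ hw.Y.X, map_add, map_smul, smul_add, TensorProduct.add_tmul,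
      TensorProduct.sub_tmul]
    match_scalars <;> (try field_simp) <;> ring

lemma IsContraction.retract {h : Module.End ℂ V} (hh : IsContraction M h) {i : W →ₗ[ℂ] V}
    {p : V →ₗ[ℂ] W} (hi : i ∈ homs N M) (hp : p ∈ homs M N) (e : p ∘ₗ i = LinearMap.id) :
    IsContraction N (p ∘ₗ h ∘ₗ i) where
  mem := wtHoms_comp (wtHoms_comp (homs_le_wtHoms hi) hh.mem) (homs_le_wtHoms hp)
  relTrace_eq := by
    rw [relTrace_comp_left hp, relTrace_comp_right hi, hh.relTrace_eq, LinearMap.id_comp, e]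

/-- A basis drawn from homogeneous weight vectors has weight functionals as coordinates. The
spanning set S is arbitrary, so that it can later consist of images of weight vectors. -/
theorem exists_wt_basis (M : IntAction ħ V) (S : Set V) (hS : Submodule.span ℂ S = ⊤)
    (hw : ∀ v ∈ S, ∃ s l n, IsWt M s l n v) :
    ∃ (d : ℕ) (b : Module.Basis (Fin d) ℂ V) (s l : Fin d → ℂ) (n : Fin d → ℤ),
      (∀ i, b i ∈ S) ∧ (∀ i, IsWt M (s i) (l i) (n i) (b i)) ∧
      ∀ i, IsCoWt M (s i) (l i) (n i) (b.coord i) := by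
  classical
  let b₀ := Module.Basis.ofSpan hS.ge
  have hfin : Fintype _ := Module.Basis.fintypeIndexOfRankLtAleph0 b₀ (Module.rank_lt_aleph0 ℂ V)
  let b := b₀.reindex (Fintype.equivFin _)
  have hb : ∀ i, b i ∈ S := fun i => by
    rw [Module.Basis.reindex_apply]
    exact Module.Basis.ofSpan_subset hS.ge ⟨_, rfl⟩
  choose s l n h using fun i => hw _ (hb i)
  have key : ∀ (A : Module.End ℂ V) (c : _ → ℂ), (∀ i, A (b i) = c i • b i) →
      ∀ i v, b.coord i (A v) = c i * b.coord i v := by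
    intro A c hA i v
    have : b.coord i ∘ₗ A = c i • b.coord i := b.ext fun j => by
      by_cases hij : j = i
      · subst hij; simp [hA]
      · simp [hA, hij]
    exact LinearMap.congr_fun this v
  exact ⟨_, b, s, l, n, hb, h, fun i => ⟨(h i).sign, key _ _ (fun j => (h j).eP) i,
    key _ _ (fun j => (h j).eE) i, key _ _ (fun j => (h j).eG) i⟩⟩

/-- A surjective module map has a section which commutes with `E` and `G`. -/
theorem exists_wt_section {f : V →ₗ[ℂ] W} (hf : f ∈ homs M N) (hs : Function.Surjective f) :
    ∃ g ∈ wtHoms N M, f ∘ₗ g = LinearMap.id := by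
  -- Choosing the basis of the target among images of weight vectors gives every basis vector a
  -- preimage which is a weight vector.
  obtain ⟨d, b, s, l, n, hb, hw, hc⟩ := exists_wt_basis N (f '' {v | ∃ s l n, IsWt M s l n v})
    (by rw [← Submodule.map_span, span_wt, Submodule.map_top, LinearMap.range_eq_top.mpr hs])
    (by rintro _ ⟨v, ⟨s, l, n, hv⟩, rfl⟩; exact ⟨s, l, n, hv.map hf⟩)
  choose v hv hfv using hb
  have key : ∀ i, b.constr ℂ v (b i) = v i := fun i => b.constr_basis ℂ v i
  -- The weight of the preimage is a priori unrelated to that of b i; eigenvalues on the nonzero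
  -- vector b i = f (v i) identify the two.
  have hz : ∀ i, IsWt M (s i) (l i) (n i) (v i) ∨ b i = 0 := fun i => by
    by_cases h0 : b i = 0
    · exact Or.inr h0
    refine Or.inl ?_
    obtain ⟨s', l', n', h⟩ := hv i
    have h' := h.map hf
    rw [hfv] at h'
    refine h.cast ?_ ?_ ?_
    · exact smul_left_injective ℂ h0 (h'.eP.symm.trans (hw i).eP)
    · exact smul_left_injective ℂ h0 (h'.eE.symm.trans (hw i).eE)
    · exact_mod_cast smul_left_injective ℂ h0 (h'.eG.symm.trans (hw i).eG)
  have hz' : ∀ i, IsWt M (s i) (l i) (n i) (v i) := fun i => (hz i).resolve_right (b.ne_zero i)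
  refine ⟨b.constr ℂ v, ⟨b.ext fun i => ?_, b.ext fun i => ?_, b.ext fun i => ?_⟩,
    b.ext fun i => ?_⟩
  · simp only [LinearMap.comp_apply, (hw i).eP, map_smul, key, (hz' i).eP]
  · simp only [LinearMap.comp_apply, (hw i).eE, map_smul, key, (hz' i).eE]
  · simp only [LinearMap.comp_apply, (hw i).eG, map_smul, key, (hz' i).eG]
  · simp only [LinearMap.comp_apply, key, hfv, LinearMap.id_apply]

/-- A weight vector is detected by a functional of the same weight. -/
theorem IsWt.exists_cowt (hv : IsWt M s l n v) (h0 : v ≠ 0) : ∃ φ, IsCoWt M s l n φ ∧ φ v = 1 := by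
  by_contra! hcon
  have : ∀ φ : Module.Dual ℂ V, φ v = 0 := by
    intro φ
    -- Weight functionals span the dual, so one of them is nonzero on v unless evaluation at v is
    -- zero. Such a functional has the weight of v and can be rescaled.
    have : LinearMap.applyₗ (R := ℂ) v = (0 : Module.Dual ℂ V →ₗ[ℂ] ℂ) :=
      ext_cowt M fun s' l' n' φ hφ => by
        by_contra hne
        have hne' : φ v ≠ 0 := hne
        obtain ⟨rfl, rfl, rfl⟩ := hφ.pair hv hne'
        refine hcon ((φ v)⁻¹ • φ) ⟨hφ.sign, fun w => ?_, fun w => ?_, fun w => ?_⟩ ?_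
        · simp [hφ.eP]; ring
        · simp [hφ.eE]; ring
        · simp [hφ.eG]; ring
        · simp [hne']
    exact LinearMap.congr_fun this φ
  exact h0 ((Module.forall_dual_apply_eq_zero_iff ℂ v).mp this)

lemma IsWt.unique (hv : IsWt M s l n v) (hv' : IsWt M t m n' v) (h0 : v ≠ 0) :
    s = t ∧ l = m ∧ n = n' :=
  ⟨smul_left_injective ℂ h0 (hv.eP.symm.trans hv'.eP),
    smul_left_injective ℂ h0 (hv.eE.symm.trans hv'.eE),
    by exact_mod_cast smul_left_injective ℂ h0 (hv.eG.symm.trans hv'.eG)⟩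

/-- The action induced on the target of a surjective linear map. -/
def ofSurjective (M : IntAction ħ V) (π : V →ₗ[ℂ] W) (hπ : Function.Surjective π)
    (P E G X Y : Module.End ℂ W) (hP : ∀ v, P (π v) = π (M.P v)) (hE : ∀ v, E (π v) = π (M.E v))
    (hG : ∀ v, G (π v) = π (M.G v)) (hX : ∀ v, X (π v) = π (M.X v))
    (hY : ∀ v, Y (π v) = π (M.Y v)) : IntAction ħ W where
  P := P
  E := E
  G := G
  X := X
  Y := Y
  P_P := LinearMap.ext <| hπ.forall.mpr fun v => by
    have := congrArg π (LinearMap.congr_fun M.P_P v); simpa [hP] using this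
  P_E := LinearMap.ext <| hπ.forall.mpr fun v => by
    have := congrArg π (LinearMap.congr_fun M.P_E v); simpa [hP, hE] using this
  P_G := LinearMap.ext <| hπ.forall.mpr fun v => by
    have := congrArg π (LinearMap.congr_fun M.P_G v); simpa [hP, hG] using this
  P_X := LinearMap.ext <| hπ.forall.mpr fun v => by
    have := congrArg π (LinearMap.congr_fun M.P_X v); simpa [hP, hX] using this
  P_Y := LinearMap.ext <| hπ.forall.mpr fun v => by
    have := congrArg π (LinearMap.congr_fun M.P_Y v); simpa [hP, hY] using this
  E_X := LinearMap.ext <| hπ.forall.mpr fun v => by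
    have := congrArg π (LinearMap.congr_fun M.E_X v); simpa [hE, hX] using this
  E_Y := LinearMap.ext <| hπ.forall.mpr fun v => by
    have := congrArg π (LinearMap.congr_fun M.E_Y v); simpa [hE, hY] using this
  E_G := LinearMap.ext <| hπ.forall.mpr fun v => by
    have := congrArg π (LinearMap.congr_fun M.E_G v); simpa [hE, hG] using this
  G_X := LinearMap.ext <| hπ.forall.mpr fun v => by
    have := congrArg π (LinearMap.congr_fun M.G_X v); simpa [hG, hX] using this
  G_Y := LinearMap.ext <| hπ.forall.mpr fun v => by
    have := congrArg π (LinearMap.congr_fun M.G_Y v); simpa [hG, hY] using this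
  X_Y := by
    have : (X * Y + Y * X) ∘ₗ π = ((qdiff ħ)⁻¹ • (qpowEnd ħ E - qpowEnd ħ (-E))) ∘ₗ π :=
      ext_wt M fun s l n v hv => by
        have h1 : qpowEnd ħ E (π v) = qpow ħ l • π v :=
          qpowEnd_apply ħ (by rw [hE, hv.eE, map_smul])
        have h2 : qpowEnd ħ (-E) (π v) = qpow ħ (-l) • π v :=
          qpowEnd_apply ħ (by rw [LinearMap.neg_apply, hE, hv.eE, map_smul, neg_smul])
        simp only [LinearMap.comp_apply, LinearMap.add_apply, Module.End.mul_apply, hX, hY,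
          LinearMap.smul_apply, LinearMap.sub_apply, h1, h2, hv.eXY, map_sub, map_smul, qpow_neg]
        module
    exact LinearMap.ext <| hπ.forall.mpr (LinearMap.congr_fun this)
  X_X := LinearMap.ext <| hπ.forall.mpr fun v => by
    have := congrArg π (LinearMap.congr_fun M.X_X v); simpa [hX] using this
  Y_Y := LinearMap.ext <| hπ.forall.mpr fun v => by
    have := congrArg π (LinearMap.congr_fun M.Y_Y v); simpa [hY] using this
  weight := by
    set S := ⨆ (l : ℂ) (n : ℤ), E.eigenspace l ⊓ G.eigenspace (n : ℂ)
    have : S.mkQ ∘ₗ π = 0 := ext_wt M fun s l n v hv => by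
      rw [LinearMap.comp_apply, LinearMap.zero_apply, Submodule.mkQ_apply,
        Submodule.Quotient.mk_eq_zero]
      refine Submodule.mem_iSup_of_mem l (Submodule.mem_iSup_of_mem n ⟨?_, ?_⟩)
      · exact Module.End.mem_eigenspace_iff.mpr (by rw [hE, hv.eE, map_smul])
      · exact Module.End.mem_eigenspace_iff.mpr (by rw [hG, hv.eG, map_smul])
    rw [eq_top_iff]
    intro w _
    obtain ⟨v, rfl⟩ := hπ w
    exact (Submodule.Quotient.mk_eq_zero S).mp (LinearMap.congr_fun this v)

end IntAction
end IntWeight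

/-! ### Cokernels, and modules induced from one dimensional weight modules -/

namespace IntWeightModule

open IntWeight IntAction

variable {ħ : ℂ} {V W U : IntWeightModule ħ}

/-- The cokernel of a morphism. -/
def coker (f : V ⟶ W) : IntWeightModule ħ where
  carrier := W.carrier ⧸ LinearMap.range (lin f)
  action :=
    have key : ∀ (A : Module.End ℂ V.carrier) (B : Module.End ℂ W.carrier),
        lin f ∘ₗ A = B ∘ₗ lin f → LinearMap.range (lin f) ≤ (LinearMap.range (lin f)).comap B := by
      rintro A B h _ ⟨v, rfl⟩
      exact ⟨A v, LinearMap.congr_fun h v⟩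
    ofSurjective W.action (LinearMap.range (lin f)).mkQ (Submodule.mkQ_surjective _)
      (Submodule.mapQ _ _ W.action.P (key _ _ (lin_mem f).1))
      (Submodule.mapQ _ _ W.action.E (key _ _ (lin_mem f).2.1))
      (Submodule.mapQ _ _ W.action.G (key _ _ (lin_mem f).2.2.1))
      (Submodule.mapQ _ _ W.action.X (key _ _ (lin_mem f).2.2.2.1))
      (Submodule.mapQ _ _ W.action.Y (key _ _ (lin_mem f).2.2.2.2))
      (fun _ => rfl) (fun _ => rfl) (fun _ => rfl) (fun _ => rfl) (fun _ => rfl)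

/-- The projection onto the cokernel. -/
def cokerπ (f : V ⟶ W) : W ⟶ coker f :=
  ofLin (LinearMap.range (lin f)).mkQ 
    ⟨LinearMap.ext fun _ => rfl, LinearMap.ext fun _ => rfl, LinearMap.ext fun _ => rfl,
      LinearMap.ext fun _ => rfl, LinearMap.ext fun _ => rfl⟩

/-- An epimorphism equalizes the projection to its cokernel with zero, so the cokernel vanishes. -/
lemma surjective_of_epi (f : V ⟶ W) [Epi f] : Function.Surjective (lin f) := by
  have h : f ≫ cokerπ f = f ≫ 0 := lin_injective (LinearMap.ext fun v => by
    have : lin (cokerπ f) (lin f v) = 0 :=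
      (Submodule.Quotient.mk_eq_zero (LinearMap.range (lin f))).mpr (LinearMap.mem_range_self _ v)
    simpa using this)
  have h' := (cancel_epi f).mp h
  intro w
  have h2 : lin (cokerπ f) w = 0 := by rw [h']; rfl
  exact (Submodule.Quotient.mk_eq_zero (LinearMap.range (lin f))).mp h2

lemma epi_of_surjective (f : V ⟶ W) (h : Function.Surjective (lin f)) : Epi f where
  left_cancellation g g' e := lin_injective (LinearMap.ext <| h.forall.mpr fun v =>
    LinearMap.congr_fun (congrArg lin e) v)

lemma paritySign_eq (p : ZMod 2) : paritySign p = 1 ∨ paritySign p = -1 := by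
  rw [paritySign]; split_ifs <;> simp

lemma exists_paritySign {s : ℂ} (h : s = 1 ∨ s = -1) : ∃ p, paritySign p = s := by
  rcases h with rfl | rfl
  · exact ⟨0, by simp [paritySign]⟩
  · exact ⟨1, by simp [paritySign]⟩

lemma paritySign_add (p p' : ZMod 2) :
    paritySign (p + p') = paritySign p * paritySign p' := by
  have h : ∀ p : ZMod 2, p = 0 ∨ p = 1 := by decide
  have h2 : (1 + 1 : ZMod 2) = 0 := by decide
  rcases h p with rfl | rfl <;> rcases h p' with rfl | rfl <;> simp [paritySign, h2]

lemma paritySign_injective : Function.Injective paritySign := by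
  intro p p' hp
  have h : ∀ p : ZMod 2, p = 0 ∨ p = 1 := by decide
  have h1 : (1 : ℂ) ≠ -1 := by norm_num
  have h2 : (-1 : ℂ) ≠ 1 := by norm_num
  rcases h p with rfl | rfl <;> rcases h p' with rfl | rfl <;> simp_all [paritySign]

/-- The action on the module induced from the one dimensional module of parity `p` and weight
`(l, n)` over `E`, `G`, `K`. The basis is `p₀`, `Y p₀`, `X p₀`, `Y X p₀`. -/
def indAction (ħ l : ℂ) (n : ℤ) (p : ZMod 2) : IntAction ħ ((ℂ × ℂ) × (ℂ × ℂ)) where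
  P :=
    { toFun := fun v => ((paritySign p * v.1.1, -paritySign p * v.1.2),
        (-paritySign p * v.2.1, paritySign p * v.2.2))
      map_add' := fun v w => by ext <;> simp <;> ring
      map_smul' := fun c v => by ext <;> simp <;> ring }
  E := l • 1
  G :=
    { toFun := fun v => ((n * v.1.1, (n - 1) * v.1.2), ((n + 1) * v.2.1, n * v.2.2))
      map_add' := fun v w => by ext <;> simp <;> ring
      map_smul' := fun c v => by ext <;> simp <;> ring }
  X :=
    -- The relations used are XYp₀ = [l] p₀ − YXp₀ and XYXp₀ = [l] Xp₀, with [l] = `qnum ħ l`.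
    { toFun := fun v => ((qnum ħ l * v.1.2, 0), (v.1.1 + qnum ħ l * v.2.2, -v.1.2))
      map_add' := fun v w => by ext <;> simp <;> ring
      map_smul' := fun c v => by ext <;> simp <;> ring }
  Y :=
    { toFun := fun v => ((0, v.1.1), (0, v.2.1))
      map_add' := fun v w => by ext <;> simp
      map_smul' := fun c v => by ext <;> simp }
  P_P := LinearMap.ext fun v => by ext <;> simp [← mul_assoc, paritySign_mul_self]
  P_E := LinearMap.ext fun v => by ext <;> simp
  P_G := LinearMap.ext fun v => by ext <;> simp <;> ring
  P_X := LinearMap.ext fun v => by ext <;> simp <;> ring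
  P_Y := LinearMap.ext fun v => by ext <;> simp
  E_X := LinearMap.ext fun v => by ext <;> simp
  E_Y := LinearMap.ext fun v => by ext <;> simp
  E_G := LinearMap.ext fun v => by ext <;> simp
  G_X := LinearMap.ext fun v => by ext <;> simp <;> ring
  G_Y := LinearMap.ext fun v => by ext <;> simp <;> ring
  X_Y := by
    have h1 : ∀ v : (ℂ × ℂ) × (ℂ × ℂ),
        qpowEnd ħ (l • (1 : Module.End ℂ ((ℂ × ℂ) × (ℂ × ℂ)))) v = qpow ħ l • v :=
      fun v => qpowEnd_apply ħ (by simp)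
    have h2 : ∀ v : (ℂ × ℂ) × (ℂ × ℂ),
        qpowEnd ħ (-(l • (1 : Module.End ℂ ((ℂ × ℂ) × (ℂ × ℂ))))) v = qpow ħ (-l) • v :=
      fun v => qpowEnd_apply ħ (by simp)
    refine LinearMap.ext fun v => ?_
    simp only [LinearMap.add_apply, LinearMap.smul_apply, LinearMap.sub_apply, h1, h2, qpow_neg,
      qnum]
    ext <;> simp <;> ring
  X_X := LinearMap.ext fun v => by ext <;> simp
  Y_Y := LinearMap.ext fun v => by ext <;> simp
  weight := by
    rw [eq_top_iff]
    intro v _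
    rw [show v = (((v.1.1, 0), (0, v.2.2)) + ((0, v.1.2), (0, 0))) + ((0, 0), (v.2.1, 0)) by
      ext <;> simp]
    refine add_mem (add_mem
      (Submodule.mem_iSup_of_mem l (Submodule.mem_iSup_of_mem n ⟨?_, ?_⟩))
      (Submodule.mem_iSup_of_mem l (Submodule.mem_iSup_of_mem (n - 1) ⟨?_, ?_⟩)))
      (Submodule.mem_iSup_of_mem l (Submodule.mem_iSup_of_mem (n + 1) ⟨?_, ?_⟩)) <;>
    simp

/-- The module induced from the one dimensional module of parity `p` and weight `(l, n)`. -/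
def ind (ħ l : ℂ) (n : ℤ) (p : ZMod 2) : IntWeightModule ħ where
  carrier := (ℂ × ℂ) × (ℂ × ℂ)
  action := indAction ħ l n p

section maps

variable {A : Type*} [AddCommGroup A] [Module ℂ A] [Module.Finite ℂ A] {M : IntAction ħ A}
  {l : ℂ} {n : ℤ} {p : ZMod 2}

/-- The linear map from the induced module which maps `p₀` to `w`. -/
def indLin (M : IntAction ħ A) (w : A) : (ℂ × ℂ) × (ℂ × ℂ) →ₗ[ℂ] A where
  toFun v := v.1.1 • w + v.1.2 • M.Y w + v.2.1 • M.X w + v.2.2 • M.Y (M.X w)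
  map_add' v v' := by simp; module
  map_smul' c v := by simp; module

lemma indLin_mem {w : A} (hw : IsWt M (paritySign p) l n w) :
    indLin M w ∈ homs (indAction ħ l n p) M := by
  refine ⟨?_, ?_, ?_, ?_, ?_⟩ <;> refine LinearMap.ext fun v => ?_
  · simp [indLin, indAction, hw.eP, hw.X.eP, hw.Y.eP, hw.YX.eP]; module
  · simp [indLin, indAction, hw.eE, hw.X.eE, hw.Y.eE, hw.YX.eE]; module
  · simp [indLin, indAction, hw.eG, hw.X.eG, hw.Y.eG, hw.YX.eG]; module
  · simp [indLin, indAction, hw.X.X_Y_apply, hw.X_Y_apply, X_X_apply]; module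
  · simp [indLin, indAction, Y_Y_apply]

/-- The linear map to the induced module given by a functional. -/
def coindLin (M : IntAction ħ A) (φ : Module.Dual ℂ A) : A →ₗ[ℂ] (ℂ × ℂ) × (ℂ × ℂ) where
  toFun x := ((-φ (M.X (M.Y x)), -φ (M.X x)), (φ (M.Y x), φ x))
  map_add' v v' := by ext <;> simp <;> ring
  map_smul' c v := by ext <;> simp

/-- The induced module is also coinduced. Taking φ as the coefficient of YXp₀, commutation with Y
and X forces the coefficients of Xp₀ and Yp₀, and then that of p₀; the content is that the forced
formula is a module map. -/
lemma coindLin_mem {φ : Module.Dual ℂ A} (hφ : IsCoWt M (paritySign p) l n φ) :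
    coindLin M φ ∈ homs M (indAction ħ l n p) := by
  have hz : ∀ x, φ (M.X (M.Y x)) + φ (M.Y (M.X x)) =
      qnum ħ l * φ x := by
    intro x
    have : φ ∘ₗ M.X ∘ₗ M.Y + φ ∘ₗ M.Y ∘ₗ M.X = qnum ħ l • φ :=
      ext_wt M fun t m k v hv => by
        simp only [LinearMap.add_apply, LinearMap.comp_apply, hv.X_Y_apply, map_sub, map_smul,
          LinearMap.smul_apply, sub_add_cancel, smul_eq_mul]
        by_cases h0 : φ v = 0
        · simp [h0]
        · rw [(hφ.pair hv h0).2.1]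
    exact LinearMap.congr_fun this x
  have hz' : ∀ x, φ (M.Y (M.X x)) = qnum ħ l * φ x - φ (M.X (M.Y x)) :=
    fun x => by rw [← hz x]; ring
  have hxyx : ∀ x, φ (M.X (M.Y (M.X x))) = qnum ħ l * φ (M.X x) :=
    fun x => by
      have := hz (M.X x)
      rwa [X_X_apply, map_zero, map_zero, add_zero] at this
  have hPX : ∀ x, φ (M.X (M.P x)) = -(paritySign p * φ (M.X x)) := fun x => by
    have := congrArg φ (LinearMap.congr_fun M.P_X x)
    simp [hφ.eP] at this; rw [this]; ring
  have hPY : ∀ x, φ (M.Y (M.P x)) = -(paritySign p * φ (M.Y x)) := fun x => by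
    have := congrArg φ (LinearMap.congr_fun M.P_Y x)
    simp [hφ.eP] at this; rw [this]; ring
  have hEX : ∀ x, φ (M.X (M.E x)) = l * φ (M.X x) := fun x => by
    have := congrArg φ (LinearMap.congr_fun M.E_X x)
    simp [hφ.eE] at this; linear_combination -this
  have hEY : ∀ x, φ (M.Y (M.E x)) = l * φ (M.Y x) := fun x => by
    have := congrArg φ (LinearMap.congr_fun M.E_Y x)
    simp [hφ.eE] at this; linear_combination -this
  have hGX : ∀ x, φ (M.X (M.G x)) = (n - 1) * φ (M.X x) := fun x => by
    have := congrArg φ (LinearMap.congr_fun M.G_X x)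
    simp [hφ.eG] at this; linear_combination -this
  have hGY : ∀ x, φ (M.Y (M.G x)) = (n + 1) * φ (M.Y x) := fun x => by
    have := congrArg φ (LinearMap.congr_fun M.G_Y x)
    simp [hφ.eG] at this; linear_combination -this
  have hPXY : ∀ x, φ (M.X (M.Y (M.P x))) =
      paritySign p * φ (M.X (M.Y x)) := fun x => by
    have := LinearMap.congr_fun M.P_Y x
    simp at this
    rw [← neg_eq_iff_eq_neg] at this
    rw [← this, map_neg, map_neg, hPX, neg_neg]
  have hEXY : ∀ x, φ (M.X (M.Y (M.E x))) =
      l * φ (M.X (M.Y x)) := fun x => by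
    have := LinearMap.congr_fun M.E_Y x
    simp [sub_eq_zero] at this
    rw [← this, hEX]
  have hGXY : ∀ x, φ (M.X (M.Y (M.G x))) =
      n * φ (M.X (M.Y x)) := fun x => by
    have := LinearMap.congr_fun M.G_Y x
    simp [sub_eq_iff_eq_add] at this
    have h2 : M.Y (M.G x) = M.G (M.Y x) + M.Y x := by
      rw [this]; abel
    rw [h2, map_add, map_add, hGX]; ring
  refine ⟨?_, ?_, ?_, ?_, ?_⟩ <;> refine LinearMap.ext fun x => ?_
  · simp [coindLin, indAction, hφ.eP, hPX, hPY, hPXY]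
  · simp [coindLin, indAction, hφ.eE, hEX, hEY, hEXY]
  · simp [coindLin, indAction, hφ.eG, hGX, hGY, hGXY]
  · simp [coindLin, indAction, X_X_apply, hz', hxyx]
    ring
  · simp [coindLin, indAction, Y_Y_apply]

end maps

/-- The morphism from the induced module which maps `p₀` to `w`. -/
def indMap {l : ℂ} {n : ℤ} {p : ZMod 2} {w : V.carrier} (hw : IsWt V.action (paritySign p) l n w) :
    ind ħ l n p ⟶ V :=
  ofLin (V := ind ħ l n p) (indLin V.action w) (indLin_mem hw)

lemma lin_indMap {l : ℂ} {n : ℤ} {p : ZMod 2} {w : V.carrier}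
    (hw : IsWt V.action (paritySign p) l n w) (v : (ℂ × ℂ) × (ℂ × ℂ)) :
    lin (indMap hw) v = v.1.1 • w + v.1.2 • V.action.Y w +
        v.2.1 • V.action.X w + v.2.2 • V.action.Y (V.action.X w) := rfl

/-- The morphism to the induced module given by a functional. -/
def coindMap {l : ℂ} {n : ℤ} {p : ZMod 2} {φ : Module.Dual ℂ V.carrier}
    (hφ : IsCoWt V.action (paritySign p) l n φ) : V ⟶ ind ħ l n p :=
  ofLin (W := ind ħ l n p) (coindLin V.action φ) (coindLin_mem hφ)

lemma lin_coindMap {l : ℂ} {n : ℤ} {p : ZMod 2} {φ : Module.Dual ℂ V.carrier}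
    (hφ : IsCoWt V.action (paritySign p) l n φ) (x : V.carrier) :
    lin (coindMap hφ) x = (((-φ (V.action.X (V.action.Y x)), -φ (V.action.X x)),
        (φ (V.action.Y x), φ x)) : (ℂ × ℂ) × (ℂ × ℂ)) := rfl

/-- The contraction of the induced module which maps `Y X p₀` to `p₀`. -/
def indContraction : Module.End ℂ ((ℂ × ℂ) × (ℂ × ℂ)) where
  toFun v := ((v.2.2, 0), (0, 0))
  map_add' v w := by ext <;> simp
  map_smul' c v := by ext <;> simp

/-- On p₀ only the term −hXYp₀ = hYXp₀ = p₀ survives, and p₀ generates. -/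
lemma isContraction_ind (l : ℂ) (n : ℤ) (p : ZMod 2) :
    IsContraction (indAction ħ l n p) indContraction where
  mem := by
    refine ⟨?_, ?_, ?_⟩ <;> refine LinearMap.ext fun v => ?_ <;>
      simp [indAction, indContraction]
  relTrace_eq := LinearMap.ext fun v => by
    rw [relTrace_apply]
    ext <;> simp [indAction, indContraction]

lemma isWt_ind (l : ℂ) (n : ℤ) (p : ZMod 2) :
    IsWt (indAction ħ l n p) (paritySign p) l n (((1, 0), (0, 0)) : (ℂ × ℂ) × (ℂ × ℂ)) where
  sign := paritySign_eq p
  eP := by simp [indAction]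
  eE := by simp [indAction]
  eG := by simp [indAction]

end IntWeightModule

/-! ### Projectivity and the modified trace -/

namespace IntWeightModule

open IntWeight IntAction RelMod

variable {ħ : ℂ} {V W U : IntWeightModule ħ}

/-- The morphism `ε` from the module induced from the trivial one to the unit. -/
def indCounit (ħ : ℂ) : ind ħ 0 0 0 ⟶ 𝟙_ (IntWeightModule ħ) :=
  indMap (V := unitObj ħ) (p := 0) (w := (1 : ℂ)) (by
    rw [show paritySign 0 = 1 by simp [paritySign]]; exact isWt_unit (1 : ℂ))

/-- If g is a weight-preserving section of f, then f ∘ `relTrace` (g h) = `relTrace` (f g h) =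
`relTrace` h = 1, so `relTrace` (g h) is a section by a module map. -/
theorem isProjective_of_isContraction {h : Module.End ℂ V.carrier}
    (hh : IsContraction V.action h) : (∀ ⦃W : IntWeightModule ħ⦄ (f : W ⟶ V), Epi f →
      ∃ s : V ⟶ W, s ≫ f = 𝟙 V) := by
  intro W f hf
  obtain ⟨g, hg, hfg⟩ := exists_wt_section (lin_mem f) (surjective_of_epi f)
  refine ⟨ofLin (relTrace V.action W.action (g ∘ₗ h)) (relTrace_mem (wtHoms_comp hh.mem hg)),
    lin_injective ?_⟩
  rw [lin_comp, lin_ofLin, ← relTrace_comp_left (lin_mem f), ← LinearMap.comp_assoc, hfg,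
    LinearMap.id_comp, hh.relTrace_eq]
  rfl

variable [Admissible ħ]

/-- For the converse, tensoring the surjection from an induced module to the unit with V presents V
as a quotient of a module that has a contraction. A splitting makes V a retract of it, and
contractions pass to retracts. -/
theorem isProjective_iff : IsProjective (IntWeightModule ħ) V ↔
    ∃ h, IsContraction V.action h := by
  refine ⟨fun hV => ?_, fun ⟨h, hh⟩ => isProjective_of_isContraction hh⟩
  let f : ind ħ 0 0 0 ⊗ V ⟶ V := (indCounit ħ ▷ V) ≫ (λ_ V).hom
  have hf : Epi f := epi_of_surjective f fun v => by
    refine ⟨(((1, 0), (0, 0)) : (ℂ × ℂ) × (ℂ × ℂ)) ⊗ₜ[ℂ] v, ?_⟩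
    have h1 : lin (indCounit ħ) (((1, 0), (0, 0)) : (ℂ × ℂ) × (ℂ × ℂ)) = (1 : ℂ) := by
      refine (lin_indMap (V := unitObj ħ) _ _).trans ?_
      simp only [zero_smul, add_zero]
      exact one_smul ℂ (1 : ℂ)
    have h2 : ∀ c : ℂ, lin (indCounit ħ) (((1, 0), (0, 0)) : (ℂ × ℂ) × (ℂ × ℂ)) = c →
        lin f ((((1, 0), (0, 0)) : (ℂ × ℂ) × (ℂ × ℂ)) ⊗ₜ[ℂ] v) = c • v := by
      rintro c hc
      subst hc
      rfl
    rw [h2 1 h1, one_smul]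
  obtain ⟨s, hs⟩ := hV f hf
  exact ⟨_, ((isContraction_ind 0 0 0).tensor V.action).retract (lin_mem s) (lin_mem f)
    (congrArg lin hs)⟩

lemma projective_isIdeal : IsIdeal (IsProjective (IntWeightModule ħ)) where
  retract hW f g e := by
    obtain ⟨h, hh⟩ := isProjective_iff.mp hW
    exact isProjective_iff.mpr ⟨_, hh.retract (lin_mem f) (lin_mem g) (congrArg lin e)⟩
  tensor hU V := by
    obtain ⟨h, hh⟩ := isProjective_iff.mp hU
    exact isProjective_iff.mpr ⟨_, hh.tensor V.action⟩

/-- The value on `f` of the modified trace, computed with the contraction `h`. -/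
def contractionTrace (V : IntWeightModule ħ) (h : Module.End ℂ V.carrier) :
    (V ⟶ V) →ₗ[ℂ] ℂ where
  -- This is the supertrace of f h. The scalar is the normalization d(V(1,0)_0) = (q − q⁻¹)⁻¹: the
  -- contraction of V(1,0)_0 has supertrace −1.
  toFun f := -(qdiff ħ)⁻¹ * LinearMap.trace ℂ V.carrier (V.action.P * lin f * h)
  map_add' f g := by simp [mul_add, add_mul]
  map_smul' c f := by simp; ring

lemma contractionTrace_apply (h : Module.End ℂ V.carrier) (f : V ⟶ V) :
    contractionTrace V h f =
      -(qdiff ħ)⁻¹ * LinearMap.trace ℂ V.carrier (V.action.P * lin f * h) := rfl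

/-- For x = f k g one has `relTrace` x = f g, because `relTrace` k = 1. Self-adjointness moves
`relTrace` from x to h, where it becomes the identity, and the ordinary trace is cyclic. -/
lemma contractionTrace_comp {h : Module.End ℂ V.carrier} (hh : IsContraction V.action h)
    {k : Module.End ℂ W.carrier} (hk : IsContraction W.action k) (f : W ⟶ V) (g : V ⟶ W) :
    contractionTrace V h (g ≫ f) = contractionTrace W k (f ≫ g) := by
  rw [contractionTrace_apply, contractionTrace_apply]
  congr 1
  let x : Module.End ℂ V.carrier := lin f ∘ₗ k ∘ₗ lin g
  have hx : x ∈ wtHoms V.action V.action := wtHoms_comp (wtHoms_comp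
    (homs_le_wtHoms (lin_mem g)) hk.mem) (homs_le_wtHoms (lin_mem f))
  have e : relTrace V.action V.action x = lin (g ≫ f) := by
    rw [relTrace_comp_left (lin_mem f), relTrace_comp_right (lin_mem g), hk.relTrace_eq]
    rfl
  rw [← e, trace_relTrace hx hh.mem, hh.relTrace_eq]
  change LinearMap.trace ℂ _ ((V.action.P ∘ₗ lin f ∘ₗ k) ∘ₗ lin g) = _
  rw [LinearMap.trace_comp_comm', ← LinearMap.comp_assoc]
  have : lin g ∘ₗ V.action.P = W.action.P ∘ₗ lin g := (lin_mem g).1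
  rw [this]
  rfl

/-- Cyclicity with one of the morphisms equal to the identity, and a different contraction on each
side. -/
lemma contractionTrace_eq {h k : Module.End ℂ V.carrier} (hh : IsContraction V.action h)
    (hk : IsContraction V.action k) : contractionTrace V h = contractionTrace V k :=
  LinearMap.ext fun f => by
    have := contractionTrace_comp hh hk f (𝟙 V)
    rwa [Category.id_comp, Category.comp_id] at this

/-- In the product basis both sides are the same double sum: an evaluation twisted by C turns the
partial trace over B into the diagonal coefficients of C applied in the second factor. -/
lemma trace_comp_partialTrace {A B : Type*} [AddCommGroup A] [Module ℂ A] [Module.Finite ℂ A]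
    [AddCommGroup B] [Module ℂ B] [Module.Finite ℂ B] (f : A ⊗[ℂ] B →ₗ[ℂ] A ⊗[ℂ] B)
    (ev : B ⊗[ℂ] Module.Dual ℂ B →ₗ[ℂ] ℂ) (C : Module.End ℂ B)
    (hev : ∀ v φ, ev (v ⊗ₜ φ) = φ (C v)) (T D : Module.End ℂ A)
    (hT : ∀ v, T v = (TensorProduct.rid ℂ A) ((TensorProduct.map LinearMap.id ev)
      ((TensorProduct.assoc ℂ _ _ _) ((TensorProduct.map f LinearMap.id)
        ((TensorProduct.assoc ℂ _ _ _).symm (v ⊗ₜ coevaluation ℂ B 1)))))) :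
    LinearMap.trace ℂ A (D * T) =
      LinearMap.trace ℂ (A ⊗[ℂ] B) (TensorProduct.map D C * f) := by
  classical
  set b := Module.Basis.ofVectorSpace ℂ B with hb
  set a := Module.Basis.ofVectorSpace ℂ A
  have h1 : ∀ (φ : Module.Dual ℂ B) (y : A ⊗[ℂ] B),
      (TensorProduct.rid ℂ A) ((TensorProduct.map LinearMap.id ev)
        ((TensorProduct.assoc ℂ A B _) (y ⊗ₜ φ))) =
      (TensorProduct.rid ℂ A) (TensorProduct.map LinearMap.id (φ ∘ₗ C) y) := by
    intro φ y
    induction y with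
    | zero => simp
    | add x y hx hy => simp only [TensorProduct.add_tmul, map_add, hx, hy]
    | tmul x y => simp [hev]
  have h2 : ∀ v, T v = ∑ i, (TensorProduct.rid ℂ A)
      (TensorProduct.map LinearMap.id (b.coord i ∘ₗ C) (f (v ⊗ₜ b i))) := by
    intro v
    rw [hT, coevaluation_apply_one]
    simp only [TensorProduct.tmul_sum, map_sum, TensorProduct.assoc_symm_tmul,
      TensorProduct.map_tmul, LinearMap.id_apply, h1]
    rfl
  have h3 : ∀ (i : _) (j : _) (y : A ⊗[ℂ] B), a.coord j (D ((TensorProduct.rid ℂ A)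
      (TensorProduct.map LinearMap.id (b.coord i ∘ₗ C) y))) =
      (a.tensorProduct b).coord (j, i) (TensorProduct.map D C y) := by
    intro i j y
    induction y with
    | zero => simp
    | add x y hx hy => simp only [map_add, hx, hy]
    | tmul x y => simp [mul_comm]
  rw [LinearMap.trace_eq_matrix_trace ℂ a, LinearMap.trace_eq_matrix_trace ℂ (a.tensorProduct b),
    Matrix.trace, Matrix.trace, Fintype.sum_prod_type]
  refine Finset.sum_congr rfl fun j _ => ?_
  simp only [Matrix.diag_apply, LinearMap.toMatrix_apply, Module.End.mul_apply, h2, map_sum,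
    Module.Basis.tensorProduct_apply]
  rw [Finset.sum_apply']
  exact Finset.sum_congr rfl fun i _ => h3 i j _

lemma contractionTrace_ptr (h : Module.End ℂ V.carrier) (hh : IsContraction V.action h)
    (f : V ⊗ W ⟶ V ⊗ W) : contractionTrace (V ⊗ W) (TensorProduct.map h W.action.K) f =
      contractionTrace V h (ptr V W f) := by
  let F : Module.End ℂ (V.carrier ⊗[ℂ] W.carrier) := lin f
  change -(qdiff ħ)⁻¹ * LinearMap.trace ℂ (V.carrier ⊗[ℂ] W.carrier)
    (TensorProduct.map V.action.P W.action.P * F * TensorProduct.map h W.action.K) =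
    -(qdiff ħ)⁻¹ * LinearMap.trace ℂ V.carrier (V.action.P * lin (ptr V W f) * h)
  congr 1
  have key := trace_comp_partialTrace F (lin (evR W)) (W.action.P * W.action.K)
    (fun v φ => lin_evR W v φ) (lin (ptr V W f)) (h * V.action.P) (fun v => rfl)
  have e1 : LinearMap.trace ℂ V.carrier (V.action.P * lin (ptr V W f) * h) =
      LinearMap.trace ℂ V.carrier (h * V.action.P * lin (ptr V W f)) := by
    rw [LinearMap.trace_mul_comm, mul_assoc]
  rw [e1, key]
  -- The pivotal operator PK of W supplies both the parity of W, as the supertrace on V ⊗ W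
  -- requires, and the K of the contraction h ⊗ K.
  have e2 : (TensorProduct.map (h * V.action.P) (W.action.P * W.action.K) :
      Module.End ℂ (V.carrier ⊗[ℂ] W.carrier)) =
      TensorProduct.map h W.action.K * TensorProduct.map V.action.P W.action.P := by
    rw [← TensorProduct.map_mul]
    congr 1
    exact ext_wt W.action fun s l n v hv => by
      simp [hv.eK, hv.eP, smul_smul, mul_comm]
  rw [e2]
  rw [LinearMap.trace_mul_comm, mul_assoc]

/-- The modified trace on the ideal of projective objects. -/
def mTrace (ħ : ℂ) [Admissible ħ] : MTrace ℂ (IsProjective (IntWeightModule ħ)) where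
  isIdeal := projective_isIdeal
  trace V hV := contractionTrace V (isProjective_iff.mp hV).choose
  cyclic hV hW f g := contractionTrace_comp (isProjective_iff.mp hV).choose_spec
    (isProjective_iff.mp hW).choose_spec f g
  partial_trace {V} hV W f := by
    rw [← contractionTrace_ptr _ (isProjective_iff.mp hV).choose_spec f]
    exact LinearMap.congr_fun (contractionTrace_eq (Exists.choose_spec _)
      ((isProjective_iff.mp hV).choose_spec.tensor W.action)) f

/-- The trace is defined through a chosen contraction; this allows it to be computed with an
explicit one. -/
lemma mTrace_trace {hV : IsProjective (IntWeightModule ħ) V} {h : Module.End ℂ V.carrier}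
    (hh : IsContraction V.action h) (f : V ⟶ V) : (mTrace ħ).trace V hV f =
      -(qdiff ħ)⁻¹ * LinearMap.trace ℂ V.carrier (V.action.P * lin f * h) :=
  LinearMap.congr_fun (contractionTrace_eq (Exists.choose_spec _) hh) f

end IntWeightModule

/-! ### Finite products of actions, and functions of E -/

namespace IntWeight
namespace IntAction

variable {ħ : ℂ}

section pi

variable {ι : Type*} [Fintype ι] [DecidableEq ι] {A : ι → Type*} [∀ i, AddCommGroup (A i)]
  [∀ i, Module ℂ (A i)] [∀ i, Module.Finite ℂ (A i)]

/-- The componentwise action on a product. -/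
def pi (M : ∀ i, IntAction ħ (A i)) : IntAction ħ (∀ i, A i) where
  P := LinearMap.pi fun i => (M i).P ∘ₗ LinearMap.proj i
  E := LinearMap.pi fun i => (M i).E ∘ₗ LinearMap.proj i
  G := LinearMap.pi fun i => (M i).G ∘ₗ LinearMap.proj i
  X := LinearMap.pi fun i => (M i).X ∘ₗ LinearMap.proj i
  Y := LinearMap.pi fun i => (M i).Y ∘ₗ LinearMap.proj i
  P_P := LinearMap.ext fun v => funext fun i => by
    simpa using LinearMap.congr_fun (M i).P_P (v i)
  P_E := LinearMap.ext fun v => funext fun i => by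
    simpa using LinearMap.congr_fun (M i).P_E (v i)
  P_G := LinearMap.ext fun v => funext fun i => by
    simpa using LinearMap.congr_fun (M i).P_G (v i)
  P_X := LinearMap.ext fun v => funext fun i => by
    simpa using LinearMap.congr_fun (M i).P_X (v i)
  P_Y := LinearMap.ext fun v => funext fun i => by
    simpa using LinearMap.congr_fun (M i).P_Y (v i)
  E_X := LinearMap.ext fun v => funext fun i => by
    simpa using LinearMap.congr_fun (M i).E_X (v i)
  E_Y := LinearMap.ext fun v => funext fun i => by
    simpa using LinearMap.congr_fun (M i).E_Y (v i)
  E_G := LinearMap.ext fun v => funext fun i => by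
    simpa using LinearMap.congr_fun (M i).E_G (v i)
  G_X := LinearMap.ext fun v => funext fun i => by
    simpa using LinearMap.congr_fun (M i).G_X (v i)
  G_Y := LinearMap.ext fun v => funext fun i => by
    simpa using LinearMap.congr_fun (M i).G_Y (v i)
  X_Y := by
    -- The operator q^E on a product is not componentwise by definition, so the relation is checked
    -- on weight vectors of a single factor, where q^E is a scalar.
    refine LinearMap.pi_ext' fun i => ext_wt (M i) fun s l n v hv => ?_
    have hs : ∀ (F : ∀ i, Module.End ℂ (A i)) (v : A i),
        (LinearMap.pi fun i => F i ∘ₗ LinearMap.proj i) (Pi.single i v) =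
          (Pi.single i (F i v) : ∀ i, A i) := fun F v => by
      ext j
      by_cases h : j = i
      · subst h; simp
      · simp [h]
    have hE : (LinearMap.pi fun i => (M i).E ∘ₗ LinearMap.proj i) (Pi.single i v) =
        l • (Pi.single i v : ∀ i, A i) := by
      rw [hs fun i => (M i).E, hv.eE, Pi.single_smul]
    have h1 := qpowEnd_apply ħ hE
    have h2 := qpowEnd_apply ħ (T := -(LinearMap.pi fun i => (M i).E ∘ₗ LinearMap.proj i))
      (z := -l) (v := Pi.single i v) (by rw [LinearMap.neg_apply, hE, neg_smul])
    simp only [LinearMap.comp_apply, LinearMap.coe_single, LinearMap.add_apply,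
      Module.End.mul_apply, LinearMap.smul_apply, LinearMap.sub_apply, h1, h2]
    rw [hs fun i => (M i).Y, hs fun i => (M i).X, hs fun i => (M i).X, hs fun i => (M i).Y,
      hv.eXY, ← Pi.single_add, sub_add_cancel, qpow_neg, ← sub_smul, smul_smul, ← Pi.single_smul]
  X_X := LinearMap.ext fun v => funext fun i => by
    simpa using LinearMap.congr_fun (M i).X_X (v i)
  Y_Y := LinearMap.ext fun v => funext fun i => by
    simpa using LinearMap.congr_fun (M i).Y_Y (v i)
  weight := by
    set S := ⨆ (l : ℂ) (n : ℤ),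
      Module.End.eigenspace (LinearMap.pi fun i => (M i).E ∘ₗ LinearMap.proj i) l ⊓
      Module.End.eigenspace (LinearMap.pi fun i => (M i).G ∘ₗ LinearMap.proj i) (n : ℂ)
    have : S.mkQ = 0 := LinearMap.pi_ext' fun i => ext_wt (M i) fun s l n v hv => by
      have hs : ∀ (F : ∀ i, Module.End ℂ (A i)) (c : ℂ), F i v = c • v →
          (LinearMap.pi fun i => F i ∘ₗ LinearMap.proj i) (Pi.single i v) =
            c • (Pi.single i v : ∀ i, A i) := fun F c hc => by
        ext j
        by_cases h : j = i
        · subst h; simp [hc]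
        · simp [h]
      rw [LinearMap.comp_apply, LinearMap.comp_apply, LinearMap.zero_apply, Submodule.mkQ_apply,
        Submodule.Quotient.mk_eq_zero]
      refine Submodule.mem_iSup_of_mem l (Submodule.mem_iSup_of_mem n ⟨?_, ?_⟩)
      · exact Module.End.mem_eigenspace_iff.mpr (hs (fun i => (M i).E) l hv.eE)
      · exact Module.End.mem_eigenspace_iff.mpr (hs (fun i => (M i).G) n hv.eG)
    rw [← S.ker_mkQ, this, LinearMap.ker_zero]

end pi

section functional_calculus

variable {V : Type*} [AddCommGroup V] [Module ℂ V] [Module.Finite ℂ V]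

/-- The operator which multiplies vectors of `E`-weight `l` by `F l`. -/
def funE (M : IntAction ħ V) (F : ℂ → ℂ) : Module.End ℂ V :=
  Polynomial.aeval M.E (Lagrange.interpolate (minpoly ℂ M.E).roots.toFinset id F)

lemma mem_roots_minpoly {T : Module.End ℂ V} {z : ℂ} {v : V} (h : T v = z • v) (hv : v ≠ 0) :
    z ∈ (minpoly ℂ T).roots.toFinset := by
  rw [Multiset.mem_toFinset,
    Polynomial.mem_roots (minpoly.ne_zero (Algebra.IsIntegral.isIntegral T))]
  exact Module.End.isRoot_of_hasEigenvalue (Module.End.hasEigenvalue_of_hasEigenvector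
    ⟨Module.End.mem_eigenspace_iff.mpr h, hv⟩)

lemma funE_apply (M : IntAction ħ V) (F : ℂ → ℂ) {l : ℂ} {v : V} (h : M.E v = l • v) :
    M.funE F v = F l • v := by
  by_cases hv : v = 0
  · simp [hv]
  rw [funE, Module.End.aeval_apply_of_hasEigenvector ⟨Module.End.mem_eigenspace_iff.mpr h, hv⟩]
  congr 1
  exact Lagrange.eval_interpolate_at_node (v := id) F (fun a _ b _ h => h) (mem_roots_minpoly h hv)

/-- X and Y preserve E-weights, so any function of E is a module endomorphism. Indicator functions
give the projections onto degrees. -/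
lemma funE_mem (M : IntAction ħ V) (F : ℂ → ℂ) : M.funE F ∈ homs M M :=
  mem_homs fun s l n v hv => by
    rw [M.funE_apply F hv.eE, M.funE_apply F hv.X.eE, M.funE_apply F hv.Y.eE, map_smul, map_smul]
    exact ⟨hv.smul _, rfl, rfl⟩

end functional_calculus

end IntAction
end IntWeight

/-! ### Direct sums, idempotents and the linear ribbon structure -/

namespace RelMod

universe v u

variable {C : Type u} [Category.{v} C] [Preadditive C]

/-- Orthogonality of the idempotents suffices: ι i ≫ s j is recovered from their product, as each s
i ≫ ι i splits through W i. -/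
lemma isDirectSum_of {n : ℕ} {V : C} {W : Fin n → C} (ι : ∀ i, W i ⟶ V) (s : ∀ i, V ⟶ W i)
    (h1 : 𝟙 V = ∑ i, s i ≫ ι i) (h2 : ∀ i, ι i ≫ s i = 𝟙 (W i))
    (h3 : ∀ i j, i ≠ j → (s i ≫ ι i) ≫ (s j ≫ ι j) = 0) : IsDirectSum V W := by
  refine ⟨ι, s, h1, h2, fun i j hij => ?_⟩
  have : ι i ≫ s j = ι i ≫ ((s i ≫ ι i) ≫ (s j ≫ ι j)) ≫ s j := by
    simp only [Category.assoc, h2, reassoc_of% h2 i, Category.comp_id]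
  rw [this, h3 i j hij]
  simp

/-- An object without non-trivial idempotents is indecomposable. -/
lemma isIndecomposable_of_idempotents {V : C} (h0 : 𝟙 V ≠ 0)
    (h : ∀ e : V ⟶ V, e ≫ e = e → e = 0 ∨ e = 𝟙 V) : IsIndecomposable V := by
  rintro n W ⟨ι, s, h1, h2, h3⟩
  have he : ∀ i, (s i ≫ ι i) ≫ (s i ≫ ι i) = s i ≫ ι i := fun i => by
    rw [Category.assoc, reassoc_of% h2 i]
  -- The idempotents of the summands add up to 𝟙 ≠ 0, so one of them is 𝟙. Its summand is all of V
  -- and orthogonality kills the others.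
  obtain ⟨i, hi⟩ : ∃ i, s i ≫ ι i = 𝟙 V := by
    by_contra! hcon
    apply h0
    rw [h1]
    exact Finset.sum_eq_zero fun i _ => (h _ (he i)).resolve_right (hcon i)
  let e : V ≅ W i := ⟨s i, ι i, hi, h2 i⟩
  have hz : ∀ j, j ≠ i → Limits.IsZero (W j) := fun j hj => by
    rw [Limits.IsZero.iff_id_eq_zero, ← h2 j, ← Category.comp_id (ι j), ← hi, ← Category.assoc,
      h3 j i hj]
    simp
  refine ⟨i, ⟨⟨e⟩, hz⟩, fun j hj => ?_⟩
  by_contra hne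
  have h4 := hj.2 i (Ne.symm hne)
  rw [Limits.IsZero.iff_id_eq_zero] at h4
  apply h0
  rw [← hi, ← Category.comp_id (s i), h4]
  simp

end RelMod

namespace IntWeightModule

open IntWeight IntAction RelMod

variable {ħ : ℂ} {V W U : IntWeightModule ħ}

lemma lin_sum {ι : Type*} (T : Finset ι) (f : ι → (V ⟶ W)) :
    lin (∑ i ∈ T, f i) = ∑ i ∈ T, lin (f i) := by
  classical
  induction T using Finset.induction_on with
  | empty => simp
  | insert a s ha ih => rw [Finset.sum_insert ha, Finset.sum_insert ha, lin_add, ih]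

lemma isIso_of_bijective (f : V ⟶ W) (h : Function.Bijective (lin f)) : IsIso f :=
  (isoOfLin (LinearEquiv.ofBijective (lin f) h) (lin_mem f)).isIso_hom

/-- A monomorphism is injective on weight vectors. -/
lemma eq_zero_of_mono (f : V ⟶ W) [Mono f] {s l : ℂ} {n : ℤ} {v : V.carrier}
    (hv : IsWt V.action s l n v) (h : lin f v = 0) : v = 0 := by
  obtain ⟨p, hp⟩ := exists_paritySign hv.sign
  have hv' : IsWt V.action (paritySign p) l n v := hv.cast hp.symm rfl rfl
  have e : indMap hv' ≫ f = 0 ≫ f := lin_injective (LinearMap.ext fun x => by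
    rw [Limits.zero_comp, lin_comp, LinearMap.comp_apply]
    refine (congrArg (lin f) (lin_indMap hv' x)).trans ?_
    simp [hom_X (lin_mem f), hom_Y (lin_mem f), h])
  have e' := (cancel_mono f).mp e
  have e2 : lin (indMap hv') (((1, 0), (0, 0)) : (ℂ × ℂ) × (ℂ × ℂ)) = 0 := by rw [e']; rfl
  rw [lin_indMap] at e2
  simpa using e2

/-- A nonzero weight vector of a subobject has nonzero image, hence is even of weight (0,0). So P, E
and G are scalars on the subobject and every vector in it is a weight vector; the monomorphism is
therefore injective, and a nonzero linear map to ℂ is onto. -/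
lemma simple_unit : Simple (𝟙_ (IntWeightModule ħ)) where
  mono_isIso_iff_nonzero {Y} f _ := by
    constructor
    · rintro h rfl
      have e : 𝟙 (𝟙_ (IntWeightModule ħ)) = 0 := by
        rw [← IsIso.inv_hom_id (0 : Y ⟶ 𝟙_ (IntWeightModule ħ)), Limits.comp_zero]
      exact one_ne_zero (α := ℂ) (LinearMap.congr_fun (congrArg lin e) (1 : ℂ))
    · intro hf
      have hw : ∀ s l n y, IsWt Y.action s l n y → IsWt Y.action 1 0 0 y := by
        intro s l n y hy
        by_cases h0 : lin f y = 0
        · rw [eq_zero_of_mono f hy h0]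
          exact ⟨Or.inl rfl, by simp, by simp, by simp⟩
        · obtain ⟨h1, h2, h3⟩ := (hy.map (lin_mem f)).unique (isWt_unit (show ℂ from lin f y)) h0
          exact hy.cast h1 h2 h3
      have hw' : ∀ y, IsWt Y.action 1 0 0 y := fun y =>
        ⟨Or.inl rfl,
          LinearMap.congr_fun (f := Y.action.P) (g := (1 : ℂ) • LinearMap.id)
            (ext_wt Y.action fun s l n y hy => (hw s l n y hy).eP) y,
          LinearMap.congr_fun (f := Y.action.E) (g := (0 : ℂ) • LinearMap.id)
            (ext_wt Y.action fun s l n y hy => (hw s l n y hy).eE) y,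
          LinearMap.congr_fun (f := Y.action.G) (g := ((0 : ℤ) : ℂ) • LinearMap.id)
            (ext_wt Y.action fun s l n y hy => (hw s l n y hy).eG) y⟩
      refine isIso_of_bijective f ⟨?_, ?_⟩
      · exact (injective_iff_map_eq_zero (lin f)).mpr fun y hy => eq_zero_of_mono f (hw' y) hy
      · have hf' : (lin f : Y.carrier →ₗ[ℂ] ℂ) ≠ 0 := fun h => hf (lin_injective h)
        exact LinearMap.surjective hf'

lemma isLinearRibbon [Admissible ħ] : IsLinearRibbon ℂ (IntWeightModule ħ) := by
  have h : MonoidalPreadditive (IntWeightModule ħ) :=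
    { whiskerLeft_zero := lin_injective (TensorProduct.map_zero_right _)
      zero_whiskerRight := lin_injective (TensorProduct.map_zero_left _)
      whiskerLeft_add := fun f g => lin_injective (TensorProduct.map_add_right _ _ _)
      add_whiskerRight := fun f g => lin_injective (TensorProduct.map_add_left _ _ _) }
  exact
    { monoidalPreadditive := h
      monoidalLinear :=
        { whiskerLeft_smul := fun X _ _ r f =>
            lin_injective (TensorProduct.map_smul_right r LinearMap.id (lin f))
          smul_whiskerRight := fun r _ _ f X =>
            lin_injective (TensorProduct.map_smul_left r (lin f) LinearMap.id) }
      simple_unit := simple_unit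
      scalars := by
        constructor
        · intro c c' e
          have := LinearMap.congr_fun (congrArg lin e) (1 : ℂ)
          simpa using (show c • (1 : ℂ) = c' • (1 : ℂ) from this)
        · intro f
          let F : ℂ →ₗ[ℂ] ℂ := lin f
          refine ⟨F 1, lin_injective ?_⟩
          change F 1 • (LinearMap.id : ℂ →ₗ[ℂ] ℂ) = F
          exact LinearMap.ext_ring (mul_one (F 1)) }

lemma rangeRestrict_apply_of_idempotent {A : Type*} [AddCommGroup A] [Module ℂ A]
    {e T : Module.End ℂ A} (he : e ∘ₗ e = e) (hT : e ∘ₗ T = T ∘ₗ e) (v : A) :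
    (e.rangeRestrict ∘ₗ T ∘ₗ (LinearMap.range e).subtype) (e.rangeRestrict v) =
      e.rangeRestrict (T v) :=
  Subtype.ext <| (LinearMap.congr_fun hT (e v)).trans <|
    (congrArg T (LinearMap.congr_fun he v)).trans (LinearMap.congr_fun hT v).symm

/-- The image of an idempotent. -/
def image (e : V ⟶ V) (he : e ≫ e = e) : IntWeightModule ħ where
  carrier := LinearMap.range (lin e)
  action :=
    have key := fun (T : Module.End ℂ V.carrier) (h : lin e ∘ₗ T = T ∘ₗ lin e) =>
      rangeRestrict_apply_of_idempotent (congrArg lin he) h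
    ofSurjective V.action (lin e).rangeRestrict (LinearMap.surjective_rangeRestrict _)
      _ _ _ _ _ (key _ (lin_mem e).1) (key _ (lin_mem e).2.1) (key _ (lin_mem e).2.2.1)
      (key _ (lin_mem e).2.2.2.1) (key _ (lin_mem e).2.2.2.2)

/-- The projection to the image of an idempotent. -/
def imageπ (e : V ⟶ V) (he : e ≫ e = e) : V ⟶ image e he :=
  ofLin (lin e).rangeRestrict
    (have key : ∀ T : Module.End ℂ V.carrier, lin e ∘ₗ T = T ∘ₗ lin e →
        (lin e).rangeRestrict ∘ₗ T = ((lin e).rangeRestrict ∘ₗ T ∘ₗ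
          (LinearMap.range (lin e)).subtype) ∘ₗ (lin e).rangeRestrict := fun T h =>
      LinearMap.ext fun v => (rangeRestrict_apply_of_idempotent (congrArg lin he) h v).symm
    ⟨key _ (lin_mem e).1, key _ (lin_mem e).2.1, key _ (lin_mem e).2.2.1,
      key _ (lin_mem e).2.2.2.1, key _ (lin_mem e).2.2.2.2⟩)

/-- The inclusion of the image of an idempotent. -/
def imageι (e : V ⟶ V) (he : e ≫ e = e) : image e he ⟶ V :=
  ofLin (LinearMap.range (lin e)).subtype (by
    have h : ∀ v : LinearMap.range (lin e), lin e v.1 = v.1 := by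
      rintro ⟨_, v, rfl⟩
      exact LinearMap.congr_fun (congrArg lin he) v
    have key : ∀ A : Module.End ℂ V.carrier, lin e ∘ₗ A = A ∘ₗ lin e →
        (LinearMap.range (lin e)).subtype ∘ₗ
          ((lin e).rangeRestrict ∘ₗ A ∘ₗ (LinearMap.range (lin e)).subtype) =
          A ∘ₗ (LinearMap.range (lin e)).subtype := fun A hA =>
      LinearMap.ext fun v => (LinearMap.congr_fun hA v.1).trans (congrArg A (h v))
    exact ⟨key _ (lin_mem e).1, key _ (lin_mem e).2.1, key _ (lin_mem e).2.2.1,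
      key _ (lin_mem e).2.2.2.1, key _ (lin_mem e).2.2.2.2⟩)

lemma imageπ_ι (e : V ⟶ V) (he : e ≫ e = e) : imageπ e he ≫ imageι e he = e :=
  lin_injective rfl

lemma imageι_π (e : V ⟶ V) (he : e ≫ e = e) : imageι e he ≫ imageπ e he = 𝟙 _ :=
  lin_injective <| LinearMap.ext <| by
    rintro ⟨_, v, rfl⟩
    exact Subtype.ext (LinearMap.congr_fun (congrArg lin he) v)

end IntWeightModule

/-! ### The grading by classes of E-weights -/

namespace IntWeightModule

open IntWeight IntAction RelMod

variable {ħ : ℂ} {V W U : IntWeightModule ħ} {Γ : AddSubgroup ℂ} {g h : ℂ ⧸ Γ}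

/-- It suffices to look at a spanning set of E-eigenvectors: eigenspaces are independent, so an
eigenvalue of another class would have an eigenspace disjoint from everything. -/
lemma eDegree_of_span (S : Set V.carrier) (hS : Submodule.span ℂ S = ⊤)
    (h : ∀ v ∈ S, ∃ l : ℂ, V.action.E v = l • v ∧ (v ≠ 0 → (l : ℂ ⧸ Γ) = g)) :
    eDegree ħ Γ g V := by
  intro l₀ hl₀
  by_contra hne
  apply hl₀
  rw [eq_bot_iff]
  have hd := V.action.E.eigenspaces_iSupIndep l₀
  have htop : (⨆ j, ⨆ (_ : j ≠ l₀), V.action.E.eigenspace j) = ⊤ := by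
    rw [eq_top_iff, ← hS, Submodule.span_le]
    intro v hv
    obtain ⟨l, h1, h2⟩ := h v hv
    by_cases h0 : v = 0
    · rw [h0]; exact zero_mem _
    · have : l ≠ l₀ := fun e => hne (e ▸ h2 h0)
      exact Submodule.mem_iSup_of_mem l (Submodule.mem_iSup_of_mem this
        (Module.End.mem_eigenspace_iff.mpr h1))
  rw [htop] at hd
  exact (disjoint_top.mp hd).le

lemma eDegree_wt (hV : eDegree ħ Γ g V) {s l : ℂ} {n : ℤ} {v : V.carrier}
    (hv : IsWt V.action s l n v) (h0 : v ≠ 0) : (l : ℂ ⧸ Γ) = g :=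
  hV l (Module.End.hasEigenvalue_of_hasEigenvector ⟨Module.End.mem_eigenspace_iff.mpr hv.eE, h0⟩)

lemma eDegree_of_wt (h : ∀ s l n v, IsWt V.action s l n v → v ≠ 0 → (l : ℂ ⧸ Γ) = g) :
    eDegree ħ Γ g V :=
  eDegree_of_span _ (span_wt V.action) (by
    rintro v ⟨s, l, n, hv⟩
    exact ⟨l, hv.eE, h s l n v hv⟩)

lemma eDegree_iso (e : V ≅ W) (hV : eDegree ħ Γ g V) : eDegree ħ Γ g W :=
  eDegree_of_wt fun s l n w hw h0 => eDegree_wt hV (hw.map (lin_mem e.inv)) fun h => h0 <| by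
    have := LinearMap.congr_fun (congrArg lin e.inv_hom_id) w
    rw [lin_comp, LinearMap.comp_apply, h, map_zero] at this
    exact this.symm

lemma eDegree_orthogonal (hgh : g ≠ h) (hV : eDegree ħ Γ g V) (hW : eDegree ħ Γ h W) (f : V ⟶ W) :
    f = 0 :=
  lin_injective <| ext_wt V.action fun s l n v hv => by
    rw [lin_zero, LinearMap.zero_apply]
    by_contra h0
    have h1 : v ≠ 0 := fun h => h0 (by rw [h, map_zero])
    exact hgh ((eDegree_wt hV hv h1).symm.trans (eDegree_wt hW (hv.map (lin_mem f)) h0))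

lemma eDegree_tensor (hV : eDegree ħ Γ g V) (hW : eDegree ħ Γ h W) :
    eDegree ħ Γ (g + h) (V ⊗ W) := by
  let S : Set (V.carrier ⊗[ℂ] W.carrier) := {x | ∃ s l n v t m n' w, IsWt V.action s l n v ∧
    IsWt W.action t m n' w ∧ x = v ⊗ₜ w}
  have hS : Submodule.span ℂ S = ⊤ := by
    rw [← Submodule.ker_mkQ (Submodule.span ℂ S), LinearMap.ker_eq_top]
    refine ext_wt₂ V.action W.action fun s l n v hv t m n' w hw => ?_
    rw [LinearMap.zero_apply, Submodule.mkQ_apply, Submodule.Quotient.mk_eq_zero]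
    exact Submodule.subset_span ⟨s, l, n, v, t, m, n', w, hv, hw, rfl⟩
  refine eDegree_of_span (V := V ⊗ W) S hS ?_
  rintro _ ⟨s, l, n, v, t, m, n', w, hv, hw, rfl⟩
  refine ⟨l + m, (hv.tmul hw).eE, fun h0 => ?_⟩
  have h1 : v ≠ 0 := fun h => h0 (by rw [h]; exact TensorProduct.zero_tmul _ _)
  have h2 : w ≠ 0 := fun h => h0 (by rw [h]; exact TensorProduct.tmul_zero _ _)
  rw [← eDegree_wt hV hv h1, ← eDegree_wt hW hw h2]
  rfl

lemma eDegree_dual (hV : eDegree ħ Γ g V) : eDegree ħ Γ (-g) (dualObj V) := by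
  refine eDegree_of_span (V := dualObj V) _ (span_cowt V.action) ?_
  rintro (φ : Module.Dual ℂ V.carrier) ⟨s, l, n, hφ⟩
  refine ⟨-l, LinearMap.ext fun v => ?_, fun h0 => ?_⟩
  · change -φ (V.action.E v) = -l * φ v
    rw [hφ.eE, neg_mul]
  · obtain ⟨t, m, n', v, hv, hne⟩ : ∃ t m n' v, IsWt V.action t m n' v ∧ φ v ≠ 0 := by
      by_contra! hcon
      exact h0 (ext_wt V.action hcon)
    obtain ⟨-, rfl, -⟩ := hφ.pair hv hne
    rw [← eDegree_wt hV hv fun h => hne (by rw [h, map_zero])]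
    rfl

/-- The direct sum of a finite family of modules. -/
def dsum {n : ℕ} (W : Fin n → IntWeightModule ħ) : IntWeightModule ħ where
  carrier := ∀ i, (W i).carrier
  action := IntAction.pi fun i => (W i).action

lemma isDirectSum_dsum {n : ℕ} (W : Fin n → IntWeightModule ħ) : IsDirectSum (dsum W) W := by
  let s : ∀ i, dsum W ⟶ W i := fun i => ofLin (V := dsum W) (LinearMap.proj i)
    ⟨rfl, rfl, rfl, rfl, rfl⟩
  have hs : ∀ (F : ∀ i, Module.End ℂ (W i).carrier) (i : Fin n),
      (LinearMap.single ℂ (fun i => (W i).carrier) i) ∘ₗ F i =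
      (LinearMap.pi fun i => F i ∘ₗ LinearMap.proj i) ∘ₗ LinearMap.single ℂ _ i := fun F i => by
    refine LinearMap.ext fun v => funext fun j => ?_
    by_cases h : j = i
    · subst h; simp
    · simp [h]
  let ι : ∀ i, W i ⟶ dsum W := fun i => ofLin (W := dsum W)
    (LinearMap.single ℂ (fun i => (W i).carrier) i)
    ⟨hs (fun i => (W i).action.P) i, hs (fun i => (W i).action.E) i,
      hs (fun i => (W i).action.G) i, hs (fun i => (W i).action.X) i,
      hs (fun i => (W i).action.Y) i⟩
  refine ⟨ι, s, lin_injective ?_, fun i => lin_injective ?_, fun i j hij => lin_injective ?_⟩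
  · rw [lin_sum]
    refine LinearMap.ext fun v => ?_
    have h := Finset.univ_sum_single (show ∀ i, (W i).carrier from v)
    rw [LinearMap.sum_apply]
    exact h.symm
  · exact LinearMap.proj_comp_single_same ℂ (fun i => (W i).carrier) i
  · exact LinearMap.proj_comp_single_ne ℂ (fun i => (W i).carrier) j i hij.symm

lemma imageι_comp (e : V ⟶ V) (he : e ≫ e = e) : imageι e he ≫ e = imageι e he :=
  lin_injective <| LinearMap.ext <| by
    rintro ⟨_, v, rfl⟩
    exact LinearMap.congr_fun (congrArg lin he) v

open Classical in
/-- The projection to the component of degree `g`. -/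
def degProj (V : IntWeightModule ħ) (g : ℂ ⧸ Γ) : V ⟶ V :=
  ofLin (V.action.funE fun l => if (l : ℂ ⧸ Γ) = g then 1 else 0) (funE_mem _ _)

open Classical in
lemma lin_degProj {s l : ℂ} {n : ℤ} {v : V.carrier} (hv : IsWt V.action s l n v) :
    lin (degProj V g) v = if (l : ℂ ⧸ Γ) = g then v else 0 := by
  refine (V.action.funE_apply _ hv.eE).trans ?_
  split_ifs <;> simp

lemma degProj_comp : degProj V g ≫ degProj V g = degProj V g :=
  lin_injective <| ext_wt V.action fun s l n v hv => by
    classical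
    rw [lin_comp, LinearMap.comp_apply, lin_degProj hv]
    split_ifs with h
    · rw [lin_degProj hv, if_pos h]
    · rw [map_zero]

lemma degProj_comp_of_ne (hgh : g ≠ h) : degProj V g ≫ degProj V h = 0 :=
  lin_injective <| ext_wt V.action fun s l n v hv => by
    classical
    rw [lin_comp, LinearMap.comp_apply, lin_degProj hv, lin_zero, LinearMap.zero_apply]
    split_ifs with h1
    · rw [lin_degProj hv, if_neg (h1 ▸ hgh)]
    · rw [map_zero]

lemma eDegree_image_degProj : eDegree ħ Γ g (image (degProj V g) degProj_comp) :=
  eDegree_of_wt fun s l n v hv h0 => by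
    classical
    have h1 := hv.map (lin_mem (imageι (degProj V g) degProj_comp))
    have h3 := LinearMap.congr_fun (congrArg lin (imageι_comp (degProj V g) degProj_comp)) v
    rw [lin_comp, LinearMap.comp_apply, lin_degProj h1] at h3
    by_contra hne
    rw [if_neg hne] at h3
    exact h0 (Subtype.ext h3.symm)

lemma exists_decomposition (V : IntWeightModule ħ) (Γ : AddSubgroup ℂ) :
    ∃ (n : ℕ) (g : Fin n → ℂ ⧸ Γ) (W : Fin n → IntWeightModule ħ), Function.Injective g ∧
      (∀ i, eDegree ħ Γ (g i) (W i)) ∧ IsDirectSum V W := by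
  classical
  -- The classes of the finitely many E-eigenvalues; the corresponding degree projections already
  -- add up to the identity.
  let T : Finset (ℂ ⧸ Γ) := (minpoly ℂ V.action.E).roots.toFinset.image QuotientAddGroup.mk
  let g : Fin T.card → ℂ ⧸ Γ := fun i => (T.equivFin.symm i).1
  have hg : Function.Injective g := Subtype.val_injective.comp T.equivFin.symm.injective
  refine ⟨T.card, g, fun i => image (degProj V (g i)) degProj_comp, hg,
    fun i => eDegree_image_degProj, isDirectSum_of (fun i => imageι _ _) (fun i => imageπ _ _) ?_
      (fun i => imageι_π _ _) fun i j hij => ?_⟩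
  · simp only [imageπ_ι]
    refine lin_injective (ext_wt V.action fun s l n v hv => ?_)
    rw [lin_sum, LinearMap.sum_apply]
    simp only [lin_degProj hv, lin_id, LinearMap.id_apply]
    by_cases h0 : v = 0
    · simp [h0]
    · have hl : (l : ℂ ⧸ Γ) ∈ T := Finset.mem_image_of_mem _ (mem_roots_minpoly hv.eE h0)
      have hgi : g (T.equivFin ⟨l, hl⟩) = l := by simp [g]
      rw [Finset.sum_eq_single (T.equivFin ⟨l, hl⟩), if_pos hgi.symm]
      · exact fun j _ hj => if_neg fun h => hj (hg (h.symm.trans hgi.symm))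
      · exact fun h => (h (Finset.mem_univ _)).elim
  · simp only [imageπ_ι]
    exact degProj_comp_of_ne (hg.ne hij)

theorem isGrading_eDegree [Admissible ħ] (Γ : AddSubgroup ℂ) : IsGrading (eDegree ħ Γ) where
  iso_closed g _ _ e hV := eDegree_iso e hV
  orthogonal hgh _ _ hV hW f := eDegree_orthogonal hgh hV hW f
  decompose V := exists_decomposition V Γ
  sum g W hg hW := ⟨dsum W, isDirectSum_dsum W⟩
  unit := eDegree_of_span (V := unitObj ħ) Set.univ Submodule.span_univ fun v _ =>
    ⟨0, (zero_smul ℂ v).symm, fun _ => rfl⟩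
  dual hV := eDegree_dual hV
  tensor hV hW := eDegree_tensor hV hW

end IntWeightModule

/-! ### The modules V(l,n)_p: maps, contraction, simplicity, modified dimension -/

namespace IntWeightModule

open IntWeight IntAction RelMod

variable {ħ : ℂ} {V W U : IntWeightModule ħ}

section linear

variable {A : Type*} [AddCommGroup A] [Module ℂ A] [Module.Finite ℂ A] {M : IntAction ħ A}
  {l : ℂ} {n : ℤ} {p : ZMod 2}

lemma kacAction_P (v : ℂ × ℂ) :
    (kacAction ħ l n p).P v = (paritySign p * v.1, -paritySign p * v.2) := rfl
lemma kacAction_E (v : ℂ × ℂ) : (kacAction ħ l n p).E v = l • v := rfl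
lemma kacAction_G (v : ℂ × ℂ) :
    (kacAction ħ l n p).G v = (n * v.1, (n - 1) * v.2) := rfl
lemma kacAction_X (v : ℂ × ℂ) : (kacAction ħ l n p).X v = (qnum ħ l * v.2, 0) := by
  change ((qpow ħ l - qpow ħ (-l)) / qdiff ħ * v.2, (0 : ℂ)) = _
  rw [qnum, qpow_neg, div_eq_inv_mul]
lemma kacAction_Y (v : ℂ × ℂ) : (kacAction ħ l n p).Y v = (0, v.1) := rfl

/-- The linear map from `V(l, n)_p` which maps the generator to `w`. -/
def kacLin (M : IntAction ħ A) (w : A) : ℂ × ℂ →ₗ[ℂ] A where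
  toFun v := v.1 • w + v.2 • M.Y w
  map_add' v v' := by simp; module
  map_smul' c v := by simp; module

lemma kacLin_mem {w : A} (hw : IsWt M (paritySign p) l n w) (hX : M.X w = 0) :
    kacLin M w ∈ homs (kacAction ħ l n p) M := by
  refine ⟨?_, ?_, ?_, ?_, ?_⟩ <;> refine LinearMap.ext fun v => ?_
  · simp [kacLin, kacAction_P, hw.eP, hw.Y.eP]; module
  · simp [kacLin, kacAction_E, hw.eE, hw.Y.eE]; module
  · simp [kacLin, kacAction_G, hw.eG, hw.Y.eG]; module
  · simp [kacLin, kacAction_X, hw.X_Y_apply, hX]; module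
  · simp [kacLin, kacAction_Y, Y_Y_apply]

lemma eq_kacLin {F : ℂ × ℂ →ₗ[ℂ] A} (hF : F ∈ homs (kacAction ħ l n p) M) :
    F = kacLin M (F (1, 0)) := by
  refine LinearMap.ext fun v => ?_
  have hv : v = v.1 • ((1, 0) : ℂ × ℂ) + v.2 • (kacAction ħ l n p).Y ((1, 0) : ℂ × ℂ) := by
    rw [kacAction_Y]; ext <;> simp
  conv_lhs => rw [hv, map_add, map_smul, map_smul, hom_Y hF]
  rfl

lemma eq_indLin {F : (ℂ × ℂ) × (ℂ × ℂ) →ₗ[ℂ] A} (hF : F ∈ homs (indAction ħ l n p) M) :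
    F = indLin M (F ((1, 0), (0, 0))) := by
  refine LinearMap.ext fun v => ?_
  set x : (ℂ × ℂ) × (ℂ × ℂ) := ((1, 0), (0, 0))
  have hv : v = v.1.1 • x + v.1.2 • (indAction ħ l n p).Y x + v.2.1 • (indAction ħ l n p).X x +
      v.2.2 • (indAction ħ l n p).Y ((indAction ħ l n p).X x) := by
    ext <;> simp [x, indAction]
  conv_lhs => rw [hv]
  simp only [map_add, map_smul, hom_Y hF, hom_X hF]
  rfl

/-- The linear map to `V(l, n)_p` given by a functional. -/
def cokacLin (M : IntAction ħ A) (φ : Module.Dual ℂ A) : A →ₗ[ℂ] ℂ × ℂ where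
  toFun x := (φ (M.X (M.Y x)), φ (M.X x))
  map_add' v v' := by simp
  map_smul' c v := by simp

/-- Up to sign this is `coindLin` followed by the quotient of the induced module by the submodule
spanned by Xp₀ and YXp₀. That quotient is V(l,n)_p, and it is read off from the first pair of
coordinates. -/
lemma cokacLin_mem {φ : Module.Dual ℂ A} (hφ : IsCoWt M (paritySign p) l n φ) :
    cokacLin M φ ∈ homs M (kacAction ħ l n p) := by
  obtain ⟨h1, h2, h3, h4, h5⟩ := coindLin_mem (p := p) hφ
  have k1 := fun x => congrArg (fun v : (ℂ × ℂ) × (ℂ × ℂ) => v.1) (LinearMap.congr_fun h1 x)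
  have k2 := fun x => congrArg (fun v : (ℂ × ℂ) × (ℂ × ℂ) => v.1) (LinearMap.congr_fun h2 x)
  have k3 := fun x => congrArg (fun v : (ℂ × ℂ) × (ℂ × ℂ) => v.1) (LinearMap.congr_fun h3 x)
  have k4 := fun x => congrArg (fun v : (ℂ × ℂ) × (ℂ × ℂ) => v.1) (LinearMap.congr_fun h4 x)
  simp [coindLin, indAction] at k1 k2 k3 k4
  refine ⟨?_, ?_, ?_, ?_, ?_⟩ <;> refine LinearMap.ext fun x => Prod.ext ?_ ?_
  · simp [cokacLin, kacAction_P, (k1 x).1]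
  · simp [cokacLin, kacAction_P, ← (k1 x).2]
  · simp [cokacLin, kacAction_E, (k2 x).1]
  · simp [cokacLin, kacAction_E, (k2 x).2]
  · simp [cokacLin, kacAction_G, (k3 x).1]
  · simp [cokacLin, kacAction_G, (k3 x).2]
  · simp [cokacLin, kacAction_X, k4 x]
  · simp [cokacLin, kacAction_X, X_X_apply]
  · simp [cokacLin, kacAction_Y, Y_Y_apply]
  · simp [cokacLin, kacAction_Y]

/-- The contraction of `V(l, n)_p`, for `q ^ l ≠ q ^ (-l)`. -/
def kacContraction (ħ l : ℂ) : Module.End ℂ (ℂ × ℂ) :=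
  LinearMap.prodMap 0 ((qnum ħ l)⁻¹ • LinearMap.id)

/-- On v only the term XhY contributes, on v' only YXh; each is [l]⁻¹[l] = 1. -/
lemma isContraction_kac (hl : qnum ħ l ≠ 0) (n : ℤ) (p : ZMod 2) :
    IsContraction (kacAction ħ l n p) (kacContraction ħ l) where
  mem := by
    refine ⟨?_, ?_, ?_⟩ <;> refine LinearMap.ext fun v => ?_ <;>
      simp [kacAction_P, kacAction_E, kacAction_G, kacContraction] <;> ring
  relTrace_eq := LinearMap.ext fun v => by
    rw [relTrace_apply]
    ext <;> simp [kacAction_X, kacAction_Y, kacContraction, hl]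

lemma isWt_kac (l : ℂ) (n : ℤ) (p : ZMod 2) :
    IsWt (kacAction ħ l n p) (paritySign p) l n ((1, 0) : ℂ × ℂ) where
  sign := paritySign_eq p
  eP := by simp [kacAction_P]
  eE := by simp [kacAction_E]
  eG := by simp [kacAction_G]

/-- Tensoring with `ε(m, k)_p`, for `q ^ m = 1`, only changes the weights and the parity. -/
lemma rid_eps_mem {m : ℂ} {k : ℤ} (hm : qpow ħ m = 1) (h : qpow ħ m = qpow ħ (-m))
    {M' : IntAction ħ A} (hP : ∀ v, M'.P v = paritySign p • M.P v)
    (hE : ∀ v, M'.E v = M.E v + m • v) (hG : ∀ v, M'.G v = M.G v + (k : ℂ) • v)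
    (hX : ∀ v, M'.X v = M.X v) (hY : ∀ v, M'.Y v = M.Y v) :
    (TensorProduct.rid ℂ A).toLinearMap ∈ homs (tensor M (epsAction ħ m k p h)) M' := by
  have hK : (epsAction ħ m k p h).Kinv 1 = 1 := by
    rw [Kinv, qpowEnd_apply ħ (z := -m) (by simp [epsAction]), qpow_neg, hm]; simp
  refine ⟨?_, ?_, ?_, ?_, ?_⟩ <;> refine TensorProduct.ext <| LinearMap.ext fun v =>
    LinearMap.ext_ring ?_
  · simp [tP, hP, epsAction]
  · simp [tE, hE, epsAction]
  · simp [tG, hG, epsAction]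
  · have hX0 : (epsAction ħ m k p h).X = 0 := rfl
    simp [tX, hX, hK, hX0]
  · simp [tY, hY, epsAction]

lemma qnum_add_of_qpow_eq_one {m : ℂ} (hm : qpow ħ m = 1) (l : ℂ) :
    qnum ħ (l + m) = qnum ħ l := by
  rw [qnum, qnum, qpow_add, hm, mul_one]

end linear

section objects

variable {l : ℂ} {n : ℤ} {p : ZMod 2}

/-- The morphism from `V(l, n)_p` given by a highest weight vector. -/
def kacMap {w : V.carrier} (hw : IsWt V.action (paritySign p) l n w) (hX : V.action.X w = 0) :
    kac ħ l n p ⟶ V :=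
  ofLin (V := kac ħ l n p) (kacLin V.action w) (kacLin_mem hw hX)

/-- The morphism to `V(l, n)_p` given by a functional. -/
def cokacMap {φ : Module.Dual ℂ V.carrier} (hφ : IsCoWt V.action (paritySign p) l n φ) :
    V ⟶ kac ħ l n p :=
  ofLin (W := kac ħ l n p) (cokacLin V.action φ) (cokacLin_mem hφ)

lemma lin_kacMap {w : V.carrier} (hw : IsWt V.action (paritySign p) l n w)
    (hX : V.action.X w = 0) (v : ℂ × ℂ) :
    lin (kacMap hw hX) v = v.1 • w + v.2 • V.action.Y w := rfl

lemma lin_cokacMap {φ : Module.Dual ℂ V.carrier}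
    (hφ : IsCoWt V.action (paritySign p) l n φ) (x : V.carrier) :
    lin (cokacMap hφ) x = ((φ (V.action.X (V.action.Y x)), φ (V.action.X x)) : ℂ × ℂ) := rfl

/-- A morphism from `V(l, n)_p` is determined by the image of the generator. -/
lemma kac_hom_ext {f g : kac ħ l n p ⟶ V}
    (h : lin f ((1, 0) : ℂ × ℂ) = lin g ((1, 0) : ℂ × ℂ)) : f = g := by
  have e1 := eq_kacLin (lin_mem f)
  have e2 := eq_kacLin (lin_mem g)
  exact lin_injective (e1.trans ((congrArg (kacLin V.action) h).trans e2.symm))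

/-- A morphism from the induced module is determined by the image of the generator. -/
lemma ind_hom_ext {f g : ind ħ l n p ⟶ V}
    (h : lin f (((1, 0), (0, 0)) : (ℂ × ℂ) × (ℂ × ℂ)) =
      lin g (((1, 0), (0, 0)) : (ℂ × ℂ) × (ℂ × ℂ))) : f = g := by
  have e1 := eq_indLin (lin_mem f)
  have e2 := eq_indLin (lin_mem g)
  exact lin_injective (e1.trans ((congrArg (indLin V.action) h).trans e2.symm))

lemma kac_one_ne_zero : 𝟙 (kac ħ l n p) ≠ 0 := fun h => by
  have := LinearMap.congr_fun (congrArg lin h) ((1, 0) : ℂ × ℂ)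
  exact one_ne_zero (congrArg Prod.fst (show ((1, 0) : ℂ × ℂ) = 0 from this))

lemma ind_one_ne_zero : 𝟙 (ind ħ l n p) ≠ 0 := fun h => by
  have := LinearMap.congr_fun (congrArg lin h) (((1, 0), (0, 0)) : (ℂ × ℂ) × (ℂ × ℂ))
  exact one_ne_zero (congrArg (fun v => v.1.1)
    (show (((1, 0), (0, 0)) : (ℂ × ℂ) × (ℂ × ℂ)) = 0 from this))

/-- X kills the generator, hence its image, and for [l'] ≠ 0 the kernel of X is the line of the
highest weight vector. This is the source of Schur's lemma for these modules. -/
lemma kac_hom_apply {l' : ℂ} {n' : ℤ} {p' : ZMod 2} (hl : qnum ħ l' ≠ 0)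
    (f : kac ħ l n p ⟶ kac ħ l' n' p') :
    ∃ a : ℂ, lin f ((1, 0) : ℂ × ℂ) = ((a, 0) : ℂ × ℂ) := by
  have h1 := hom_X (lin_mem f) ((1, 0) : ℂ × ℂ)
  have h2 : (kac ħ l n p).action.X ((1, 0) : ℂ × ℂ) = 0 := by
    refine (kacAction_X _).trans ?_
    simp
    rfl
  rw [h2, map_zero] at h1
  let y : ℂ × ℂ := lin f ((1, 0) : ℂ × ℂ)
  have h3 : (qnum ħ l' * y.2, (0 : ℂ)) = (0 : ℂ × ℂ) := (kacAction_X y).symm.trans h1.symm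
  have h4 : y.2 = 0 := by simpa [hl] using h3
  exact ⟨y.1, Prod.ext rfl h4⟩

lemma kac_end_eq_smul (hl : qnum ħ l ≠ 0) (f : kac ħ l n p ⟶ kac ħ l n p) :
    ∃ a : ℂ, f = a • 𝟙 _ := by
  obtain ⟨a, ha⟩ := kac_hom_apply hl f
  refine ⟨a, kac_hom_ext (ha.trans ?_)⟩
  change _ = a • ((1, 0) : ℂ × ℂ)
  simp

lemma kac_hom_eq_zero {l' : ℂ} {n' : ℤ} {p' : ZMod 2} (hl : qnum ħ l' ≠ 0)
    (hne : ¬(l = l' ∧ n = n' ∧ p = p')) (f : kac ħ l n p ⟶ kac ħ l' n' p') : f = 0 := by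
  obtain ⟨a, ha⟩ := kac_hom_apply hl f
  refine kac_hom_ext (ha.trans ?_)
  by_cases h0 : a = 0
  · rw [h0]; rfl
  · exfalso
    have h1 : IsWt (kacAction ħ l' n' p') (paritySign p) l n ((a, 0) : ℂ × ℂ) :=
      ha ▸ (isWt_kac l n p).map (lin_mem f)
    have h2 : IsWt (kacAction ħ l' n' p') (paritySign p') l' n' ((a, 0) : ℂ × ℂ) := by
      have := (isWt_kac (ħ := ħ) l' n' p').smul a
      simpa using this
    obtain ⟨e1, e2, e3⟩ := h1.unique h2 (by simpa using h0)
    exact hne ⟨e2, e3, paritySign_injective e1⟩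

lemma isProjective_kac [Admissible ħ] (hl : qnum ħ l ≠ 0) :
    IsProjective (IntWeightModule ħ) (kac ħ l n p) :=
  isProjective_of_isContraction (isContraction_kac hl n p)

lemma isProjective_ind [Admissible ħ] : IsProjective (IntWeightModule ħ) (ind ħ l n p) :=
  isProjective_of_isContraction (isContraction_ind l n p)

/-- Only v' contributes to the trace: P acts on it by −(−1)^p and the contraction by [l]⁻¹. The
scalar −(q − q⁻¹)⁻¹ turns this into (−1)^p (q^l − q^{−l})⁻¹. -/
lemma mTrace_dim_kac [Admissible ħ] (hl : qnum ħ l ≠ 0)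
    (h : IsProjective (IntWeightModule ħ) (kac ħ l n p)) :
    (mTrace ħ).dim (kac ħ l n p) h = paritySign p * (qpow ħ l - (qpow ħ l)⁻¹)⁻¹ := by
  rw [MTrace.dim, mTrace_trace (isContraction_kac hl n p)]
  have e : (kacAction ħ l n p).P * LinearMap.id * kacContraction ħ l =
      LinearMap.prodMap 0 ((-paritySign p * (qnum ħ l)⁻¹) • LinearMap.id) :=
    LinearMap.ext fun v => by
      simp [kacAction_P, kacContraction, mul_assoc]
  have e2 : LinearMap.trace ℂ (ℂ × ℂ) ((kacAction ħ l n p).P * LinearMap.id * kacContraction ħ l) =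
      -paritySign p * (qnum ħ l)⁻¹ := by
    rw [e, LinearMap.trace_prodMap']
    simp
  refine (congrArg (-(qdiff ħ)⁻¹ * ·) e2).trans ?_
  have hq := qdiff_ne_zero ħ
  have h2 : qpow ħ l - (qpow ħ l)⁻¹ ≠ 0 := right_ne_zero_of_mul hl
  change -(qdiff ħ)⁻¹ * (-paritySign p * (qnum ħ l)⁻¹) = _
  rw [qnum, mul_inv]
  field_simp

/-- A nonzero subspace stable under X and Y contains the highest weight vector, possibly after
applying X, and then everything. So a nonzero monomorphism is onto; it splits by projectivity of the
target, and a split epimorphism that is mono is invertible. -/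
lemma simple_kac [Admissible ħ] (hl : qnum ħ l ≠ 0) : Simple (kac ħ l n p) where
  mono_isIso_iff_nonzero {Y} f _ := by
    constructor
    · rintro h rfl
      apply kac_one_ne_zero (ħ := ħ) (l := l) (n := n) (p := p)
      rw [← IsIso.inv_hom_id (0 : Y ⟶ kac ħ l n p), Limits.comp_zero]
    · intro hf
      obtain ⟨y, hy⟩ : ∃ y, lin f y ≠ 0 := by
        by_contra! hcon
        exact hf (lin_injective (LinearMap.ext hcon))
      let R : Submodule ℂ (ℂ × ℂ) := LinearMap.range (lin f)
      have hRX : ∀ v ∈ R, (kacAction ħ l n p).X v ∈ R := by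
        rintro _ ⟨x, rfl⟩; exact ⟨_, hom_X (lin_mem f) x⟩
      have hRY : ∀ v ∈ R, (kacAction ħ l n p).Y v ∈ R := by
        rintro _ ⟨x, rfl⟩; exact ⟨_, hom_Y (lin_mem f) x⟩
      have h1 : ((1, 0) : ℂ × ℂ) ∈ R := by
        let v : ℂ × ℂ := lin f y
        have hv : v ∈ R := ⟨y, rfl⟩
        by_cases hb : v.2 = 0
        · have ha : v.1 ≠ 0 := fun ha => hy (Prod.ext ha hb)
          have := R.smul_mem v.1⁻¹ hv
          rwa [show v.1⁻¹ • v = (1, 0) by ext <;> simp [ha, hb]] at this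
        · have := R.smul_mem (qnum ħ l * v.2)⁻¹ (hRX v hv)
          rw [kacAction_X] at this
          have hne : qnum ħ l * v.2 ≠ 0 := mul_ne_zero hl hb
          rwa [show (qnum ħ l * v.2)⁻¹ • ((qnum ħ l * v.2, 0) : ℂ × ℂ) = (1, 0) by
            rw [Prod.smul_mk, smul_zero, smul_eq_mul, inv_mul_cancel₀ hne]] at this
      have h2 : ((0, 1) : ℂ × ℂ) ∈ R := hRY _ h1
      have hs : Function.Surjective (lin f) := by
        intro (v : ℂ × ℂ)
        have : v ∈ R := by
          rw [show v = v.1 • ((1, 0) : ℂ × ℂ) + v.2 • ((0, 1) : ℂ × ℂ) by ext <;> simp]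
          exact R.add_mem (R.smul_mem _ h1) (R.smul_mem _ h2)
        exact this
      obtain ⟨s, hs⟩ := isProjective_kac (n := n) (p := p) hl f (epi_of_surjective f hs)
      have : f ≫ s = 𝟙 Y := by
        rw [← cancel_mono f, Category.assoc, hs, Category.comp_id, Category.id_comp]
      exact ⟨s, this, hs⟩

lemma isRegular_of_ne_zero [Admissible ħ] {v : V.carrier} (hv : v ≠ 0) : IsRegular V := by
  refine epi_of_surjective (ε_ V Vᘁ) fun (c : ℂ) => ?_
  obtain ⟨φ, hφ⟩ : ∃ φ : Module.Dual ℂ V.carrier, φ v ≠ 0 := by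
    by_contra! hcon
    exact hv ((Module.forall_dual_apply_eq_zero_iff ℂ v).mp hcon)
  refine ⟨((c * (φ v)⁻¹) • φ) ⊗ₜ[ℂ] v, ?_⟩
  refine (contractLeft_apply ((c * (φ v)⁻¹) • φ) v).trans ?_
  simp [hφ]

/-- Tensoring `V(l, n)_p` with an invertible object. -/
def kacTensorEps {m : ℂ} {k : ℤ} {p' : ZMod 2} (hm : qpow ħ m = 1) (h : qpow ħ m = qpow ħ (-m)) :
    kac ħ l n p ⊗ eps ħ m k p' h ≅ kac ħ (l + m) (n + k) (p + p') :=
  isoOfLin (V := tensorObj (kac ħ l n p) (eps ħ m k p' h)) (W := kac ħ (l + m) (n + k) (p + p'))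
    (TensorProduct.rid ℂ (ℂ × ℂ))
    (rid_eps_mem (M := kacAction ħ l n p) (M' := kacAction ħ (l + m) (n + k) (p + p')) hm h
      (fun v => by simp [kacAction_P, paritySign_add]; ring_nf; simp)
      (fun v => by simp [kacAction_E, add_smul])
      (fun v => by ext <;> simp [kacAction_G] <;> ring)
      (fun v => by simp [kacAction_X, qnum_add_of_qpow_eq_one hm])
      (fun v => by simp [kacAction_Y]))

/-- Tensoring an induced module with an invertible object. -/
def indTensorEps {m : ℂ} {k : ℤ} {p' : ZMod 2} (hm : qpow ħ m = 1) (h : qpow ħ m = qpow ħ (-m)) :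
    ind ħ l n p ⊗ eps ħ m k p' h ≅ ind ħ (l + m) (n + k) (p + p') :=
  isoOfLin (V := tensorObj (ind ħ l n p) (eps ħ m k p' h)) (W := ind ħ (l + m) (n + k) (p + p'))
    (TensorProduct.rid ℂ ((ℂ × ℂ) × (ℂ × ℂ)))
    (rid_eps_mem (M := indAction ħ l n p) (M' := indAction ħ (l + m) (n + k) (p + p')) hm h
      (fun v => by ext <;> simp [indAction, paritySign_add] <;> ring)
      (fun v => by simp [indAction, add_smul])
      (fun v => by ext <;> simp [indAction] <;> ring)
      (fun v => by simp [indAction, qnum_add_of_qpow_eq_one hm])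
      (fun v => by simp [indAction]))

end objects

end IntWeightModule

/-! ### Domination by families, and summands of indecomposable objects -/

namespace RelMod

universe v u

variable {C : Type u} [Category.{v} C] [Preadditive C]

/-- The sums of endomorphisms which factor through members of a family. -/
def factorSums {J : Type*} (W : J → C) (V : C) : AddSubmonoid (V ⟶ V) :=
  AddSubmonoid.closure {f | ∃ (j : J) (s : V ⟶ W j) (ι : W j ⟶ V), f = s ≫ ι}

lemma comp_mem_factorSums {J : Type*} {W : J → C} {V V' : C} {f : V' ⟶ V'}
    (hf : f ∈ factorSums W V') (a : V ⟶ V') (b : V' ⟶ V) : a ≫ f ≫ b ∈ factorSums W V := by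
  induction hf using AddSubmonoid.closure_induction with
  | mem x hx =>
    obtain ⟨j, s, ι, rfl⟩ := hx
    exact AddSubmonoid.subset_closure ⟨j, a ≫ s, ι ≫ b, by simp⟩
  | zero => simp
  | add x y _ _ hx hy =>
    rw [Preadditive.add_comp, Preadditive.comp_add]
    exact add_mem hx hy

lemma isDominating_of_mem {J : Type*} {W : J → C} {D : ObjectProperty C}
    (h : ∀ V, D V → 𝟙 V ∈ factorSums W V) : IsDominating W D := by
  intro V hV
  obtain ⟨L, hL, hs⟩ := AddSubmonoid.exists_list_of_mem_closure (h V hV)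
  choose j s ι e using fun i : Fin L.length => hL (L.get i) (L.get_mem i)
  refine ⟨L.length, j, ι, s, ?_⟩
  have h1 : L.sum = ∑ i, L.get i := by rw [← List.sum_ofFn, List.ofFn_get]
  rw [← hs, h1]
  exact Finset.sum_congr rfl fun i _ => e i

/-- A summand of an indecomposable object is the whole object. -/
lemma IsIndecomposable.nonempty_iso {Q A B : C} (hQ : IsIndecomposable Q) (hA : 𝟙 A ≠ 0)
    {i : A ⟶ Q} {s : Q ⟶ A} {i' : B ⟶ Q} {s' : Q ⟶ B} (h1 : i ≫ s = 𝟙 A) (h2 : i' ≫ s' = 𝟙 B)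
    (h3 : 𝟙 Q = s ≫ i + s' ≫ i') : Nonempty (Q ≅ A) := by
  -- Orthogonality is not assumed. Composing the decomposition of 𝟙 with i gives i ≫ s' ≫ i' = 0,
  -- and i' is a split monomorphism.
  have h4 : i ≫ s' = 0 := by
    have h5 : i ≫ (s ≫ i + s' ≫ i') = i := by rw [← h3, Category.comp_id]
    rw [Preadditive.comp_add, reassoc_of% h1, add_eq_left] at h5
    have := congrArg (· ≫ s') h5
    simpa [h2] using this
  have h4' : i' ≫ s = 0 := by
    have h5 : i' ≫ (s ≫ i + s' ≫ i') = i' := by rw [← h3, Category.comp_id]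
    rw [Preadditive.comp_add, reassoc_of% h2, add_eq_right] at h5
    have := congrArg (· ≫ s) h5
    simpa [h1] using this
  have hd : IsDirectSum Q ![A, B] := by
    refine ⟨fun | 0 => i | 1 => i', fun | 0 => s | 1 => s', ?_, ?_, ?_⟩
    · rw [Fin.sum_univ_two]; exact h3
    · intro k
      fin_cases k
      · exact h1
      · exact h2
    · intro k m hkm
      fin_cases k <;> fin_cases m
      · exact (hkm rfl).elim
      · exact h4
      · exact h4'
      · exact (hkm rfl).elim
  obtain ⟨k, ⟨hk, hz⟩, -⟩ := hQ 2 _ hd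
  fin_cases k
  · exact hk
  · exact (hA ((Limits.IsZero.iff_id_eq_zero A).mp (hz 0 (by decide)))).elim

end RelMod

/-! ### Decompositions into typical and induced modules; the indecomposable projectives -/

namespace IntWeightModule

open IntWeight IntAction RelMod

variable {ħ : ℂ} {V W U : IntWeightModule ħ} {l : ℂ} {n : ℤ} {p : ZMod 2}

lemma kac_idempotent (hl : qnum ħ l ≠ 0) (e : kac ħ l n p ⟶ kac ħ l n p) (he : e ≫ e = e) :
    e = 0 ∨ e = 𝟙 _ := by
  obtain ⟨a, rfl⟩ := kac_end_eq_smul hl e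
  have h : a * a = a := by
    have := LinearMap.congr_fun (congrArg lin he) ((1, 0) : ℂ × ℂ)
    have h2 : a • a • ((1, 0) : ℂ × ℂ) = a • ((1, 0) : ℂ × ℂ) := this
    simpa using congrArg Prod.fst h2
  rcases mul_right_eq_self₀.mp h with h | h
  · right; rw [h, one_smul]
  · left; rw [h, zero_smul]

/-- An endomorphism is given by a vector of the weight of p₀, that is, by a combination of p₀ and
YXp₀. For [l] = 0 the operator YX squares to zero, so the endomorphism ring is ℂ[x]/x², which is
local. -/
lemma ind_idempotent (hl : qnum ħ l = 0) (e : ind ħ l n p ⟶ ind ħ l n p) (he : e ≫ e = e) :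
    e = 0 ∨ e = 𝟙 _ := by
  let F : (ℂ × ℂ) × (ℂ × ℂ) →ₗ[ℂ] (ℂ × ℂ) × (ℂ × ℂ) := lin e
  have hF : F ∈ homs (indAction ħ l n p) (indAction ħ l n p) := lin_mem e
  have hw : IsWt (indAction ħ l n p) (paritySign p) l n (F ((1, 0), (0, 0))) :=
    (isWt_ind l n p).map hF
  have hFF : F (F ((1, 0), (0, 0))) = F ((1, 0), (0, 0)) :=
    LinearMap.congr_fun (congrArg lin he) (((1, 0), (0, 0)) : (ℂ × ℂ) × (ℂ × ℂ))
  rw [eq_indLin hF] at hFF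
  have hG := hw.eG
  obtain ⟨⟨⟨a, b⟩, ⟨c, d⟩⟩, hy⟩ : ∃ y, F ((1, 0), (0, 0)) = y := ⟨_, rfl⟩
  rw [hy] at hFF hG
  simp only [indAction, LinearMap.coe_mk, AddHom.coe_mk, Prod.smul_mk, smul_eq_mul,
    Prod.mk.injEq] at hG
  -- Yp₀ and Xp₀ have G-weights n − 1 and n + 1, so they cannot occur in a vector of weight n.
  have hb : b = 0 := by linear_combination -hG.1.2
  have hc : c = 0 := by linear_combination hG.2.1
  subst hb hc
  simp [indLin, indAction, hl] at hFF
  obtain ⟨h1, h2⟩ := hFF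
  rcases mul_right_eq_self₀.mp h1 with h | h
  · subst h
    right
    have hd : d = 0 := by simpa using h2
    subst hd
    exact ind_hom_ext hy
  · subst h
    left
    have hd : d = 0 := by simpa using h2.symm
    subst hd
    exact ind_hom_ext hy

/-- The module whose weights are such that `X Y + Y X` is invertible is a sum of modules
`V(l, n)_p`. -/
theorem exists_kac_sum (hV : ∀ s l n v, IsWt V.action s l n v → v ≠ 0 → qnum ħ l ≠ 0) :
    ∃ (d : ℕ) (l : Fin d → ℂ) (n : Fin d → ℤ) (p : Fin d → ZMod 2)
      (s : ∀ i, V ⟶ kac ħ (l i) (n i) (p i)) (ι : ∀ i, kac ħ (l i) (n i) (p i) ⟶ V),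
      𝟙 V = ∑ i, s i ≫ ι i ∧ ∀ i, V.action.E.HasEigenvalue (l i) := by
  obtain ⟨d, b, σ, l, n, -, hb, hφ⟩ := exists_wt_basis V.action _ (span_wt V.action)
    (fun v hv => hv)
  choose p hp using fun i => exists_paritySign (hb i).sign
  have hu : ∀ i, IsWt V.action (paritySign (p i)) (l i) (n i) (V.action.X (V.action.Y (b i))) :=
    fun i => (hb i).Y.X.cast (by rw [neg_neg, hp]) rfl (by ring)
  -- Without the scalars, the composites add up to XYXY + YXYX, which is [l]² because X² = Y² = 0
  -- and XY + YX = [l].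
  refine ⟨d, l, n, p,
    fun i => ((qnum ħ (l i))⁻¹ * (qnum ħ (l i))⁻¹) •
      cokacMap ((hp i).symm ▸ hφ i : IsCoWt V.action (paritySign (p i)) (l i) (n i) (b.coord i)),
    fun i => kacMap (hu i) (X_X_apply _), lin_injective (ext_wt V.action fun s m k x hx => ?_),
    fun i => Module.End.hasEigenvalue_of_hasEigenvector
      ⟨Module.End.mem_eigenspace_iff.mpr (hb i).eE, b.ne_zero i⟩⟩
  by_cases h0 : x = 0
  · rw [h0, map_zero, map_zero]
  have hz := hV _ _ _ _ hx h0
  rw [lin_sum, LinearMap.sum_apply]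
  -- The scalar attached to b i may be replaced by that of the vector: a coordinate of a vector of
  -- E-weight m vanishes unless l i = m.
  have hi : ∀ i y, V.action.E y = m • y → ((qnum ħ (l i))⁻¹ * (qnum ħ (l i))⁻¹) * b.coord i y =
      ((qnum ħ m)⁻¹ * (qnum ħ m)⁻¹) * b.coord i y := fun i y hy => by
    by_cases h : b.coord i y = 0
    · rw [h, mul_zero, mul_zero]
    · have := (hφ i).eE y
      rw [hy, map_smul, smul_eq_mul] at this
      rw [mul_right_cancel₀ h this]
  have hs : ∀ (F : V.carrier →ₗ[ℂ] V.carrier) y, F y = ∑ i, b.coord i y • F (b i) :=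
    fun F y => by
      conv_lhs => rw [← b.sum_repr y, map_sum]
      simp
  have key : ∀ i, lin ((((qnum ħ (l i))⁻¹ * (qnum ħ (l i))⁻¹) • cokacMap ((hp i).symm ▸ hφ i :
      IsCoWt V.action (paritySign (p i)) (l i) (n i) (b.coord i))) ≫
      kacMap (hu i) (X_X_apply _)) x =
      ((qnum ħ m)⁻¹ * (qnum ħ m)⁻¹) • (b.coord i (V.action.X (V.action.Y x)) •
        (V.action.X * V.action.Y) (b i) + b.coord i (V.action.X x) •
        (V.action.Y * V.action.X * V.action.Y) (b i)) := fun i => by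
    rw [Linear.smul_comp, lin_smul, lin_comp, LinearMap.smul_apply, LinearMap.comp_apply]
    refine (congrArg _ (lin_kacMap (hu i) (X_X_apply _) (lin (cokacMap _) x))).trans ?_
    simp only [lin_cokacMap, smul_add, smul_smul, hi i _ hx.Y.X.eE, hi i _ hx.X.eE]
    rfl
  rw [Finset.sum_congr rfl fun i _ => key i, ← Finset.smul_sum, Finset.sum_add_distrib, ← hs, ← hs]
  simp only [Module.End.mul_apply, hx.X_Y_apply, map_sub, map_smul, hx.X.X_Y_apply, X_X_apply,
    Y_Y_apply, map_zero, lin_id, LinearMap.id_apply]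
  match_scalars
  field_simp
  ring

/-- Projective modules are sums of retracts of induced modules. -/
theorem exists_ind_sum {h : Module.End ℂ V.carrier} (hh : IsContraction V.action h) :
    ∃ (d : ℕ) (l : Fin d → ℂ) (n : Fin d → ℤ) (p : Fin d → ZMod 2)
      (s : ∀ i, V ⟶ ind ħ (l i) (n i) (p i)) (ι : ∀ i, ind ħ (l i) (n i) (p i) ⟶ V),
      𝟙 V = ∑ i, s i ≫ ι i := by
  obtain ⟨d, b, σ, l, n, -, hb, hφ⟩ := exists_wt_basis V.action _ (span_wt V.action)
    (fun v hv => hv)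
  choose p hp using fun i => exists_paritySign (hb i).sign
  have hu : ∀ i, IsWt V.action (paritySign (p i)) (l i) (n i) (h (b i)) :=
    fun i => ((hb i).map_wt hh.mem).cast (hp i).symm rfl rfl
  -- Coinduce along the coordinate functional of b i and map the generator to h (b i). The four
  -- coefficients sum to the four terms of `relTrace` h, which is the identity.
  refine ⟨d, l, n, p, fun i => coindMap
      ((hp i).symm ▸ hφ i : IsCoWt V.action (paritySign (p i)) (l i) (n i) (b.coord i)),
    fun i => indMap (hu i), lin_injective (LinearMap.ext fun x => ?_)⟩
  have hs : ∀ (F : V.carrier →ₗ[ℂ] V.carrier) y, F y = ∑ i, b.coord i y • F (b i) :=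
    fun F y => by
      conv_lhs => rw [← b.sum_repr y, map_sum]
      simp
  rw [lin_sum, LinearMap.sum_apply]
  have key : ∀ i, lin (coindMap
      ((hp i).symm ▸ hφ i : IsCoWt V.action (paritySign (p i)) (l i) (n i) (b.coord i)) ≫
      indMap (hu i)) x = -(b.coord i (V.action.X (V.action.Y x)) • h (b i)) -
        b.coord i (V.action.X x) • (V.action.Y * h) (b i) +
        b.coord i (V.action.Y x) • (V.action.X * h) (b i) +
        b.coord i x • (V.action.Y * V.action.X * h) (b i) := fun i => by
    rw [lin_comp, LinearMap.comp_apply]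
    refine (lin_indMap (hu i) (lin (coindMap _) x)).trans ?_
    simp only [lin_coindMap, neg_smul, ← sub_eq_add_neg]
    rfl
  rw [Finset.sum_congr rfl fun i _ => key i]
  simp only [Finset.sum_add_distrib, Finset.sum_sub_distrib, Finset.sum_neg_distrib, ← hs]
  have := LinearMap.congr_fun hh.relTrace_eq x
  rw [relTrace_apply] at this
  simp only [Module.End.mul_apply]
  rw [lin_id, ← this]
  abel

open Classical in
/-- The indecomposable projective module with generator of weight `(l, n)` and parity `p`. -/
def indec (ħ l : ℂ) (n : ℤ) (p : ZMod 2) : IntWeightModule ħ :=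
  if qnum ħ l = 0 then ind ħ l n p else kac ħ l n p

lemma indec_of_eq (hl : qnum ħ l = 0) : indec ħ l n p = ind ħ l n p := if_pos hl
lemma indec_of_ne (hl : qnum ħ l ≠ 0) : indec ħ l n p = kac ħ l n p := if_neg hl

lemma isProjective_indec [Admissible ħ] : IsProjective (IntWeightModule ħ) (indec ħ l n p) := by
  by_cases hl : qnum ħ l = 0
  · rw [indec_of_eq hl]; exact isProjective_ind
  · rw [indec_of_ne hl]; exact isProjective_kac hl

lemma indec_one_ne_zero : 𝟙 (indec ħ l n p) ≠ 0 := by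
  by_cases hl : qnum ħ l = 0
  · rw [indec_of_eq hl]; exact ind_one_ne_zero
  · rw [indec_of_ne hl]; exact kac_one_ne_zero

lemma isIndecomposable_indec : IsIndecomposable (indec ħ l n p) := by
  by_cases hl : qnum ħ l = 0
  · rw [indec_of_eq hl]
    exact isIndecomposable_of_idempotents ind_one_ne_zero (ind_idempotent hl)
  · rw [indec_of_ne hl]
    exact isIndecomposable_of_idempotents kac_one_ne_zero (kac_idempotent hl)

lemma eDegree_ind {Γ : AddSubgroup ℂ} : eDegree ħ Γ (l : ℂ ⧸ Γ) (ind ħ l n p) :=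
  eDegree_of_span (V := ind ħ l n p) Set.univ Submodule.span_univ fun v _ => ⟨l, rfl, fun _ => rfl⟩

lemma eDegree_kac {Γ : AddSubgroup ℂ} : eDegree ħ Γ (l : ℂ ⧸ Γ) (kac ħ l n p) :=
  eDegree_of_span (V := kac ħ l n p) Set.univ Submodule.span_univ fun v _ => ⟨l, rfl, fun _ => rfl⟩

lemma eDegree_indec {Γ : AddSubgroup ℂ} : eDegree ħ Γ (l : ℂ ⧸ Γ) (indec ħ l n p) := by
  by_cases hl : qnum ħ l = 0
  · rw [indec_of_eq hl]; exact eDegree_ind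
  · rw [indec_of_ne hl]; exact eDegree_kac

lemma nonempty_indecTensorEps {m : ℂ} {k : ℤ} {p' : ZMod 2} (hm : qpow ħ m = 1)
    (h : qpow ħ m = qpow ħ (-m)) :
    Nonempty (indec ħ l n p ⊗ eps ħ m k p' h ≅ indec ħ (l + m) (n + k) (p + p')) := by
  by_cases hl : qnum ħ l = 0
  · rw [indec_of_eq hl, indec_of_eq ((qnum_add_of_qpow_eq_one hm l).trans hl)]
    exact ⟨indTensorEps hm h⟩
  · rw [indec_of_ne hl, indec_of_ne ((qnum_add_of_qpow_eq_one hm l).trans_ne hl)]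
    exact ⟨kacTensorEps hm h⟩

/-- A projective module factors through a sum of induced modules. Each of these is either
indecomposable or, when [l] ≠ 0, again a sum of modules V(l,n)_p. -/
theorem projective_dominated [Admissible ħ] :
    IsDominating (fun P : {P : IntWeightModule ħ // IsProjective _ P ∧ IsIndecomposable P} => P.1)
      (IsProjective (IntWeightModule ħ)) := by
  refine isDominating_of_mem fun V hV => ?_
  obtain ⟨h, hh⟩ := isProjective_iff.mp hV
  obtain ⟨d, l, n, p, s, ι, e⟩ := exists_ind_sum hh
  rw [e]
  refine sum_mem fun i _ => ?_
  by_cases hl : qnum ħ (l i) = 0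
  · refine AddSubmonoid.subset_closure ⟨⟨ind ħ (l i) (n i) (p i), isProjective_ind, ?_⟩, s i, ι i,
      rfl⟩
    exact isIndecomposable_of_idempotents ind_one_ne_zero (ind_idempotent hl)
  -- E acts on this induced module by the single scalar l i, so only typical summands can occur.
  · have key : 𝟙 (ind ħ (l i) (n i) (p i)) ∈ factorSums (fun P : {P : IntWeightModule ħ //
        IsProjective _ P ∧ IsIndecomposable P} => P.1) (ind ħ (l i) (n i) (p i)) := by
      have hE : ∀ x : (ind ħ (l i) (n i) (p i)).carrier,
        (ind ħ (l i) (n i) (p i)).action.E x = l i • x := fun x => rfl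
      have hw : ∀ m, (∃ x : (ind ħ (l i) (n i) (p i)).carrier, x ≠ 0 ∧
          (ind ħ (l i) (n i) (p i)).action.E x = m • x) → qnum ħ m ≠ 0 := by
        rintro m ⟨x, h0, hx⟩
        rw [hE] at hx
        rwa [← smul_left_injective ℂ h0 hx]
      obtain ⟨d', l', n', p', s', ι', e', hl'⟩ := exists_kac_sum
        (V := ind ħ (l i) (n i) (p i)) fun s m k x hx h0 => hw m ⟨x, h0, hx.eE⟩
      rw [e']
      refine sum_mem fun j _ => ?_
      obtain ⟨x, hx⟩ := (hl' j).exists_hasEigenvector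
      have hj := hw (l' j) ⟨x, hx.2, hx.apply_eq_smul⟩
      exact AddSubmonoid.subset_closure ⟨⟨kac ħ (l' j) (n' j) (p' j), isProjective_kac hj,
        isIndecomposable_of_idempotents kac_one_ne_zero (kac_idempotent hj)⟩, s' j, ι' j, rfl⟩
    have := comp_mem_factorSums key (s i) (ι i)
    rwa [Category.id_comp] at this

lemma exists_wt_ne_zero (h : 𝟙 V ≠ 0) : ∃ s l n v, IsWt V.action s l n v ∧ v ≠ 0 := by
  by_contra! hcon
  exact h (lin_injective (ext_wt V.action fun s l n v hv => by rw [hcon s l n v hv]; simp))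

/-- The vector, or its image under X, is a nonzero highest weight vector u. A functional dual to u
gives a map back to V(l,n)_p, and the round trip is multiplication by [l]. -/
lemma exists_kac_summand {s : ℂ} {v : V.carrier} (hl : qnum ħ l ≠ 0) (hv : IsWt V.action s l n v)
    (h0 : v ≠ 0) : ∃ n p, ∃ (i : kac ħ l n p ⟶ V) (s : V ⟶ kac ħ l n p), i ≫ s = 𝟙 _ := by
  obtain ⟨t, k, u, hu, hX, hu0⟩ : ∃ t k u, IsWt V.action t l k u ∧ V.action.X u = 0 ∧ u ≠ 0 := by
    by_cases hX : V.action.X v = 0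
    · exact ⟨_, _, v, hv, hX, h0⟩
    · exact ⟨_, _, _, hv.X, X_X_apply v, hX⟩
  obtain ⟨p, rfl⟩ := exists_paritySign hu.sign
  obtain ⟨φ, hφ, h1⟩ := hu.exists_cowt hu0
  refine ⟨k, p, kacMap hu hX, (qnum ħ l)⁻¹ • cokacMap hφ, kac_hom_ext ?_⟩
  have e : lin (kacMap hu hX) ((1, 0) : ℂ × ℂ) = u := by
    rw [lin_kacMap]; simp
  refine (congrArg (fun y => (qnum ħ l)⁻¹ • lin (cokacMap hφ) y) e).trans ?_
  simp only [lin_cokacMap, hu.X_Y_apply, hX, map_zero, sub_zero, map_smul, h1]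
  rw [smul_eq_mul, mul_one]
  change ((qnum ħ l)⁻¹ * qnum ħ l, (qnum ħ l)⁻¹ * 0) = ((1, 0) : ℂ × ℂ)
  rw [inv_mul_cancel₀ hl, mul_zero]

/-- A vector w with YXw ≠ 0 generates a copy of the induced module, and a functional detecting YXw
splits it off. The contraction guarantees that such a w exists. -/
lemma exists_ind_summand {s : ℂ} {v : V.carrier} (hl : qnum ħ l = 0) (hv : IsWt V.action s l n v)
    (h0 : v ≠ 0) {h : Module.End ℂ V.carrier} (hh : IsContraction V.action h) :
    ∃ n p, ∃ (i : ind ħ l n p ⟶ V) (s : V ⟶ ind ħ l n p), i ≫ s = 𝟙 _ := by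
  -- If YX vanished at E-weight l, so would XY = −YX, and `relTrace` h = 1 would read w = XhYw −
  -- YhXw. Applied to Xw and Yw this gives Xw = Yw = 0, and then w = 0.
  obtain ⟨t, k, w, hw, hne⟩ : ∃ t k w, IsWt V.action t l k w ∧ V.action.Y (V.action.X w) ≠ 0 := by
    by_contra! hcon
    have hXY : ∀ t k w, IsWt V.action t l k w → V.action.X (V.action.Y w) = 0 :=
      fun t k w hw => by rw [hw.X_Y_apply, hl, hcon t k w hw]; simp
    have key : ∀ t k w, IsWt V.action t l k w →
        w = V.action.X (h (V.action.Y w)) - V.action.Y (h (V.action.X w)) := fun t k w hw => by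
      have := LinearMap.congr_fun hh.relTrace_eq w
      rw [relTrace_apply, hcon _ _ _ (hw.map_wt hh.mem), hXY _ _ _ hw, map_zero, zero_sub,
        sub_zero, LinearMap.id_apply] at this
      rw [sub_eq_neg_add, this]
    have hY : ∀ t k w, IsWt V.action t l k w → V.action.Y w = 0 := fun t k w hw => by
      rw [key _ _ _ hw.Y, Y_Y_apply, hXY _ _ _ hw]; simp
    have hX : ∀ t k w, IsWt V.action t l k w → V.action.X w = 0 := fun t k w hw => by
      rw [key _ _ _ hw.X, X_X_apply, hcon _ _ _ hw]; simp
    apply h0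
    rw [key _ _ _ hv, hX _ _ _ hv, hY _ _ _ hv]
    simp
  obtain ⟨p, rfl⟩ := exists_paritySign hw.sign
  obtain ⟨φ, hφ, h1⟩ := hw.YX.exists_cowt hne
  set y := V.action.Y (V.action.X w) with hy
  have hYXy : V.action.Y (V.action.X y) = 0 := by
    rw [hy, hw.X.X_Y_apply, hl, X_X_apply]; simp
  -- As YXy = 0, subtracting φ(w) y from w leaves YXw = y unchanged and achieves φ = 0 on the new
  -- vector; the round trip then fixes p₀ exactly.
  have hw' : IsWt V.action (paritySign p) l k (w + (-φ w) • y) := hw.add (hw.YX.smul _)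
  have e1 : V.action.Y (V.action.X (w + (-φ w) • y)) = y := by
    rw [map_add, map_add, map_smul, map_smul, hYXy, smul_zero, add_zero]
  have e2 : φ (w + (-φ w) • y) = 0 := by simp [h1]
  refine ⟨k, p, indMap hw', coindMap hφ, ind_hom_ext ?_⟩
  have e : lin (indMap hw') (((1, 0), (0, 0)) : (ℂ × ℂ) × (ℂ × ℂ)) = w + (-φ w) • y := by
    rw [lin_indMap]; simp
  refine (congrArg (lin (coindMap hφ)) e).trans ?_
  have e3 : φ (V.action.X (w + (-φ w) • y)) = 0 := by
    by_contra h
    have := (hφ.pair hw'.X h).2.2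
    omega
  have e4 : φ (V.action.Y (w + (-φ w) • y)) = 0 := by
    by_contra h
    have := (hφ.pair hw'.Y h).2.2
    omega
  rw [lin_coindMap, hw'.X_Y_apply, hl, e1, e2, e3, e4]
  simp only [zero_smul, zero_sub, map_neg, h1, neg_neg, neg_zero]
  rfl

/-- The classification of the indecomposable projective modules. -/
theorem exists_iso_indec [Admissible ħ] (hV : IsProjective (IntWeightModule ħ) V)
    (hV' : IsIndecomposable V) :
    ∃ l n p, V.action.E.HasEigenvalue l ∧ Nonempty (V ≅ indec ħ l n p) := by
  obtain ⟨h, hh⟩ := isProjective_iff.mp hV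
  -- A zero object is the empty direct sum, which has no index to single out, so it is not
  -- indecomposable.
  have hne : 𝟙 V ≠ 0 := fun h0 => by
    obtain ⟨i, -⟩ := hV' 0 Fin.elim0 ⟨fun i => i.elim0, fun i => i.elim0, by simp [h0],
      fun i => i.elim0, fun i => i.elim0⟩
    exact i.elim0
  obtain ⟨s, l, n, v, hv, h0⟩ := exists_wt_ne_zero hne
  have hE : V.action.E.HasEigenvalue l := Module.End.hasEigenvalue_of_hasEigenvector
    ⟨Module.End.mem_eigenspace_iff.mpr hv.eE, h0⟩
  obtain ⟨n, p, i, s, his⟩ : ∃ n p, ∃ (i : indec ħ l n p ⟶ V) (s : V ⟶ indec ħ l n p),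
      i ≫ s = 𝟙 _ := by
    by_cases hl : qnum ħ l = 0
    · obtain ⟨n, p, i, s, h⟩ := exists_ind_summand hl hv h0 hh
      exact ⟨n, p, by rw [indec_of_eq hl]; exact ⟨i, s, h⟩⟩
    · obtain ⟨n, p, i, s, h⟩ := exists_kac_summand hl hv h0
      exact ⟨n, p, by rw [indec_of_ne hl]; exact ⟨i, s, h⟩⟩
  -- The complementary summand is the image of this idempotent, so V, being indecomposable, is
  -- isomorphic to the summand found.
  have he : (𝟙 V - s ≫ i) ≫ (𝟙 V - s ≫ i) = 𝟙 V - s ≫ i := by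
    simp [reassoc_of% his]
  exact ⟨l, n, p, hE, hV'.nonempty_iso indec_one_ne_zero his (imageι_π _ he)
    (by rw [imageπ_ι]; abel)⟩

end IntWeightModule

/-! ### The period of q^z, and generic degrees -/

namespace IntWeight

/-- `R γ` is the period of `z ↦ q ^ z`, where `R` is odd. -/
structure IsPeriod (ħ γ : ℂ) (R : ℕ) : Prop where
  odd : Odd R
  eq : ħ * (R * γ) = 2 * Real.pi * Complex.I

namespace IsPeriod

variable {ħ γ : ℂ} {R : ℕ}

lemma mul_ne_zero (H : IsPeriod ħ γ R) : (R : ℂ) * γ ≠ 0 := fun h => by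
  have := H.eq
  rw [h, mul_zero] at this
  exact Complex.two_pi_I_ne_zero this.symm

lemma ne_zero (H : IsPeriod ħ γ R) : γ ≠ 0 := right_ne_zero_of_mul H.mul_ne_zero

lemma cast_ne_zero (H : IsPeriod ħ γ R) : (R : ℂ) ≠ 0 := left_ne_zero_of_mul H.mul_ne_zero

lemma pos (H : IsPeriod ħ γ R) : 0 < R := H.odd.pos

lemma qpow_eq_one_iff (H : IsPeriod ħ γ R) {l : ℂ} :
    qpow ħ l = 1 ↔ ∃ n : ℤ, l = n * (R * γ) := by
  have hħ : ħ ≠ 0 := fun h => by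
    have := H.eq
    rw [h, zero_mul] at this
    exact Complex.two_pi_I_ne_zero this.symm
  rw [qpow, Complex.exp_eq_one_iff]
  refine exists_congr fun n => ?_
  rw [← H.eq]
  constructor
  · intro h
    exact mul_left_cancel₀ hħ (by linear_combination h)
  · rintro rfl
    ring

lemma qpow_int_mul (H : IsPeriod ħ γ R) (n : ℤ) : qpow ħ (n * (R * γ)) = 1 :=
  H.qpow_eq_one_iff.mpr ⟨n, rfl⟩

lemma qpow_eq_neg (H : IsPeriod ħ γ R) (n : ℤ) :
    qpow ħ (n * (R * γ)) = qpow ħ (-(n * (R * γ))) := by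
  rw [qpow_neg, H.qpow_int_mul, inv_one]

/-- The weights whose class does not lie in `X` are typical. -/
lemma qnum_ne_zero (H : IsPeriod ħ γ R) [Admissible ħ] {l : ℂ}
    (hl : ¬∃ m : ℤ, (l : ℂ ⧸ AddSubgroup.zmultiples γ) = ((m * (γ / 2) : ℂ) : ℂ ⧸ AddSubgroup.zmultiples γ)) :
    IntAction.qnum ħ l ≠ 0 := fun h => by
  have h1 : qpow ħ l = (qpow ħ l)⁻¹ := by
    rcases mul_eq_zero.mp h with h | h
    · exact absurd h (inv_ne_zero (qdiff_ne_zero ħ))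
    · exact sub_eq_zero.mp h
  have h2 : qpow ħ (l + l) = 1 := by
    rw [qpow_add]
    nth_rewrite 1 [h1]
    exact inv_mul_cancel₀ (qpow_ne_zero ħ l)
  obtain ⟨n, hn⟩ := H.qpow_eq_one_iff.mp h2
  -- From 2l = nRγ one gets l = (nR)(γ/2).
  refine hl ⟨n * R, ?_⟩
  congr 1
  push_cast
  linear_combination hn / 2

lemma isSymmetric (γ : ℂ) : RelMod.IsSymmetric {g : ℂ ⧸ AddSubgroup.zmultiples γ |
    ∃ m : ℤ, g = ((m * (γ / 2) : ℂ) : ℂ ⧸ AddSubgroup.zmultiples γ)} := by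
  have key : ∀ g : ℂ ⧸ AddSubgroup.zmultiples γ,
      (∃ m : ℤ, g = ((m * (γ / 2) : ℂ) : ℂ ⧸ AddSubgroup.zmultiples γ)) →
      ∃ m : ℤ, -g = ((m * (γ / 2) : ℂ) : ℂ ⧸ AddSubgroup.zmultiples γ) := by
    rintro _ ⟨m, rfl⟩
    refine ⟨-m, ?_⟩
    rw [← QuotientAddGroup.mk_neg]
    congr 1
    push_cast
    ring
  refine Set.ext fun g => ⟨fun hg => key g hg, fun hg => ?_⟩
  have := key _ hg
  rwa [neg_neg] at this

/-- The preimage in ℂ of the set is the countable group (γ/2)ℤ; finitely many translates of it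
cannot cover ℂ, which is uncountable. -/
lemma isSmall (γ : ℂ) : RelMod.IsSmall {g : ℂ ⧸ AddSubgroup.zmultiples γ |
    ∃ m : ℤ, g = ((m * (γ / 2) : ℂ) : ℂ ⧸ AddSubgroup.zmultiples γ)} := by
  intro s hs
  let f : s × ℤ × ℤ → ℂ := fun x => Quotient.out x.1.1 + x.2.1 * (γ / 2) + x.2.2 * γ
  have hf : Function.Surjective f := fun z => by
    have hz : (z : ℂ ⧸ AddSubgroup.zmultiples γ) ∈ (Set.univ : Set _) := trivial
    rw [← hs] at hz
    simp only [Set.mem_iUnion] at hz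
    obtain ⟨g, hg, -, ⟨m, rfl⟩, hz⟩ := hz
    have e : ((g.out + m * (γ / 2) : ℂ) : ℂ ⧸ AddSubgroup.zmultiples γ) = z := by
      rw [QuotientAddGroup.mk_add, QuotientAddGroup.out_eq', ← hz]
    obtain ⟨k, hk⟩ := AddSubgroup.mem_zmultiples_iff.mp (QuotientAddGroup.eq.mp e)
    refine ⟨⟨⟨g, hg⟩, m, k⟩, ?_⟩
    change g.out + m * (γ / 2) + k * γ = z
    rw [zsmul_eq_mul] at hk
    rw [hk]
    ring
  have : Countable ℂ := hf.countable
  exact not_countable_complex (Set.to_countable _)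

end IsPeriod

end IntWeight

/-! ### The free realisation σ -/

namespace IntWeightModule

open IntWeight IntAction RelMod

variable {ħ γ : ℂ} {R : ℕ} {V W : IntWeightModule ħ}

lemma isWt_eps {l : ℂ} {n : ℤ} {p : ZMod 2} (h : qpow ħ l = qpow ħ (-l)) (c : ℂ) :
    IsWt (epsAction ħ l n p h) (paritySign p) l n c where
  sign := paritySign_eq p
  eP := by simp [epsAction]
  eE := by simp [epsAction]
  eG := by simp [epsAction]

/-- The invertible object of index `k`. -/
def sigmaObj (H : IsPeriod ħ γ R) (k : ℤ × ℤ × ZMod 2) : IntWeightModule ħ :=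
  eps ħ (k.1 * (R * γ)) (k.2.1 * R) k.2.2 (H.qpow_eq_neg k.1)

lemma sigmaObj_zero [Admissible ħ] (H : IsPeriod ħ γ R) :
    sigmaObj H 0 = 𝟙_ (IntWeightModule ħ) := by
  have key : ∀ (l : ℂ) (n : ℤ) (h : qpow ħ l = qpow ħ (-l)), l = 0 → n = 0 →
      eps ħ l n 0 h = 𝟙_ (IntWeightModule ħ) := by
    rintro _ _ h rfl rfl
    exact eps_zero h
  exact key _ _ _ (by simp) (by simp)

/-- The functor underlying the free realisation. -/
def sigmaFunctor (H : IsPeriod ħ γ R) : Discrete (ℤ × ℤ × ZMod 2) ⥤ IntWeightModule ħ :=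
  Discrete.functor (sigmaObj H)

lemma lin_sigmaFunctor_map (H : IsPeriod ħ γ R) {X Y : Discrete (ℤ × ℤ × ZMod 2)} (f : X ⟶ Y)
    (c : ℂ) : lin ((sigmaFunctor H).map f) c = c := by
  obtain ⟨x⟩ := X
  obtain ⟨y⟩ := Y
  obtain ⟨⟨h⟩⟩ := f
  obtain rfl : x = y := h
  rfl

/-- The unit constraint of the free realisation. -/
def sigmaUnit (H : IsPeriod ħ γ R) :
    𝟙_ (IntWeightModule ħ) ≅ (sigmaFunctor H).obj (𝟙_ (Discrete (ℤ × ℤ × ZMod 2))) :=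
  isoOfLin (V := unitObj ħ) (W := sigmaObj H 0) (LinearEquiv.refl ℂ ℂ) (by
    refine ⟨?_, ?_, ?_, ?_, ?_⟩ <;> refine LinearMap.ext fun c => ?_ <;>
      simp [sigmaObj, eps, epsAction, paritySign] <;> rfl)

/-- The tensor constraint of the free realisation. -/
def sigmaTensor (H : IsPeriod ħ γ R) (k k' : ℤ × ℤ × ZMod 2) :
    sigmaObj H k ⊗ sigmaObj H k' ≅ sigmaObj H (k + k') :=
  isoOfLin (V := tensorObj (sigmaObj H k) (sigmaObj H k')) (W := sigmaObj H (k + k'))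
    (TensorProduct.rid ℂ ℂ)
    (rid_eps_mem (M := epsAction ħ _ _ _ (H.qpow_eq_neg k.1))
      (M' := epsAction ħ _ _ _ (H.qpow_eq_neg (k + k').1)) (H.qpow_int_mul k'.1)
      (H.qpow_eq_neg k'.1)
      (fun c => by simp [epsAction, paritySign_add]; ring)
      (fun c => by simp [epsAction]; ring)
      (fun c => by simp [epsAction]; ring)
      (fun c => by simp [epsAction])
      (fun c => by simp [epsAction]))

/-- The monoidal structure of the free realisation. -/
def sigmaCoreMonoidal (H : IsPeriod ħ γ R) : (sigmaFunctor H).CoreMonoidal where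
  εIso := sigmaUnit H
  μIso := fun X Y => sigmaTensor H X.as Y.as
  μIso_hom_natural_left := fun f Z => lin_injective (TensorProduct.ext' fun (a : ℂ) (b : ℂ) => by
    refine Eq.trans ?_ (lin_sigmaFunctor_map H (f ▷ Z) (b • a)).symm
    exact congrArg (fun x : ℂ => b • x) (lin_sigmaFunctor_map H f a))
  μIso_hom_natural_right := fun Z f => lin_injective (TensorProduct.ext' fun (a : ℂ) (b : ℂ) => by
    refine Eq.trans ?_ (lin_sigmaFunctor_map H (Z ◁ f) (b • a)).symm
    exact congrArg (fun x : ℂ => x • a) (lin_sigmaFunctor_map H f b))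
  associativity := fun X Y Z => lin_injective (TensorProduct.ext_threefold
    fun (a : ℂ) (b : ℂ) (c : ℂ) => by
      refine (lin_sigmaFunctor_map H (α_ X Y Z).hom (c • b • a)).trans ?_
      exact smul_smul c b a)
  left_unitality := fun X => lin_injective (TensorProduct.ext' fun (a : ℂ) (b : ℂ) => by
    refine Eq.trans ?_ (lin_sigmaFunctor_map H (λ_ X).hom (b • a)).symm
    exact mul_comm a b)
  right_unitality := fun X => lin_injective (TensorProduct.ext' fun (a : ℂ) (b : ℂ) =>
    (lin_sigmaFunctor_map H (ρ_ X).hom (b • a)).symm)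

/-- K acts by q^l = 1, so the pivotal operator PK is the sign (−1)^p. -/
lemma lin_qdim_eps [Admissible ħ] {l : ℂ} {n : ℤ} {p : ZMod 2} (hl : qpow ħ l = 1)
    (h : qpow ħ l = qpow ħ (-l)) : qdim (eps ħ l n p h) = paritySign p • 𝟙 _ := by
  have hev : ∀ (c : ℂ) (φ : Module.Dual ℂ ℂ), lin (evR (eps ħ l n p h)) (c ⊗ₜ[ℂ] φ) =
      paritySign p • φ c := fun c φ => by
    refine (lin_evR (eps ħ l n p h) c φ).trans ?_
    have := (isWt_eps (n := n) (p := p) h c).eK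
    change φ ((epsAction ħ l n p h).P ((epsAction ħ l n p h).K c)) = _
    rw [this, hl, one_smul, (isWt_eps h c).eP, map_smul]
  refine lin_injective (LinearMap.ext_ring ?_)
  change lin (evR (eps ħ l n p h)) (coevaluation ℂ ℂ 1) = paritySign p • (1 : ℂ)
  rw [coevaluation_apply_one]
  refine (map_sum (lin (evR (eps ħ l n p h))) _ _).trans ?_
  refine (Finset.sum_congr rfl fun i _ => hev _ _).trans ?_
  have := Module.finrank_eq_card_basis (Module.Basis.ofVectorSpace ℂ ℂ)
  rw [Module.finrank_self] at this
  simp only [Module.Basis.coord_apply, Module.Basis.repr_self, Finsupp.single_eq_same, smul_eq_mul,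
    mul_one]
  refine (Finset.sum_const (paritySign p)).trans ?_
  refine (congrArg (· • paritySign p) this.symm).trans (one_smul _ _)

lemma theta_eps [Admissible ħ] {l : ℂ} {n : ℤ} {p : ZMod 2} (hl : qpow ħ l = 1)
    (hn : qpow ħ (-2 * (l * n)) = 1) (h : qpow ħ l = qpow ħ (-l)) : θ (eps ħ l n p h) = 𝟙 _ := by
  refine lin_injective (LinearMap.ext fun (c : ℂ) => ?_)
  have := (isWt_eps (n := n) (p := p) h c).twist
  refine this.trans ?_
  rw [hl, hn]
  change (1 : ℂ) • ((1 : ℂ) • c - qdiff ħ • (0 : ℂ)) = c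
  simp

/-- Idempotent endomorphisms of simple objects are trivial. -/
lemma idempotent_of_simple [Simple V] (e : V ⟶ V) (he : e ≫ e = e) : e = 0 ∨ e = 𝟙 V := by
  by_cases h0 : e = 0
  · exact Or.inl h0
  right
  have hne : imageι e he ≠ 0 := fun h => h0 (by rw [← imageπ_ι e he, h, Limits.comp_zero])
  have : Mono (imageι e he) := mono_of_mono_fac (imageι_π e he)
  have : IsIso (imageι e he) := isIso_of_mono_of_nonzero hne
  rw [← cancel_epi (imageι e he), imageι_comp, Category.comp_id]

/-- The operator `v ↦ (-1) ^ (|v| + n) v` for `v` of weight `(l, n)`. -/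
def parityG (V : IntWeightModule ħ) : Module.End ℂ V.carrier :=
  -- Interpolation of z ↦ e^{πiz} gives (−1)^n on integral weights. X and Y change both the parity
  -- and the parity of n, so the product is a module map.
  V.action.P * qpowEnd (Real.pi * Complex.I) V.action.G

lemma qpow_pi_add_one (n : ℤ) : qpow (Real.pi * Complex.I) ((n + 1 : ℤ) : ℂ) =
    -qpow (Real.pi * Complex.I) (n : ℂ) := by
  push_cast
  rw [qpow_add, show qpow (Real.pi * Complex.I) 1 = -1 by rw [qpow, mul_one, Complex.exp_pi_mul_I],
    mul_neg_one]

lemma qpow_pi_mul_self (n : ℤ) : qpow (Real.pi * Complex.I) (n : ℂ) *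
    qpow (Real.pi * Complex.I) (n : ℂ) = 1 := by
  rw [← qpow_add, qpow, Complex.exp_eq_one_iff]
  exact ⟨n, by ring⟩

lemma parityG_apply {s l : ℂ} {n : ℤ} {v : V.carrier} (hv : IsWt V.action s l n v) :
    parityG V v = (s * qpow (Real.pi * Complex.I) (n : ℂ)) • v := by
  rw [parityG, Module.End.mul_apply, qpowEnd_apply _ hv.eG, map_smul, hv.eP, smul_smul, mul_comm]

lemma parityG_mem : parityG V ∈ homs V.action V.action := by
  refine mem_homs fun s l n v hv => ⟨?_, ?_, ?_⟩
  · rw [parityG_apply hv]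
    exact hv.smul _
  · rw [parityG_apply hv, parityG_apply hv.X, qpow_pi_add_one, map_smul]
    simp
  · rw [parityG_apply hv, parityG_apply hv.Y, map_smul]
    have := qpow_pi_add_one (n - 1)
    rw [sub_add_cancel] at this
    rw [this]
    simp

/-- The sign `(-1) ^ (|v| + n)` is constant on a simple module. -/
lemma parityG_of_simple [Simple V] :
    (∀ v, parityG V v = v) ∨ ∀ v, parityG V v = -v := by
  have hsq : ∀ v, parityG V (parityG V v) = v := fun v => by
    have : parityG V ∘ₗ parityG V = LinearMap.id := ext_wt V.action fun s l n v hv => by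
      rw [LinearMap.comp_apply, parityG_apply hv, map_smul, parityG_apply hv, smul_smul,
        mul_mul_mul_comm, hv.sq, qpow_pi_mul_self, mul_one, one_smul, LinearMap.id_apply]
    exact LinearMap.congr_fun this v
  let Q : V ⟶ V := ofLin (parityG V) parityG_mem
  -- Q squares to the identity, so (1 + Q)/2 is an idempotent, hence 0 or 1 on a simple module.
  have he : ((1 / 2 : ℂ) • (𝟙 V + Q)) ≫ ((1 / 2 : ℂ) • (𝟙 V + Q)) = (1 / 2 : ℂ) • (𝟙 V + Q) :=
    lin_injective (LinearMap.ext fun v => by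
      simp only [lin_comp, lin_smul, lin_add, lin_id, LinearMap.comp_apply, LinearMap.smul_apply,
        LinearMap.add_apply, LinearMap.id_apply, Q, lin_ofLin, map_smul, map_add, hsq]
      module)
  rcases idempotent_of_simple _ he with h | h
  · right
    intro v
    have := LinearMap.congr_fun (congrArg lin h) v
    simp only [lin_smul, lin_add, lin_id, LinearMap.smul_apply, LinearMap.add_apply,
      LinearMap.id_apply, Q, lin_ofLin, lin_zero, LinearMap.zero_apply, smul_eq_zero] at this
    rcases this with h | h
    · norm_num at h
    · exact eq_neg_of_add_eq_zero_right h
  · left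
    intro v
    have := LinearMap.congr_fun (congrArg lin h) v
    simp only [lin_smul, lin_add, lin_id, LinearMap.smul_apply, LinearMap.add_apply,
      LinearMap.id_apply, Q, lin_ofLin] at this
    have h2 : parityG V v = (2 : ℂ) • ((1 / 2 : ℂ) • (v + parityG V v)) - v := by module
    rw [h2, this]
    module

/-- If translation by `c` maps eigenvalues to eigenvalues, then `c = 0`. -/
lemma eq_zero_of_hasEigenvalue_add {A : Type*} [AddCommGroup A] [Module ℂ A] [Module.Finite ℂ A]
    {T : Module.End ℂ A} {a c : ℂ} (ha : T.HasEigenvalue a)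
    (h : ∀ z, T.HasEigenvalue z → T.HasEigenvalue (z + c)) : c = 0 := by
  by_contra hc
  have key : ∀ j : ℕ, T.HasEigenvalue (a + j * c) := fun j => by
    induction j with
    | zero => simpa using ha
    | succ j ih =>
      have := h _ ih
      rwa [show a + j * c + c = a + (j + 1 : ℕ) * c by push_cast; ring] at this
  have hfin : {z | T.HasEigenvalue z}.Finite :=
    Module.End.finite_hasEigenvalue T
  refine Set.infinite_of_injective_forall_mem (f := fun j : ℕ => a + j * c) (fun i j hij => ?_)
    key hfin
  have : (i : ℂ) * c = j * c := add_left_cancel hij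
  exact_mod_cast mul_right_cancel₀ hc this

/-- An isomorphism shifts the finite spectrum of E by m and that of G by k, so both shifts are zero.
Parity needs a separate argument, because V may have vectors of both parities: the sign
(−1)^{|v|+n}, constant on a simple module, would be reversed. -/
lemma tensor_eps_free [Simple V] {m : ℂ} {k : ℤ} {p : ZMod 2} {h : qpow ħ m = qpow ħ (-m)}
    (e : V ⊗ eps ħ m k p h ≅ V) : m = 0 ∧ k = 0 ∧ p = 0 := by
  obtain ⟨s, l, n, v, hv, h0⟩ := exists_wt_ne_zero (id_nonzero V)
  let f : V.carrier ⊗[ℂ] ℂ →ₗ[ℂ] V.carrier := lin e.hom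
  have hf : ∀ s l n v, IsWt V.action s l n v →
      IsWt V.action (s * paritySign p) (l + m) (n + k) (f (v ⊗ₜ (1 : ℂ))) := fun s l n v hv =>
    (hv.tmul (isWt_eps h 1)).map (lin_mem e.hom)
  let f' : V.carrier →ₗ[ℂ] V.carrier ⊗[ℂ] ℂ := lin e.inv
  have hff : ∀ x, f' (f x) = x := fun x => LinearMap.congr_fun (congrArg lin e.hom_inv_id) x
  have hne : ∀ v, v ≠ 0 → f (v ⊗ₜ (1 : ℂ)) ≠ 0 := fun v hv hz => hv (by
    have h1 := hff (v ⊗ₜ (1 : ℂ))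
    rw [hz, map_zero] at h1
    have := congrArg (TensorProduct.rid ℂ V.carrier) h1
    simpa using this.symm)
  have ht : ∀ v, f (v ⊗ₜ (1 : ℂ)) = (f ∘ₗ (TensorProduct.mk ℂ V.carrier ℂ).flip 1) v := fun v => rfl
  have hE : ∀ v, V.action.E (f (v ⊗ₜ (1 : ℂ))) = f (V.action.E v ⊗ₜ 1) + m • f (v ⊗ₜ (1 : ℂ)) := by
    intro v
    have : V.action.E ∘ₗ f ∘ₗ (TensorProduct.mk ℂ V.carrier ℂ).flip 1 =
        (f ∘ₗ (TensorProduct.mk ℂ V.carrier ℂ).flip 1) ∘ₗ V.action.E +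
          m • (f ∘ₗ (TensorProduct.mk ℂ V.carrier ℂ).flip 1) :=
      ext_wt V.action fun s l n v hv => by
        have := (hf _ _ _ _ hv).eE
        rw [ht] at this
        simp only [LinearMap.comp_apply, LinearMap.add_apply, LinearMap.smul_apply, hv.eE, map_smul] at this ⊢
        rw [this, add_smul]
    exact LinearMap.congr_fun this v
  have hG : ∀ v, V.action.G (f (v ⊗ₜ (1 : ℂ))) =
      f (V.action.G v ⊗ₜ 1) + (k : ℂ) • f (v ⊗ₜ (1 : ℂ)) := by
    intro v
    have : V.action.G ∘ₗ f ∘ₗ (TensorProduct.mk ℂ V.carrier ℂ).flip 1 =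
        (f ∘ₗ (TensorProduct.mk ℂ V.carrier ℂ).flip 1) ∘ₗ V.action.G +
          (k : ℂ) • (f ∘ₗ (TensorProduct.mk ℂ V.carrier ℂ).flip 1) :=
      ext_wt V.action fun s l n v hv => by
        have := (hf _ _ _ _ hv).eG
        rw [ht] at this
        simp only [LinearMap.comp_apply, LinearMap.add_apply, LinearMap.smul_apply, hv.eG, map_smul] at this ⊢
        rw [this, Int.cast_add, add_smul]
    exact LinearMap.congr_fun this v
  have heig : ∀ (T : Module.End ℂ V.carrier) (c a : ℂ) (v : V.carrier), v ≠ 0 → T v = a • v →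
      (∀ v, T (f (v ⊗ₜ (1 : ℂ))) = f (T v ⊗ₜ 1) + c • f (v ⊗ₜ (1 : ℂ))) → c = 0 :=
    fun T c a v h0 hv hT => by
      refine eq_zero_of_hasEigenvalue_add (T := T) (a := a)
        (Module.End.hasEigenvalue_of_hasEigenvector
          ⟨Module.End.mem_eigenspace_iff.mpr hv, h0⟩) fun z hz => ?_
      obtain ⟨w, hw⟩ := hz.exists_hasEigenvector
      refine Module.End.hasEigenvalue_of_hasEigenvector (x := f (w ⊗ₜ (1 : ℂ)))
        ⟨Module.End.mem_eigenspace_iff.mpr ?_, hne w hw.2⟩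
      rw [hT, hw.apply_eq_smul, ← TensorProduct.smul_tmul', map_smul, add_smul]
  have hm : m = 0 := heig _ _ _ v h0 hv.eE hE
  have hk : k = 0 := by exact_mod_cast heig _ _ _ v h0 hv.eG hG
  subst hm hk
  refine ⟨rfl, rfl, ?_⟩
  by_contra hp
  have hs : paritySign p = -1 := if_neg hp
  have h1 := parityG_apply hv
  have h2 := parityG_apply (hf _ _ _ _ hv)
  have h3 : qpow (Real.pi * Complex.I) ((n + 0 : ℤ) : ℂ) = qpow (Real.pi * Complex.I) (n : ℂ) := by
    rw [add_zero]
  rw [hs, h3] at h2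
  obtain ⟨c, hc⟩ : ∃ c : ℂ, ∀ v, parityG V v = c • v := by
    rcases parityG_of_simple (V := V) with h | h
    · exact ⟨1, fun v => by rw [h, one_smul]⟩
    · exact ⟨-1, fun v => by rw [h, neg_one_smul]⟩
  rw [hc] at h1 h2
  have e1 := smul_left_injective ℂ h0 h1
  have e2 := smul_left_injective ℂ (hne v h0) h2
  have h4 : s * qpow (Real.pi * Complex.I) (n : ℂ) ≠ 0 := by
    rcases hv.sign with rfl | rfl <;> simp
  apply h4
  have : (2 : ℂ) * (s * qpow (Real.pi * Complex.I) (n : ℂ)) = 0 := by linear_combination e2 - e1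
  simpa using this

/-- The free realisation `(n, n', p) ↦ ε(n R γ, n' R)_p`. -/
def sigma [Admissible ħ] (H : IsPeriod ħ γ R) :
    FreeRealisation (IntWeightModule ħ) (ℤ × ℤ × ZMod 2) where
  functor := sigmaFunctor H
  monoidal := (sigmaCoreMonoidal H).toMonoidal
  obj_zero := sigmaObj_zero H
  qdim_eq k := by
    have := lin_qdim_eps (n := k.2.1 * R) (p := k.2.2) (H.qpow_int_mul k.1) (H.qpow_eq_neg k.1)
    rcases paritySign_eq k.2.2 with h | h <;> rw [h] at this
    · exact Or.inl (this.trans (one_smul _ _))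
    · exact Or.inr (this.trans (neg_one_smul _ _))
  twist_eq k := by
    refine theta_eps (H.qpow_int_mul k.1) ?_ (H.qpow_eq_neg k.1)
    -- For l = k₁Rγ and n = k₂R the exponent −2ln is an integral multiple of the period Rγ.
    rw [← H.qpow_int_mul (-2 * k.1 * k.2.1 * R)]
    congr 1
    push_cast
    ring
  free V _ k := by
    constructor
    · rintro ⟨e⟩
      obtain ⟨h1, h2, h3⟩ := tensor_eps_free e
      have hR : (R : ℤ) ≠ 0 := by exact_mod_cast H.pos.ne'
      refine Prod.ext ?_ (Prod.ext ?_ h3)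
      · exact_mod_cast (mul_eq_zero.mp h1).resolve_right H.mul_ne_zero
      · exact (mul_eq_zero.mp h2).resolve_right hR
    · rintro rfl
      have e : V ⊗ sigmaObj H 0 = V ⊗ 𝟙_ (IntWeightModule ħ) := by rw [sigmaObj_zero]
      exact ⟨eqToIso e ≪≫ ρ_ V⟩

end IntWeightModule

/-! ### The pairing ψ, the cells of weights, pre-modularity and TQFT finiteness -/

namespace IntWeightModule

open IntWeight IntAction RelMod

variable {ħ γ : ℂ} {R : ℕ} {V W : IntWeightModule ħ} {l : ℂ} {n : ℤ} {p : ZMod 2}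

/-- The character `l ↦ q ^ (-2 R l)` of the grading group. -/
def psiAux (H : IsPeriod ħ γ R) : ℂ ⧸ AddSubgroup.zmultiples γ →+ Additive ℂˣ :=
  QuotientAddGroup.lift _
    (AddMonoidHom.mk' (fun l : ℂ => Additive.ofMul (Units.mk0 (qpow ħ (-2 * R * l)) (qpow_ne_zero _ _)))
      fun a b => by
        apply Additive.toMul.injective
        ext
        simp [mul_add, qpow_add])
    -- The character is trivial on γ, since q^{−2Rγ} = 1.
    (AddSubgroup.zmultiples_le_of_mem (by
      rw [AddMonoidHom.mem_ker]
      apply Additive.toMul.injective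
      ext
      have := H.qpow_int_mul (-2)
      simpa [mul_assoc] using this))

/-- The bilinear map `ψ`. -/
def psi (H : IsPeriod ħ γ R) :
    ℂ ⧸ AddSubgroup.zmultiples γ →+ ℤ × ℤ × ZMod 2 →+ Additive ℂˣ :=
  AddMonoidHom.mk' (fun g => AddMonoidHom.mk' (fun k => k.2.1 • psiAux H g)
    fun a b => add_zsmul _ _ _) fun a b => by
      ext1 k
      simpa using zsmul_add _ _ k.2.1

lemma psi_apply (H : IsPeriod ħ γ R) (l : ℂ) (k : ℤ × ℤ × ZMod 2) :
    (((psi H l k).toMul : ℂˣ) : ℂ) = qpow ħ (-2 * (l * (k.2.1 * R))) := by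
  have h : (((psi H l k).toMul : ℂˣ) : ℂ) = (qpow ħ (-2 * R * l)) ^ k.2.1 := by
    simp [psi, psiAux]
  rw [h, qpow, qpow, ← Complex.exp_int_mul]
  congr 1
  ring

/-- X and Y vanish on σ(k), so only the two operators Υ remain; they give q^{−2(l k₂R + n k₁Rγ)}.
The second part is 1 because the G-weight n is an integer, and the super signs cancel. -/
lemma double_braiding_eps [Admissible ħ] (H : IsPeriod ħ γ R) {g : ℂ ⧸ AddSubgroup.zmultiples γ}
    (hV : eDegree ħ (AddSubgroup.zmultiples γ) g V) (k : ℤ × ℤ × ZMod 2) :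
    (β_ V (sigmaObj H k)).hom ≫ (β_ (sigmaObj H k) V).hom =
      (((psi H g k).toMul : ℂˣ) : ℂ) • 𝟙 (V ⊗ sigmaObj H k) := by
  refine lin_injective (TensorProduct.ext (ext_wt V.action fun s l n v hv =>
    LinearMap.ext_ring ?_))
  by_cases h0 : v = 0
  · rw [h0, map_zero, map_zero]
  have hg := eDegree_wt hV hv h0
  rw [← hg, psi_apply]
  have hw := isWt_eps (n := k.2.1 * R) (p := k.2.2) (H.qpow_eq_neg k.1) (1 : ℂ)
  have hX : (epsAction ħ _ (k.2.1 * R) k.2.2 (H.qpow_eq_neg k.1)).X 1 = 0 := rfl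
  have hY : (epsAction ħ _ (k.2.1 * R) k.2.2 (H.qpow_eq_neg k.1)).Y 1 = 0 := rfl
  change braid (epsAction ħ _ (k.2.1 * R) k.2.2 (H.qpow_eq_neg k.1)) V.action
    (braid V.action (epsAction ħ _ (k.2.1 * R) k.2.2 (H.qpow_eq_neg k.1)) (v ⊗ₜ (1 : ℂ))) =
    qpow ħ (-2 * (l * (k.2.1 * R))) • (v ⊗ₜ[ℂ] (1 : ℂ))
  rw [braid_tmul hv hw, hY, TensorProduct.zero_tmul, smul_zero, add_zero, map_smul, map_smul,
    braid_tmul hw hv, hX, TensorProduct.tmul_zero, smul_zero, add_zero]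
  simp only [smul_smul]
  congr 1
  have e : qpow ħ (-(l * ((k.2.1 * R : ℤ) : ℂ) + n * (k.1 * (R * γ)))) *
      qpow ħ (-(k.1 * (R * γ) * n + ((k.2.1 * R : ℤ) : ℂ) * l)) =
      qpow ħ (-2 * (l * (k.2.1 * R))) := by
    have h1 := H.qpow_int_mul (-2 * n * k.1)
    rw [← qpow_add, ← mul_one (qpow ħ (-2 * (l * (k.2.1 * R)))), ← h1, ← qpow_add]
    congr 1
    push_cast
    ring
  have e2 : sgn s (paritySign k.2.2) * sgn (paritySign k.2.2) s = 1 := by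
    rcases hv.sign with rfl | rfl <;> rcases paritySign_eq k.2.2 with h | h <;> rw [h] <;>
      simp only [sgn] <;> norm_num
  linear_combination (sgn s (paritySign k.2.2) * sgn (paritySign k.2.2) s) * e +
    qpow ħ (-2 * (l * (k.2.1 * R))) * e2

lemma eDegree_sigma [Admissible ħ] (H : IsPeriod ħ γ R) (k : ℤ × ℤ × ZMod 2) :
    eDegree ħ (AddSubgroup.zmultiples γ) 0 (sigmaObj H k) := by
  have hk : ((k.1 * (R * γ) : ℂ) : ℂ ⧸ AddSubgroup.zmultiples γ) = 0 :=
    (QuotientAddGroup.eq_zero_iff _).mpr (AddSubgroup.mem_zmultiples_iff.mpr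
      ⟨k.1 * R, by rw [zsmul_eq_mul]; push_cast; ring⟩)
  exact eDegree_of_span (V := sigmaObj H k) Set.univ Submodule.span_univ
    fun v _ => ⟨k.1 * (R * γ), (isWt_eps (H.qpow_eq_neg k.1) v).eE, fun _ => hk⟩

/-- The representative of index `i` of the `E`-weights of degree `g`. -/
def cellE (g : ℂ ⧸ AddSubgroup.zmultiples γ) (i : Fin (R * R)) : ℂ :=
  g.out + (finProdFinEquiv.symm i).1 * γ

/-- The representative of index `i` of the `G`-weights. -/
def cellG (i : Fin (R * R)) : ℤ := (finProdFinEquiv.symm i).2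

lemma mk_cellE (g : ℂ ⧸ AddSubgroup.zmultiples γ) (i : Fin (R * R)) :
    (cellE g i : ℂ ⧸ AddSubgroup.zmultiples γ) = g := by
  have h : (((finProdFinEquiv.symm i).1 * γ : ℂ) : ℂ ⧸ AddSubgroup.zmultiples γ) = 0 :=
    (QuotientAddGroup.eq_zero_iff _).mpr (AddSubgroup.mem_zmultiples_iff.mpr
      ⟨((finProdFinEquiv.symm i).1 : ℕ), by rw [zsmul_eq_mul]; push_cast; rfl⟩)
  rw [cellE, QuotientAddGroup.mk_add, h, add_zero, QuotientAddGroup.out_eq']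

lemma exists_fin_add_mul (hR : 0 < R) (j : ℤ) : ∃ (a : Fin R) (b : ℤ), j = a + b * R := by
  have h1 := Int.emod_nonneg j (b := R) (by omega)
  have h2 := Int.emod_lt_of_pos j (b := R) (by omega)
  refine ⟨⟨(j % R).toNat, by omega⟩, j / R, ?_⟩
  have := Int.emod_add_mul_ediv j R
  simp only [Int.toNat_of_nonneg h1]
  linarith

/-- Division with remainder by R, applied to (l − g.out)/γ and to n: the remainders select the cell
and the quotients are the components of the twist by σ. -/
lemma exists_cell (H : IsPeriod ħ γ R) {g : ℂ ⧸ AddSubgroup.zmultiples γ}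
    (hl : (l : ℂ ⧸ AddSubgroup.zmultiples γ) = g) (n : ℤ) :
    ∃ (i : Fin (R * R)) (a b : ℤ), cellE g i + a * (R * γ) = l ∧ cellG i + b * R = n := by
  rw [← QuotientAddGroup.out_eq' g] at hl
  obtain ⟨j, hj⟩ := AddSubgroup.mem_zmultiples_iff.mp (QuotientAddGroup.eq.mp hl.symm)
  obtain ⟨i₁, a, h1⟩ := exists_fin_add_mul H.pos j
  obtain ⟨i₂, b, h2⟩ := exists_fin_add_mul H.pos n
  refine ⟨finProdFinEquiv (i₁, i₂), a, b, ?_, ?_⟩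
  · rw [cellE, Equiv.symm_apply_apply]
    rw [zsmul_eq_mul, h1] at hj
    push_cast at hj
    linear_combination hj
  · rw [cellG, Equiv.symm_apply_apply, h2]

lemma fin_add_mul_unique {a a' : Fin R} {b b' : ℤ} (h : (a : ℤ) + b * R = a' + b' * R) :
    a = a' ∧ b = b' := by
  have ha := a.isLt
  have ha' := a'.isLt
  have h1 : b = b' := by
    by_contra hne
    rcases lt_or_gt_of_ne hne with hlt | hlt
    · nlinarith
    · nlinarith
  subst h1
  refine ⟨Fin.ext ?_, rfl⟩
  omega

lemma cell_unique (H : IsPeriod ħ γ R) {g : ℂ ⧸ AddSubgroup.zmultiples γ} {i j : Fin (R * R)}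
    {a b a' b' : ℤ} (hE : cellE g i + a * (R * γ) = cellE g j + a' * (R * γ))
    (hG : cellG i + b * R = cellG j + b' * R) : i = j ∧ a = a' ∧ b = b' := by
  obtain ⟨h2, hb⟩ := fin_add_mul_unique hG
  have h3 : ((finProdFinEquiv.symm i).1 : ℤ) + a * R = (finProdFinEquiv.symm j).1 + a' * R := by
    have : (((finProdFinEquiv.symm i).1 : ℂ) + a * R) * γ =
        ((finProdFinEquiv.symm j).1 + a' * R) * γ := by
      rw [cellE, cellE] at hE
      linear_combination hE
    exact_mod_cast mul_right_cancel₀ H.ne_zero this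
  obtain ⟨h1, ha⟩ := fin_add_mul_unique h3
  exact ⟨finProdFinEquiv.symm.injective (Prod.ext h1 h2), ha, hb⟩

/-- The data of a relative modular category. -/
def relativeData [Admissible ħ] (H : IsPeriod ħ γ R) :
    RelativeData ℂ (IntWeightModule ħ) (ℂ ⧸ AddSubgroup.zmultiples γ) (ℤ × ℤ × ZMod 2) where
  deg := eDegree ħ (AddSubgroup.zmultiples γ)
  σ := sigma H
  t := mTrace ħ

/-- The degrees which are not generic. -/
def nonGeneric (γ : ℂ) : Set (ℂ ⧸ AddSubgroup.zmultiples γ) :=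
  {g | ∃ m : ℤ, g = ((m * (γ / 2) : ℂ) : ℂ ⧸ AddSubgroup.zmultiples γ)}

lemma qnum_ne_zero_of_degree [Admissible ħ] (H : IsPeriod ħ γ R)
    {g : ℂ ⧸ AddSubgroup.zmultiples γ} (hg : g ∉ nonGeneric γ)
    (hl : (l : ℂ ⧸ AddSubgroup.zmultiples γ) = g) : qnum ħ l ≠ 0 :=
  H.qnum_ne_zero (by rw [hl]; exact hg)

lemma kac_congr {l l' : ℂ} {n n' : ℤ} {p p' : ZMod 2} (h1 : l = l') (h2 : n = n') (h3 : p = p') :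
    kac ħ l n p = kac ħ l' n' p' := by rw [h1, h2, h3]

lemma indec_congr {l l' : ℂ} {n n' : ℤ} {p p' : ZMod 2} (h1 : l = l') (h2 : n = n') (h3 : p = p') :
    indec ħ l n p = indec ħ l' n' p' := by rw [h1, h2, h3]

/-- Tensoring a typical module with `σ(k)`. -/
def kacTensorSigma (H : IsPeriod ħ γ R) (k : ℤ × ℤ × ZMod 2) :
    kac ħ l n 0 ⊗ sigmaObj H k ≅ kac ħ (l + k.1 * (R * γ)) (n + k.2.1 * R) k.2.2 :=
  kacTensorEps (H.qpow_int_mul k.1) (H.qpow_eq_neg k.1) ≪≫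
    eqToIso (kac_congr rfl rfl (zero_add _))

lemma kac_dominating [Admissible ħ] (H : IsPeriod ħ γ R) {g : ℂ ⧸ AddSubgroup.zmultiples γ}
    (hg : g ∉ nonGeneric γ) :
    IsDominating (fun ik : Fin (R * R) × (ℤ × ℤ × ZMod 2) =>
      kac ħ (cellE g ik.1) (cellG ik.1) 0 ⊗ sigmaObj H ik.2)
      (eDegree ħ (AddSubgroup.zmultiples γ) g) := by
  intro V hV
  obtain ⟨d, l, n, p, s, ι, h1, h2⟩ := exists_kac_sum (V := V) fun s l n v hv h0 =>
    qnum_ne_zero_of_degree H hg (eDegree_wt hV hv h0)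
  choose i a b hE hG using fun x => exists_cell H (hV _ (h2 x)) (n x)
  let e : ∀ x, kac ħ (cellE g (i x)) (cellG (i x)) 0 ⊗ sigmaObj H (a x, b x, p x) ≅
      kac ħ (l x) (n x) (p x) := fun x =>
    kacTensorSigma H (a x, b x, p x) ≪≫ eqToIso (kac_congr (hE x) (hG x) rfl)
  refine ⟨d, fun x => (i x, (a x, b x, p x)), fun x => (e x).hom ≫ ι x, fun x => s x ≫ (e x).inv, ?_⟩
  rw [h1]
  exact Finset.sum_congr rfl fun x _ => by simp

/-- After absorbing σ(k), the members of the family are modules V(l,n)_p with pairwise distinct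
(l,n,p) and [l] ≠ 0, to which Schur's lemma applies. -/
lemma kac_completelyReduced [Admissible ħ] (H : IsPeriod ħ γ R)
    {g : ℂ ⧸ AddSubgroup.zmultiples γ} (hg : g ∉ nonGeneric γ) :
    IsCompletelyReduced ℂ (fun ik : Fin (R * R) × (ℤ × ℤ × ZMod 2) =>
      kac ħ (cellE g ik.1) (cellG ik.1) 0 ⊗ sigmaObj H ik.2) := by
  have hq : ∀ (i : Fin (R * R)) (k : ℤ), qnum ħ (cellE g i + k * (R * γ)) ≠ 0 := fun i k => by
    rw [qnum_add_of_qpow_eq_one (H.qpow_int_mul k)]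
    exact qnum_ne_zero_of_degree H hg (mk_cellE g i)
  constructor
  · rintro ⟨i, k⟩
    let e := kacTensorSigma (l := cellE g i) (n := cellG i) H k
    refine rank_eq_one (𝟙 _) (fun h => ?_) fun f => ?_
    · apply kac_one_ne_zero (ħ := ħ)
      have h2 : e.inv ≫ 𝟙 _ ≫ e.hom = 𝟙 _ := by simp
      rw [h, Limits.zero_comp, Limits.comp_zero] at h2
      exact h2.symm
    · obtain ⟨c, hc⟩ := kac_end_eq_smul (hq i k.1) (e.inv ≫ f ≫ e.hom)
      refine ⟨c, ?_⟩
      have h2 : f = e.hom ≫ (e.inv ≫ f ≫ e.hom) ≫ e.inv := by simp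
      rw [h2, hc]
      simp
  · rintro ⟨i, k⟩ ⟨j, k'⟩ hne
    let e := kacTensorSigma (l := cellE g i) (n := cellG i) H k
    let e' := kacTensorSigma (l := cellE g j) (n := cellG j) H k'
    have h0 : ∀ f : kac ħ (cellE g i) (cellG i) 0 ⊗ sigmaObj H k ⟶
        kac ħ (cellE g j) (cellG j) 0 ⊗ sigmaObj H k', f = 0 := fun f => by
      have h2 : f = e.hom ≫ (e.inv ≫ f ≫ e'.hom) ≫ e'.inv := by simp
      rw [h2, kac_hom_eq_zero (hq j k'.1) ?_ (e.inv ≫ f ≫ e'.hom), Limits.zero_comp,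
        Limits.comp_zero]
      rintro ⟨h1, h2, h3⟩
      obtain ⟨rfl, h4, h5⟩ := cell_unique H h1 h2
      exact hne (Prod.ext rfl (Prod.ext h4 (Prod.ext h5 h3)))
    have : Subsingleton (kac ħ (cellE g i) (cellG i) 0 ⊗ sigmaObj H k ⟶
        kac ħ (cellE g j) (cellG j) 0 ⊗ sigmaObj H k') :=
      ⟨fun f f' => (h0 f).trans (h0 f').symm⟩
    exact rank_subsingleton' _ _

/-- The simple objects of generic degree. -/
def genericSimples [Admissible ħ] (H : IsPeriod ħ γ R) :
    (relativeData H).GenericSimples (nonGeneric γ) where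
  card _ := R * R
  obj g i := kac ħ (cellE g i) (cellG i) 0
  deg_obj {g} hg i := by
    have := eDegree_kac (ħ := ħ) (Γ := AddSubgroup.zmultiples γ) (l := cellE g i) (n := cellG i)
      (p := 0)
    rwa [mk_cellE] at this
  simple {g} hg i := simple_kac (qnum_ne_zero_of_degree H hg (mk_cellE g i))
  regular {g} hg i := isRegular_of_ne_zero (V := kac ħ (cellE g i) (cellG i) 0)
    (v := ((1, 0) : ℂ × ℂ)) fun h => one_ne_zero (congrArg Prod.fst h)
  projective {g} hg i := isProjective_kac (qnum_ne_zero_of_degree H hg (mk_cellE g i))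
  dominating hg := kac_dominating H hg
  completelyReduced hg := kac_completelyReduced H hg

lemma qnum_one [Admissible ħ] : qnum ħ 1 ≠ 0 := by
  have h : qpow ħ 1 - (qpow ħ 1)⁻¹ = qdiff ħ := by rw [qdiff, qpow_neg]
  rw [qnum, h, inv_mul_cancel₀ (qdiff_ne_zero ħ)]
  exact one_ne_zero

lemma mTrace_dim_kac_one [Admissible ħ] :
    (mTrace ħ).dim (kac ħ 1 0 0) (isProjective_kac qnum_one) = (qdiff ħ)⁻¹ := by
  rw [mTrace_dim_kac qnum_one, qdiff, qpow_neg]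
  simp [paritySign]

theorem isPreModular [Admissible ħ] (H : IsPeriod ħ γ R) :
    (relativeData H).IsPreModular (nonGeneric γ) where
  isLinearRibbon := isLinearRibbon
  small := IsPeriod.isSmall γ
  symmetric := IsPeriod.isSymmetric γ
  grading := isGrading_eDegree _
  deg_σ k := eDegree_sigma H k
  trace_ne_zero := ⟨kac ħ 1 0 0, isProjective_kac qnum_one, 𝟙 _, by
    refine ne_of_eq_of_ne mTrace_dim_kac_one ?_
    exact inv_ne_zero (qdiff_ne_zero ħ)⟩
  generic_semisimplicity := ⟨genericSimples H⟩
  compatibility := ⟨psi H, fun _ _ hV k => double_braiding_eps H hV k⟩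

instance finite_hom : Module.Finite ℂ (V ⟶ W) :=
  Module.Finite.of_injective
    ({ toFun := lin
       map_add' := lin_add
       map_smul' := lin_smul } : (V ⟶ W) →ₗ[ℂ] V.carrier →ₗ[ℂ] W.carrier)
    fun _ _ h => lin_injective h

/-- A nonzero map out of σ(k) yields a vector of weight (k₁Rγ, k₂R), and V has finitely many
weights. -/
lemma finite_hom_ne_zero [Admissible ħ] (H : IsPeriod ħ γ R) (V : IntWeightModule ħ) :
    {k | ∃ f : sigmaObj H k ⟶ V, f ≠ 0}.Finite := by
  have hfin := ((Module.End.finite_hasEigenvalue V.action.E).prod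
    ((Module.End.finite_hasEigenvalue V.action.G).prod (Set.finite_univ (α := ZMod 2))))
  refine (hfin.preimage (f := fun k : ℤ × ℤ × ZMod 2 =>
    ((k.1 * (R * γ) : ℂ), (((k.2.1 * R : ℤ) : ℂ), k.2.2))) ?_).subset ?_
  · rintro ⟨a, b, c⟩ - ⟨a', b', c'⟩ - h
    simp only [Prod.mk.injEq] at h
    obtain ⟨h1, h2, h3⟩ := h
    have h4 : a = a' := by exact_mod_cast mul_right_cancel₀ H.mul_ne_zero h1
    have h5 : b = b' := by
      push_cast at h2
      exact_mod_cast mul_right_cancel₀ H.cast_ne_zero h2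
    rw [h4, h5, h3]
  · rintro k ⟨f, hf⟩
    have hw : IsWt V.action (paritySign k.2.2) (k.1 * (R * γ)) (k.2.1 * R) (lin f (1 : ℂ)) :=
      (isWt_eps (H.qpow_eq_neg k.1) (1 : ℂ)).map (lin_mem f)
    have h0 : lin f (1 : ℂ) ≠ 0 := fun h => hf (lin_injective (LinearMap.ext_ring h))
    exact ⟨Module.End.hasEigenvalue_of_hasEigenvector
        ⟨Module.End.mem_eigenspace_iff.mpr hw.eE, h0⟩,
      Module.End.hasEigenvalue_of_hasEigenvector
        ⟨Module.End.mem_eigenspace_iff.mpr hw.eG, h0⟩, trivial⟩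

/-- Indecomposable projectives are labelled by (l,n,p), and σ acts on the labels by translation. The
R² cells represent the orbits in a given degree. -/
theorem isTQFTFinite [Admissible ħ] (H : IsPeriod ħ γ R) : (relativeData H).IsTQFTFinite where
  finite_indecomposables g := by
    refine ⟨R * R, fun i => indec ħ (cellE g i) (cellG i) 0, fun i =>
      ⟨isProjective_indec, isIndecomposable_indec, ?_⟩, fun Q hQ hQ' hg => ?_⟩
    · have := eDegree_indec (ħ := ħ) (Γ := AddSubgroup.zmultiples γ) (l := cellE g i)
        (n := cellG i) (p := 0)
      rwa [mk_cellE] at this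
    · obtain ⟨l, n, p, hl, ⟨e⟩⟩ := exists_iso_indec hQ hQ'
      obtain ⟨i, a, b, hE, hG⟩ := exists_cell H (hg l hl) n
      obtain ⟨e'⟩ := nonempty_indecTensorEps (l := cellE g i) (n := cellG i) (p := 0)
        (k := b * R) (p' := p) (H.qpow_int_mul a) (H.qpow_eq_neg a)
      exact ⟨i, (a, b, p), ⟨e ≪≫ eqToIso (indec_congr hE.symm hG.symm (zero_add p).symm) ≪≫
        e'.symm⟩⟩
  finite_hom P hP := ⟨fun k => finite_hom, finite_hom_ne_zero H P⟩
  dominated := projective_dominated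

end IntWeightModule

/-! ### Encircling a strand by a typical module -/

namespace IntWeightModule

open IntWeight IntAction RelMod

variable {ħ γ : ℂ} {R : ℕ} {V W : IntWeightModule ħ}

/-- Coevaluation does not depend on the basis: V ⊗ V* embeds into the endomorphisms of V, and both
sides go to the identity. -/
lemma coevaluation_pair : coevaluation ℂ (ℂ × ℂ) 1 =
    ((1, 0) : ℂ × ℂ) ⊗ₜ LinearMap.fst ℂ ℂ ℂ + ((0, 1) : ℂ × ℂ) ⊗ₜ LinearMap.snd ℂ ℂ ℂ := by
  have hinj : Function.Injective (dualTensorHom ℂ (ℂ × ℂ) (ℂ × ℂ) ∘ₗ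
      (TensorProduct.comm ℂ (ℂ × ℂ) (Module.Dual ℂ (ℂ × ℂ))).toLinearMap) :=
    ((TensorProduct.comm ℂ (ℂ × ℂ) (Module.Dual ℂ (ℂ × ℂ))).trans
      (dualTensorHomEquiv ℂ (ℂ × ℂ) (ℂ × ℂ))).injective
  apply hinj
  rw [coevaluation_apply_one]
  refine LinearMap.ext fun v => ?_
  have h1 : ∑ i, (Module.Basis.ofVectorSpace ℂ (ℂ × ℂ)).coord i v •
      Module.Basis.ofVectorSpace ℂ (ℂ × ℂ) i = v := (Module.Basis.ofVectorSpace ℂ (ℂ × ℂ)).sum_repr v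
  simp only [LinearMap.comp_apply, LinearEquiv.coe_coe, map_sum, map_add, TensorProduct.comm_tmul,
    LinearMap.sum_apply, LinearMap.add_apply, dualTensorHom_apply, h1]
  ext <;> simp

/-- For an encircling module of dimension two, the partial trace is a sum of two diagonal entries,
each twisted by the pivotal operator B. -/
lemma partialTrace_pair {A : Type*} [AddCommGroup A] [Module ℂ A]
    {g : A ⊗[ℂ] (ℂ × ℂ) →ₗ[ℂ] A ⊗[ℂ] (ℂ × ℂ)}
    {ev : (ℂ × ℂ) ⊗[ℂ] Module.Dual ℂ (ℂ × ℂ) →ₗ[ℂ] ℂ} {B : Module.End ℂ (ℂ × ℂ)}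
    (hev : ∀ v φ, ev (v ⊗ₜ φ) = φ (B v)) (v : A) :
    (TensorProduct.rid ℂ A) ((TensorProduct.map LinearMap.id ev)
      ((TensorProduct.assoc ℂ _ _ _) ((TensorProduct.map g LinearMap.id)
        ((TensorProduct.assoc ℂ _ _ _).symm (v ⊗ₜ coevaluation ℂ (ℂ × ℂ) 1))))) =
      (TensorProduct.rid ℂ A) (TensorProduct.map LinearMap.id (LinearMap.fst ℂ ℂ ℂ ∘ₗ B)
        (g (v ⊗ₜ ((1, 0) : ℂ × ℂ)))) +
      (TensorProduct.rid ℂ A) (TensorProduct.map LinearMap.id (LinearMap.snd ℂ ℂ ℂ ∘ₗ B)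
        (g (v ⊗ₜ ((0, 1) : ℂ × ℂ)))) := by
  have key : ∀ (φ : Module.Dual ℂ (ℂ × ℂ)) (y : A ⊗[ℂ] (ℂ × ℂ)),
      TensorProduct.map LinearMap.id ev (TensorProduct.assoc ℂ _ _ _ (y ⊗ₜ φ)) =
        TensorProduct.map LinearMap.id (φ ∘ₗ B) y := fun φ y => by
    induction y using TensorProduct.induction_on with
    | zero => simp
    | tmul a b => simp [hev]
    | add x y hx hy => rw [TensorProduct.add_tmul, map_add, map_add, map_add, hx, hy]
  rw [coevaluation_pair]
  simp only [TensorProduct.tmul_add, map_add, TensorProduct.assoc_symm_tmul,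
    TensorProduct.map_tmul, LinearMap.id_apply, key]

lemma isWt_kac_snd (l : ℂ) (n : ℤ) :
    IsWt (kacAction ħ l n 0) (-1) l (n - 1) ((0, 1) : ℂ × ℂ) where
  sign := Or.inr rfl
  eP := by simp [kacAction_P, paritySign]
  eE := by simp [kacAction_E]
  eG := by simp [kacAction_G]

lemma isWt_kac_fst (l : ℂ) (n : ℤ) : IsWt (kacAction ħ l n 0) 1 l n ((1, 0) : ℂ × ℂ) :=
  (isWt_kac l n 0).cast (by simp [paritySign]) rfl rfl

/-- The endomorphism of a module given by encircling it by a typical module. -/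
lemma lin_Phi_kac [Admissible ħ] {s l β : ℂ} {n b : ℤ} {v : V.carrier}
    (hv : IsWt V.action s l n v) : lin (Phi (kac ħ β b 0) V) v =
      qpow ħ (-2 * (l * b + n * β)) • ((qpow ħ β * (1 - qpow ħ l * qpow ħ l)) • v +
        (qdiff ħ * qpow ħ l * (qpow ħ β - (qpow ħ β)⁻¹)) • V.action.Y (V.action.X v)) := by
  have hx := isWt_kac_fst (ħ := ħ) β b
  have hy := isWt_kac_snd (ħ := ħ) β b
  have hYx : (kacAction ħ β b 0).Y ((1, 0) : ℂ × ℂ) = (0, 1) := rfl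
  have hYy : (kacAction ħ β b 0).Y ((0, 1) : ℂ × ℂ) = 0 := rfl
  have hXx : (kacAction ħ β b 0).X ((1, 0) : ℂ × ℂ) = 0 := by rw [kacAction_X]; simp
  have hXy : (kacAction ħ β b 0).X ((0, 1) : ℂ × ℂ) = qnum ħ β • ((1, 0) : ℂ × ℂ) := by
    rw [kacAction_X]; simp
  -- B is the pivotal operator PK of V(β,b)_0, that is, q^β times the parity.
  obtain ⟨B, hB, hBx, hBy⟩ : ∃ B : Module.End ℂ (ℂ × ℂ),
      (∀ (v : ℂ × ℂ) (φ : Module.Dual ℂ (ℂ × ℂ)), lin (evR (kac ħ β b 0)) (v ⊗ₜ[ℂ] φ) = φ (B v)) ∧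
      B (1, 0) = (qpow ħ β, 0) ∧ B (0, 1) = (0, -qpow ħ β) := by
    refine ⟨(kacAction ħ β b 0).P * (kacAction ħ β b 0).K, lin_evR (kac ħ β b 0), ?_, ?_⟩
    · rw [Module.End.mul_apply, hx.eK, map_smul, hx.eP]; simp
    · rw [Module.End.mul_apply, hy.eK, map_smul, hy.eP]; simp
  have h1 : lin (Phi (kac ħ β b 0) V) v = _ :=
    partialTrace_pair (g := braid (kacAction ħ β b 0) V.action ∘ₗ braid V.action (kacAction ħ β b 0))
      (ev := lin (evR (kac ħ β b 0))) hB v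
  have e : qpow ħ (-2 * (l * b + n * β)) =
      qpow ħ (-(l * b + n * β)) * qpow ħ (-(l * b + n * β)) := by
    rw [← qpow_add]; congr 1; ring
  have e2 : qpow ħ (-(β * n + b * l)) = qpow ħ (-(l * b + n * β)) := by congr 1; ring
  rw [h1]
  simp only [LinearMap.comp_apply, braid_tmul hv hx, braid_tmul hv hy, hYx, hYy, map_smul, map_add,
    braid_tmul hx hv, braid_tmul hy hv, braid_tmul hy hv.X, hXx, hXy, TensorProduct.map_tmul,
    LinearMap.id_apply, TensorProduct.tmul_zero, TensorProduct.zero_tmul, smul_zero, add_zero,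
    map_zero, TensorProduct.rid_tmul, hBx, hBy, LinearMap.fst_apply,
    LinearMap.snd_apply, e, e2, zero_smul, TensorProduct.tmul_smul, qpow_shift₁, qpow_shift₂, qpow_shift₃, qpow_shift₄,
    qpow_shift₅, qnum]
  have a := qpow_ne_zero ħ l
  have b := qpow_ne_zero ħ β
  have c := qdiff_ne_zero ħ
  rcases hv.sign with rfl | rfl <;> simp only [sgn] <;> match_scalars <;> field_simp <;> ring

end IntWeightModule

/-! ### Root of unity sums, Kirby colors and relative modularity -/

namespace IntWeight

namespace IsPeriod

variable {ħ γ : ℂ} {R : ℕ}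

/-- A full geometric sum of powers of q^{−2Nγ}, an R-th root of unity different from 1. -/
lemma sum_qpow (H : IsPeriod ħ γ R) {N : ℤ} (hN : ¬(R : ℤ) ∣ N) :
    ∑ k : Fin R, qpow ħ (-2 * (N * (k * γ))) = 0 := by
  have h1 : ∀ k : ℕ, qpow ħ (-2 * (N * (k * γ))) = qpow ħ (-2 * (N * γ)) ^ k := fun k => by
    rw [qpow, qpow, ← Complex.exp_nat_mul]
    congr 1
    ring
  have h2 : qpow ħ (-2 * (N * γ)) ^ R = 1 := by
    rw [← h1, ← H.qpow_int_mul (-2 * N)]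
    congr 1
    push_cast
    ring
  have h3 : qpow ħ (-2 * (N * γ)) - 1 ≠ 0 := fun h => by
    obtain ⟨n, hn⟩ := H.qpow_eq_one_iff.mp (sub_eq_zero.mp h)
    have h4 : (-2 * N : ℂ) * γ = (n * R) * γ := by linear_combination hn
    have h5 : -2 * N = n * R := by exact_mod_cast mul_right_cancel₀ H.ne_zero h4
    -- Here oddness of R is needed: R dividing 2N must imply that R divides N.
    have h6 : IsCoprime (R : ℤ) 2 := by
      rw [Int.isCoprime_iff_gcd_eq_one]
      exact H.odd.coprime_two_right
    exact hN (h6.dvd_of_dvd_mul_left ⟨-n, by linarith⟩)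
  rw [Fin.sum_univ_eq_sum_range (fun k : ℕ => qpow ħ (-2 * (N * (k * γ)))) R,
    Finset.sum_congr rfl fun k _ => h1 k]
  have h4 := geom_sum_mul (qpow ħ (-2 * (N * γ))) R
  rw [h2, sub_self] at h4
  exact (mul_eq_zero.mp h4).resolve_right h3

end IsPeriod

end IntWeight

namespace IntWeightModule

open IntWeight IntAction RelMod

variable {ħ γ : ℂ} {R : ℕ} {V W : IntWeightModule ħ} {l : ℂ} {a a' : ℤ}

lemma kacAction_K (v : ℂ × ℂ) : (kacAction ħ l a 0).K v = qpow ħ l • v :=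
  qpowEnd_apply ħ (kacAction_E v)

lemma kacAction_Kinv (v : ℂ × ℂ) : (kacAction ħ l a 0).Kinv v = (qpow ħ l)⁻¹ • v := by
  rw [← qpow_neg]
  exact qpowEnd_apply ħ (by rw [LinearMap.neg_apply, kacAction_E, neg_smul])

lemma isWt_dual_kac_fst : IsWt (dual (kacAction ħ l a 0)) 1 (-l) (-a) (LinearMap.fst ℂ ℂ ℂ) where
  sign := Or.inl rfl
  eP := LinearMap.ext fun v => by simp [kacAction_P, paritySign]
  eE := LinearMap.ext fun v => by simp [kacAction_E]
  eG := LinearMap.ext fun v => by simp [kacAction_G]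

lemma isWt_dual_kac_snd :
    IsWt (dual (kacAction ħ l a 0)) (-1) (-l) (-(a - 1)) (LinearMap.snd ℂ ℂ ℂ) where
  sign := Or.inr rfl
  eP := LinearMap.ext fun v => by simp [kacAction_P, paritySign]
  eE := LinearMap.ext fun v => by simp [kacAction_E]
  eG := LinearMap.ext fun v => by simp [kacAction_G]; ring

lemma dual_kac_X_fst : (dual (kacAction ħ l a 0)).X (LinearMap.fst ℂ ℂ ℂ) =
    -(qpow ħ l * qnum ħ l) • LinearMap.snd ℂ ℂ ℂ := LinearMap.ext fun v => by
  simp [kacAction_P, kacAction_K, kacAction_X, paritySign]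
  ring

lemma dual_kac_X_snd : (dual (kacAction ħ l a 0)).X (LinearMap.snd ℂ ℂ ℂ) = 0 :=
  LinearMap.ext fun v => by
  simp [kacAction_P, kacAction_K, kacAction_X, paritySign]

lemma dual_kac_Y_fst : (dual (kacAction ħ l a 0)).Y (LinearMap.fst ℂ ℂ ℂ) = 0 :=
  LinearMap.ext fun v => by
  simp [kacAction_P, kacAction_Kinv, kacAction_Y, paritySign]

lemma dual_kac_Y_snd : (dual (kacAction ħ l a 0)).Y (LinearMap.snd ℂ ℂ ℂ) =
    (qpow ħ l)⁻¹ • LinearMap.fst ℂ ℂ ℂ := LinearMap.ext fun v => by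
  simp [kacAction_P, kacAction_Kinv, kacAction_Y, paritySign]

/-- The action of `Y X` on `V(l, a) ⊗ V(l, a')*`. -/
lemma YX_kac_tensor_dual [Admissible ħ] (v : (ℂ × ℂ) ⊗[ℂ] Module.Dual ℂ (ℂ × ℂ)) :
    (tensor (kacAction ħ l a 0) (dual (kacAction ħ l a' 0))).Y
      ((tensor (kacAction ħ l a 0) (dual (kacAction ħ l a' 0))).X v) =
      (-qnum ħ l * (show ℂ from lin (evR (kac ħ l a 0)) v)) • coevaluation ℂ (ℂ × ℂ) 1 := by
  -- The underlying space of V(l,a)_0 does not depend on a, nor does the pivotal operator, so the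
  -- evaluation of V(l,a)_0 makes sense on V(l,a)_0 ⊗ V(l,a')_0* as a linear form.
  let ev : (ℂ × ℂ) ⊗[ℂ] Module.Dual ℂ (ℂ × ℂ) →ₗ[ℂ] ℂ := lin (evR (kac ħ l a 0))
  have hev : ∀ (x : ℂ × ℂ) (φ : Module.Dual ℂ (ℂ × ℂ)), ev (x ⊗ₜ φ) =
      qpow ħ l * φ (x.1, -x.2) := fun x φ => by
    refine (lin_evR (kac ħ l a 0) x φ).trans ?_
    change φ ((kacAction ħ l a 0).P ((kacAction ħ l a 0).K x)) = _
    rw [kacAction_K, map_smul, map_smul, kacAction_P]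
    simp [paritySign]
  change tY _ _ (tX _ _ v) = (-qnum ħ l * ev v) • coevaluation ℂ (ℂ × ℂ) 1
  have hx := isWt_kac_fst (ħ := ħ) l a
  have hy := isWt_kac_snd (ħ := ħ) l a
  have hφ := isWt_dual_kac_fst (ħ := ħ) (l := l) (a := a')
  have hψ := isWt_dual_kac_snd (ħ := ħ) (l := l) (a := a')
  have hYx : (kacAction ħ l a 0).Y ((1, 0) : ℂ × ℂ) = (0, 1) := rfl
  have hYy : (kacAction ħ l a 0).Y ((0, 1) : ℂ × ℂ) = 0 := rfl
  have hXx : (kacAction ħ l a 0).X ((1, 0) : ℂ × ℂ) = 0 := by rw [kacAction_X]; simp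
  have hXy : (kacAction ħ l a 0).X ((0, 1) : ℂ × ℂ) = qnum ħ l • ((1, 0) : ℂ × ℂ) := by
    rw [kacAction_X]; simp
  have hq := qpow_ne_zero ħ l
  induction v using TensorProduct.induction_on with
  | zero => simp
  | add x y h1 h2 => simp only [map_add, h1, h2]; module
  | tmul x φ =>
    obtain ⟨x₁, x₂⟩ := x
    obtain ⟨c, d, rfl⟩ : ∃ c d : ℂ, φ = c • LinearMap.fst ℂ ℂ ℂ + d • LinearMap.snd ℂ ℂ ℂ :=
      ⟨φ (1, 0), φ (0, 1), LinearMap.ext fun v => by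
        have e : v.1 • ((1, 0) : ℂ × ℂ) + v.2 • ((0, 1) : ℂ × ℂ) = v := by ext <;> simp
        have h := congrArg φ e
        rw [map_add, map_smul, map_smul] at h
        rw [← h]
        simp [mul_comm]⟩
    rw [hev, coevaluation_pair]
    have e : ((x₁, x₂) : ℂ × ℂ) = x₁ • ((1, 0) : ℂ × ℂ) + x₂ • ((0, 1) : ℂ × ℂ) := by
      ext <;> simp
    rw [e]
    simp only [TensorProduct.add_tmul, TensorProduct.tmul_add, ← TensorProduct.smul_tmul',
      TensorProduct.tmul_smul, map_add, map_smul, tX_tmul hx hφ, tX_tmul hx hψ, tX_tmul hy hφ,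
      tX_tmul hy hψ, hXx, hXy, dual_kac_X_fst, dual_kac_X_snd, TensorProduct.zero_tmul,
      TensorProduct.tmul_zero, tY_tmul hx hφ, tY_tmul hx hψ, tY_tmul hy hφ, tY_tmul hy hψ, hYx, hYy,
      dual_kac_Y_fst, dual_kac_Y_snd, qpow_neg, map_zero]
    simp only [LinearMap.add_apply, LinearMap.smul_apply, LinearMap.fst_apply,
      LinearMap.snd_apply, smul_eq_mul, Prod.fst_add, Prod.smul_fst, Prod.snd_add, Prod.smul_snd]
    match_scalars <;> field_simp <;> ring

lemma tensor_dual_kac_E {l l' : ℂ} (v : (ℂ × ℂ) ⊗[ℂ] Module.Dual ℂ (ℂ × ℂ)) :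
    (tensor (kacAction ħ l a 0) (dual (kacAction ħ l' a' 0))).E v = (l - l') • v := by
  have : (tensor (kacAction ħ l a 0) (dual (kacAction ħ l' a' 0))).E = (l - l') • 1 :=
    TensorProduct.ext' fun x φ => by
      have h1 : (kacAction ħ l a 0).E = l • 1 := rfl
      have h2 : (dual (kacAction ħ l' a' 0)).E = -(l' • 1) :=
        LinearMap.ext fun φ => LinearMap.ext fun v => by simp [kacAction_E]
      simp only [tensor_E, tE, h1, h2, LinearMap.add_apply, TensorProduct.map_tmul,
        LinearMap.smul_apply, LinearMap.neg_apply, Module.End.one_apply, TensorProduct.tmul_neg,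
        TensorProduct.tmul_smul, ← TensorProduct.smul_tmul']
      module
  rw [this]
  rfl

lemma isWt_coevaluation : IsWt (tensor (kacAction ħ l a 0) (dual (kacAction ħ l a' 0)))
    1 0 (a - a') (coevaluation ℂ (ℂ × ℂ) 1) := by
  rw [coevaluation_pair]
  exact ((isWt_kac_fst l a).tmul isWt_dual_kac_fst).cast (by ring) (by ring) (by ring) |>.add
    (((isWt_kac_snd l a).tmul isWt_dual_kac_snd).cast (by ring) (by ring) (by ring))

/-- On weight vectors of `V(l, a) ⊗ V(l, a')*` of weight other than `(0, a - a')`, `Y X = 0`. -/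
lemma YX_eq_zero_of_ne [Admissible ħ] {s m : ℂ} {n : ℤ}
    {v : (ℂ × ℂ) ⊗[ℂ] Module.Dual ℂ (ℂ × ℂ)}
    (hv : IsWt (tensor (kacAction ħ l a 0) (dual (kacAction ħ l a' 0))) s m n v)
    (hn : n ≠ a - a') : (tensor (kacAction ħ l a 0) (dual (kacAction ħ l a' 0))).Y
      ((tensor (kacAction ħ l a 0) (dual (kacAction ħ l a' 0))).X v) = 0 := by
  have h1 := hv.YX
  by_contra h0
  rw [YX_kac_tensor_dual] at h1 h0
  exact hn (h1.unique (isWt_coevaluation.smul _) h0).2.2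

/-- The action of the Kirby color on a weight vector. -/
lemma lin_kirbyPhi [Admissible ħ] (H : IsPeriod ħ γ R) {h : ℂ ⧸ AddSubgroup.zmultiples γ}
    (hh : h ∉ nonGeneric γ) {s : ℂ} {n : ℤ} {v : V.carrier} (hv : IsWt V.action s l n v) :
    lin ((genericSimples H).kirbyPhi hh V) v = ∑ k₁ : Fin R, ∑ k₂ : Fin R,
      (qpow ħ (-2 * (l * k₂)) * qpow ħ (-2 * (n * (h.out + k₁ * γ)))) •
        (((qpow ħ (h.out + k₁ * γ) - (qpow ħ (h.out + k₁ * γ))⁻¹)⁻¹ *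
          (qpow ħ (h.out + k₁ * γ) * (1 - qpow ħ l * qpow ħ l))) • v +
        (qdiff ħ * qpow ħ l) • V.action.Y (V.action.X v)) := by
  rw [← Fintype.sum_prod_type', ← finProdFinEquiv.symm.sum_comp, RelativeData.GenericSimples.kirbyPhi, lin_sum,
    LinearMap.sum_apply]
  refine Finset.sum_congr rfl fun k _ => ?_
  have hq : qnum ħ (cellE h k) ≠ 0 := qnum_ne_zero_of_degree H hh (mk_cellE h k)
  have hd : qpow ħ (cellE h k) - (qpow ħ (cellE h k))⁻¹ ≠ 0 := right_ne_zero_of_mul hq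
  have h1 : (mTrace ħ).dim (kac ħ (cellE h k) (cellG k) 0) (isProjective_kac hq) =
      (qpow ħ (cellE h k) - (qpow ħ (cellE h k))⁻¹)⁻¹ := by
    rw [mTrace_dim_kac hq]; simp [paritySign]
  have h2 := lin_Phi_kac (β := cellE h k) (b := cellG k) hv
  refine (congrArg₂ (fun (c : ℂ) (x : V.carrier) => c • x) h1 h2).trans ?_
  rw [show h.out + (finProdFinEquiv.symm k).1 * γ = cellE h k from rfl,
    show (((finProdFinEquiv.symm k).2 : ℕ) : ℂ) = ((cellG k : ℤ) : ℂ) by simp [cellG],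
    mul_add (-2 : ℂ), qpow_add]
  -- The modified dimension δ⁻¹ cancels the factor δ of the term with YX, so that the coefficient of
  -- YXv depends on the summation indices only through the two powers of q in front.
  generalize qpow ħ (cellE h k) - (qpow ħ (cellE h k))⁻¹ = δ at hd ⊢
  match_scalars <;> field_simp

/-- The index k₂ of the G-cell enters only through q^{−2lk₂}, and with l = Nγ this is a vanishing
root of unity sum. -/
lemma kirbyPhi_eq_zero [Admissible ħ] (H : IsPeriod ħ γ R) {h : ℂ ⧸ AddSubgroup.zmultiples γ}
    (hh : h ∉ nonGeneric γ) {s : ℂ} {n N : ℤ} {v : V.carrier}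
    (hv : IsWt V.action s (N * γ) n v) (hN : ¬(R : ℤ) ∣ N) :
    lin ((genericSimples H).kirbyPhi hh V) v = 0 := by
  rw [lin_kirbyPhi H hh hv]
  refine Finset.sum_eq_zero fun k₁ _ => ?_
  rw [← Finset.sum_smul, ← Finset.sum_mul]
  have e : ∑ k₂ : Fin R, qpow ħ (-2 * (N * γ * k₂)) = 0 := by
    rw [← H.sum_qpow hN]
    refine Finset.sum_congr rfl fun k _ => ?_
    congr 1
    ring
  rw [e, zero_mul, zero_smul]

/-- At l = 0 the coefficient 1 − q^{2l} vanishes, so only YXv remains, and the now idle sum over k₂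
contributes the factor R. -/
lemma kirbyPhi_of_zero [Admissible ħ] (H : IsPeriod ħ γ R) {h : ℂ ⧸ AddSubgroup.zmultiples γ}
    (hh : h ∉ nonGeneric γ) {s : ℂ} {n : ℤ} {v : V.carrier} (hv : IsWt V.action s 0 n v) :
    lin ((genericSimples H).kirbyPhi hh V) v =
      (R * qpow ħ (-2 * (n * h.out)) * (∑ k : Fin R, qpow ħ (-2 * (n * (k * γ)))) * qdiff ħ) •
        V.action.Y (V.action.X v) := by
  rw [lin_kirbyPhi H hh hv]
  simp only [zero_mul, mul_zero, qpow_zero, one_mul, mul_one, sub_self, zero_smul, zero_add,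
    Finset.sum_const, Finset.card_univ, Fintype.card_fin, smul_smul, ← Finset.sum_smul,
    ← Finset.smul_sum, mul_add, qpow_add]
  rw [← Finset.sum_mul, ← Finset.mul_sum, ← Nat.cast_smul_eq_nsmul ℂ, smul_smul]
  congr 1
  ring

/-- On V_i ⊗ V_j* every vector has E-weight l equal to the difference of two E-cells. Root of unity
sums eliminate the case l ≠ 0 and the case of a G-weight not divisible by R, and the surviving
multiple of YX is coevaluation after evaluation. -/
theorem relative_modularity [Admissible ħ] (H : IsPeriod ħ γ R)
    {g h : ℂ ⧸ AddSubgroup.zmultiples γ} (hg : g ∉ nonGeneric γ) (hh : h ∉ nonGeneric γ)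
    (i j : Fin (R * R)) :
    (i ≠ j → (mTrace ħ).dim (kac ħ (cellE g i) (cellG i) 0)
        (isProjective_kac (qnum_ne_zero_of_degree H hg (mk_cellE g i))) •
      (genericSimples H).kirbyPhi hh (kac ħ (cellE g i) (cellG i) 0 ⊗
        (kac ħ (cellE g j) (cellG j) 0)ᘁ) = 0) ∧
    (mTrace ħ).dim (kac ħ (cellE g i) (cellG i) 0)
        (isProjective_kac (qnum_ne_zero_of_degree H hg (mk_cellE g i))) •
      (genericSimples H).kirbyPhi hh (kac ħ (cellE g i) (cellG i) 0 ⊗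
        (kac ħ (cellE g i) (cellG i) 0)ᘁ) =
      (-(R : ℂ) ^ 2) • (evR (kac ħ (cellE g i) (cellG i) 0) ≫
        η_ (kac ħ (cellE g i) (cellG i) 0) (kac ħ (cellE g i) (cellG i) 0)ᘁ) := by
  have hnd : ∀ c d : Fin R, c ≠ d → ¬(R : ℤ) ∣ (c : ℤ) - d := fun c d hcd hdvd => by
    have h1 := c.isLt
    have h2 := d.isLt
    have h3 : (c : ℤ) - d = 0 := Int.eq_zero_of_abs_lt_dvd hdvd (by rw [abs_lt]; omega)
    exact hcd (Fin.ext (by omega))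
  constructor
  · intro hij
    suffices hz : (genericSimples H).kirbyPhi hh (kac ħ (cellE g i) (cellG i) 0 ⊗
        (kac ħ (cellE g j) (cellG j) 0)ᘁ) = 0 by rw [hz, smul_zero]
    refine lin_injective (ext_wt (tensor (kacAction ħ (cellE g i) (cellG i) 0)
      (dual (kacAction ħ (cellE g j) (cellG j) 0))) fun s l n v hv => ?_)
    by_cases h0 : v = 0
    · rw [h0]
      exact (map_zero (lin _)).trans (map_zero (lin _)).symm
    have hl : l = cellE g i - cellE g j :=
      smul_left_injective ℂ h0 (hv.eE.symm.trans (tensor_dual_kac_E v))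
    -- If the E-cells agree, l = 0 and the G-cells a, a' differ. At n = a − a', which R does not
    -- divide, the sum over the E-cells of degree h vanishes; at any other n it is YXv that
    -- vanishes. If the E-cells differ, the sum over G-cells vanishes.
    by_cases h1 : (finProdFinEquiv.symm i).1 = (finProdFinEquiv.symm j).1
    · have hE : cellE g i = cellE g j := by rw [cellE, cellE, h1]
      have hl0 : l = 0 := by rw [hl, hE, sub_self]
      subst hl0
      refine (kirbyPhi_of_zero H hh (V := kac ħ (cellE g i) (cellG i) 0 ⊗
        (kac ħ (cellE g j) (cellG j) 0)ᘁ) hv).trans ?_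
      by_cases hn : n = cellG i - cellG j
      · have h2 : (finProdFinEquiv.symm i).2 ≠ (finProdFinEquiv.symm j).2 := fun h2 =>
          hij (finProdFinEquiv.symm.injective (Prod.ext h1 h2))
        rw [H.sum_qpow (N := n) (by rw [hn]; exact hnd _ _ h2), mul_zero, zero_mul, zero_smul]
        rfl
      · rw [← hE] at hv
        have h3 := YX_eq_zero_of_ne hv hn
        rw [← hE]
        refine (congrArg (_ • ·) h3).trans ?_
        exact smul_zero (A := (ℂ × ℂ) ⊗[ℂ] Module.Dual ℂ (ℂ × ℂ)) (_ : ℂ)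
    · have hl' : l = (((finProdFinEquiv.symm i).1 : ℤ) - (finProdFinEquiv.symm j).1 : ℤ) * γ := by
        rw [hl, cellE, cellE]
        push_cast
        ring
      rw [hl'] at hv
      exact kirbyPhi_eq_zero H hh (V := kac ħ (cellE g i) (cellG i) 0 ⊗
        (kac ħ (cellE g j) (cellG j) 0)ᘁ) hv (hnd _ _ h1)
  · have hq := qnum_ne_zero_of_degree H hg (mk_cellE g i)
    rw [mTrace_dim_kac hq]
    generalize cellE g i = α at hq ⊢
    generalize cellG i = a
    refine lin_injective (ext_wt (tensor (kacAction ħ α a 0)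
      (dual (kacAction ħ α a 0))) fun s l n v hv => ?_)
    by_cases h0 : v = 0
    · rw [h0]
      exact (map_zero (lin _)).trans (map_zero (lin _)).symm
    have hl : l = 0 :=
      smul_left_injective ℂ h0 (hv.eE.symm.trans ((tensor_dual_kac_E v).trans (by rw [sub_self])))
    subst hl
    let ev : (ℂ × ℂ) ⊗[ℂ] Module.Dual ℂ (ℂ × ℂ) →ₗ[ℂ] ℂ := lin (evR (kac ħ α a 0))
    have hd : qpow ħ α - (qpow ħ α)⁻¹ ≠ 0 := right_ne_zero_of_mul hq
    have h1 : (tensor (kacAction ħ α a 0) (dual (kacAction ħ α a 0))).Y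
        ((tensor (kacAction ħ α a 0) (dual (kacAction ħ α a 0))).X v) =
        (-qnum ħ α * ev v) • coevaluation ℂ (ℂ × ℂ) 1 := YX_kac_tensor_dual v
    have h2 : lin ((genericSimples H).kirbyPhi hh (kac ħ α a 0 ⊗ (kac ħ α a 0)ᘁ)) v =
        ((R : ℂ) ^ 2 * qdiff ħ) • (-qnum ħ α * ev v) • coevaluation ℂ (ℂ × ℂ) 1 := by
      refine (kirbyPhi_of_zero H hh (V := kac ħ α a 0 ⊗ (kac ħ α a 0)ᘁ) hv).trans ?_
      -- For n = 0 every term of the remaining sum is 1, which gives R · R. For n ≠ 0 both sides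
      -- vanish since YXv = 0, whether or not R divides n.
      by_cases hn : n = 0
      · subst hn
        refine (congrArg (_ • ·) h1).trans ?_
        refine congrArg (fun c : ℂ => c • ((-qnum ħ α * ev v) • coevaluation ℂ (ℂ × ℂ) 1)) ?_
        simp [qpow_zero, sq]
      · have h3 := YX_eq_zero_of_ne hv (by simpa using hn)
        refine (congrArg (_ • ·) h3).trans (Eq.trans
          (smul_zero (A := (ℂ × ℂ) ⊗[ℂ] Module.Dual ℂ (ℂ × ℂ)) (_ : ℂ)) ?_)
        rw [← h1, h3, smul_zero]
    have h3 : lin (evR (kac ħ α a 0) ≫ η_ (kac ħ α a 0) (kac ħ α a 0)ᘁ) v =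
        ev v • coevaluation ℂ (ℂ × ℂ) 1 := by
      change coevaluation ℂ (ℂ × ℂ) (ev v) = _
      rw [← map_smul, smul_eq_mul, mul_one]
    refine (congrArg (fun x : (ℂ × ℂ) ⊗[ℂ] Module.Dual ℂ (ℂ × ℂ) =>
      (paritySign 0 * (qpow ħ α - (qpow ħ α)⁻¹)⁻¹) • x) h2).trans (Eq.trans ?_
      (congrArg (fun x : (ℂ × ℂ) ⊗[ℂ] Module.Dual ℂ (ℂ × ℂ) => (-(R : ℂ) ^ 2) • x) h3).symm)
    simp only [smul_smul, paritySign, if_true, one_mul, qnum]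
    have hq' := qdiff_ne_zero ħ
    refine congrArg (fun c : ℂ => c • coevaluation ℂ (ℂ × ℂ) 1) ?_
    generalize qpow ħ α - (qpow ħ α)⁻¹ = δ at hd
    field_simp

theorem isModular [Admissible ħ] (H : IsPeriod ħ γ R) :
    (relativeData H).IsModular (nonGeneric γ) (-(R : ℂ) ^ 2) where
  toIsPreModular := isPreModular H
  ζ_ne_zero := neg_ne_zero.mpr (pow_ne_zero _ H.cast_ne_zero)
  relative_modularity := ⟨genericSimples H, fun g h hg hh i j => relative_modularity H hg hh i j⟩

end IntWeightModule

end

/-! ### The two choices of period -/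

theorem mainTheorem4 (ħ : ℂ) [IntWeight.Admissible ħ] :
    (∃ D : RelMod.RelativeData ℂ (IntWeightModule ħ)
        (ℂ ⧸ AddSubgroup.zmultiples (2 * Real.pi * Complex.I / ħ)) (ℤ × ℤ × ZMod 2),
      D.deg = IntWeightModule.eDegree ħ (AddSubgroup.zmultiples (2 * Real.pi * Complex.I / ħ)) ∧
      (∀ (n n' : ℤ) (p : ZMod 2),
        ∃ h, D.σ.obj (n, n', p) = IntWeightModule.eps ħ (2 * Real.pi * Complex.I * n / ħ) n' p h) ∧
      (∃ h, D.t.dim (IntWeightModule.kac ħ 1 0 0) h = (IntWeight.qdiff ħ)⁻¹) ∧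
      D.IsModular {g | ∃ m : ℤ, g = ((m * (Real.pi * Complex.I / ħ) : ℂ) :
        ℂ ⧸ AddSubgroup.zmultiples (2 * Real.pi * Complex.I / ħ))} (-1) ∧
      D.IsTQFTFinite) ∧
    (∀ r : ℕ, Odd r → 3 ≤ r → ħ = 2 * Real.pi * Complex.I / r →
      ∃ D : RelMod.RelativeData ℂ (IntWeightModule ħ)
        (ℂ ⧸ AddSubgroup.zmultiples (1 : ℂ)) (ℤ × ℤ × ZMod 2),
      D.deg = IntWeightModule.eDegree ħ (AddSubgroup.zmultiples (1 : ℂ)) ∧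
      (∀ (n n' : ℤ) (p : ZMod 2),
        ∃ h, D.σ.obj (n, n', p) = IntWeightModule.eps ħ (n * r) (n' * r) p h) ∧
      (∃ h, D.t.dim (IntWeightModule.kac ħ 1 0 0) h = (IntWeight.qdiff ħ)⁻¹) ∧
      D.IsModular {g | ∃ m : ℤ, g = ((m / 2 : ℂ) : ℂ ⧸ AddSubgroup.zmultiples (1 : ℂ))}
        (-(r : ℂ) ^ 2) ∧
      D.IsTQFTFinite) := by
  -- The condition carried by `eps` depends on the weight, so equality of weights has to be
  -- transported together with it.
  have eps_congr : ∀ {l l' : ℂ} {n n' : ℤ} (p : ZMod 2) {h : IntWeight.qpow ħ l = IntWeight.qpow ħ (-l)},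
      l = l' → n = n' → ∃ h', IntWeightModule.eps ħ l n p h = IntWeightModule.eps ħ l' n' p h' := by
    rintro l _ n _ p h rfl rfl
    exact ⟨h, rfl⟩
  constructor
  · have hħ : ħ ≠ 0 := by
      rintro rfl
      exact IntWeight.Admissible.exp_ne_one (ħ := 0) Complex.exp_zero
    -- With R = 1 the group γℤ of the grading is the whole period lattice of q^z, each generic
    -- degree has a single cell, and ζ = −1² = −1.
    have H : IntWeight.IsPeriod ħ (2 * Real.pi * Complex.I / ħ) 1 := ⟨odd_one, by
      push_cast
      field_simp⟩
    refine ⟨IntWeightModule.relativeData H, rfl, fun n n' p => ?_,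
      ⟨_, IntWeightModule.mTrace_dim_kac_one⟩, ?_, IntWeightModule.isTQFTFinite H⟩
    · exact eps_congr p (by push_cast; ring) (by simp)
    · have h := IntWeightModule.isModular H
      have e : (2 * Real.pi * Complex.I / ħ) / 2 = Real.pi * Complex.I / ħ := by ring
      rw [IntWeightModule.nonGeneric, e] at h
      simpa using h
  · intro r hr h3 hħ
    have hr0 : (r : ℂ) ≠ 0 := by
      exact_mod_cast (by omega : r ≠ 0)
    -- The period of q^z is now r, split as R = r times γ = 1.
    have H : IntWeight.IsPeriod ħ 1 r := ⟨hr, by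
      rw [hħ]
      field_simp⟩
    refine ⟨IntWeightModule.relativeData H, rfl, fun n n' p => ?_,
      ⟨_, IntWeightModule.mTrace_dim_kac_one⟩, ?_, IntWeightModule.isTQFTFinite H⟩
    · exact eps_congr p (by rw [mul_one]) rfl
    · have h := IntWeightModule.isModular H
      rw [IntWeightModule.nonGeneric] at h
      simpa only [mul_one_div] using h
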